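/- **Definitions.** Let $G$ be a finite group. Let $X(G)$ be the 2-dimensional simplicial complex with vertices $(x,1)$ and $(x,2)$ for $x\in G\setminus Z(G)$ whose maximal simplices are the triangles $[(x,1),(y,1),(xy,2)]$ with $xy\neq yx$. Its desingularization $Y(G)$ is the triangulated closed surface obtained by removing the vertices of $X(G)$ and filling in each puncture by its own point; thus a vertex of $Y(G)$ is a vertex $v$ of $X(G)$ together with a connected component (a circle) of the link of $v$. A vertex of $Y(G)$ is of type $i$ if it lies over a vertex $(z,i)$. The 2-cell structure of a component of $Y(G)$ is obtained by erasing the type 2 vertices and all edges containing one: its vertices are the type 1 vertices, its edges those joining two type 1 vertices, and its 2-faces the closed stars of the type 2 vertices. A cell automorphism is a bijection of the vertices (with a compatible bijection of the 2-faces) carrying edges to edges and boundaries of 2-faces to boundaries of 2-faces. The valency of a vertex is the number of edges of the 2-cell structure at it. For $c,g\in G$, the $c$-conjugacy class of $g$ is $\{c^k g c^{-k} : k\in\mathbb Z\}$. **Theorem.** Let $x,y\in G$ with $xy\ne yx$, put $\alpha=xy$, and let $T$ be the component of $Y(G)$ containing the triangle $[(x,1),(y,1),(\alpha,2)]$, with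 its 2-cell structure. Below, $(x,1)$ and $(y,1)$ denote the corners of this triangle in $T$. Then $T$ is a compact, connected, oriented 2-manifold of some genus $g$ (so that its first Betti number is $2g$), and there is $n\ge 3$ such that all 2-faces of $T$ are $n$-gons, without identifications on their boundaries. The cell automorphism group of $T$ acts transitively on the 2-faces and on the unoriented edges. Let $V,E,F$ be the numbers of vertices, edges and 2-faces of $T$, let $\lambda$ be the average of the valencies of its vertices, let $\lambda_1,\lambda_2$ be the sizes of the $x$-conjugacy class and of the $y$-conjugacy class of $\alpha$, and let $V_i$ be the number of vertices of valency $\lambda_i$. 1. If $x$ and $y$ lie in different $\alpha$-conjugacy classes, then $n$ is even, $n=2\cdot|\alpha\text{-conjugacy class of }x|$, and every vertex is in the orbit of $(x,1)$ or of $(y,1)$ under the cell automorphism group. The valency of $(x,1)$ is $\lambda_1\ge2$, that of $(y,1)$ is $\lambda_2\ge 2$, and every vertex has valency $\lambda_1$ or $\lambda_2$. If $\lambda_1\ne\lambda_2$, then $V=V_1+V_2$, $\lambda=\frac{\lambda_1V_1+\lambda_2V_2}{V_1+V_2}$, every edge joins a vertex of valency $\lambda_1$ to one of valency $\lambda_2$,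 and $E=\lambda_1V_1=\lambda_2V_2$. Moreover $\lambda\ge2$, $\lambda=\frac{2E}{V}$, and $\lambda$ is the harmonic mean of $\lambda_1,\lambda_2$: $\frac2\lambda=\frac1{\lambda_1}+\frac1{\lambda_2}$. 2. If $x$ and $y$ lie in the same $\alpha$-conjugacy class, then $n$ is odd, $n=|\alpha\text{-conjugacy class of }x|$, the cell automorphism group acts transitively on the vertices too, and all vertices have the same valency $\lambda=\lambda_1\ge2$. 3. In both cases $nF=2E$, $nF=\lambda V$, and $$2-2g=V-E+F=2\left(\frac1\lambda+\frac1n-\frac12\right)E.$$ -/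

import Mathlib

open scoped Classical

noncomputable section

namespace NoncommutingComplex

/-! ### Abstract simplicial complexes: links, sheets, desingularization, components -/

section Complexes

variable {U : Type*}

/-- The 1-skeleton of a simplicial complex. -/
def skeletonGraph (K : PreAbstractSimplicialComplex U) : SimpleGraph U where
  Adj u w := u ≠ w ∧ {u, w} ∈ K.faces
  symm := ⟨fun u w h => ⟨h.1.symm, by rw [Finset.pair_comm]; exact h.2⟩⟩
  loopless := ⟨fun _ h => h.1 rfl⟩

/-- The link of the vertex `v` in a simplicial complex of dimension 2, as a graph:
`u` and `w` are joined when `v, u, w` span a triangle. -/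
def linkGraph (K : PreAbstractSimplicialComplex U) (v : U) : SimpleGraph U where
  Adj u w := u ≠ v ∧ w ≠ v ∧ u ≠ w ∧ {v, u, w} ∈ K.faces
  symm := ⟨fun u w h => ⟨h.2.1, h.1, h.2.2.1.symm, by rw [Finset.pair_comm]; exact h.2.2.2⟩⟩
  loopless := ⟨fun _ h => h.2.2.1 rfl⟩

/-- A vertex `v` together with a connected component of its link. When the component is a circle of
the link, this is a sheet of the closed star of `v`, that is, a puncture at `v`. (A vertex outside
the link of `v` forms a component of its own; such pairs lie in no simplex of the
desingularization.) -/
abbrev Sheet (K : PreAbstractSimplicialComplex U) : Type _ :=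
  Σ v : U, (linkGraph K v).ConnectedComponent

instance [Finite U] (K : PreAbstractSimplicialComplex U) (v : U) :
    Finite (linkGraph K v).ConnectedComponent :=
  inferInstanceAs (Finite (Quot _))

instance [Finite U] (K : PreAbstractSimplicialComplex U) : Fintype (Sheet K) :=
  Fintype.ofFinite _

/-- The sheet of the closed star of `v` that contains the edge from `v` to `u`. -/
def sheetAt (K : PreAbstractSimplicialComplex U) (v u : U) : Sheet K :=
  ⟨v, (linkGraph K v).connectedComponentMk u⟩

/-- The desingularization of a 2-dimensional simplicial complex, with its triangulation: the
vertices are removed and every puncture is filled in by a point of its own. The vertices are the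
sheets; the maximal simplices are the triangles `{a, b, c}` of `K`, the corner at `a` being the
sheet at `a` containing that triangle, and so on. -/
def desingularization (K : PreAbstractSimplicialComplex U) :
    PreAbstractSimplicialComplex (Sheet K) where
  faces := {s | s.Nonempty ∧ ∃ a b c : U, a ≠ b ∧ b ≠ c ∧ a ≠ c ∧ {a, b, c} ∈ K.faces ∧
    s ⊆ {sheetAt K a b, sheetAt K b c, sheetAt K c a}}
  isRelLowerSet_faces := by
    rintro s ⟨hs, a, b, c, hab, hbc, hac, h, hsub⟩
    exact ⟨hs, fun t hts ht => ⟨ht, a, b, c, hab, hbc, hac, h, hts.trans hsub⟩⟩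

/-- The connected component of the vertex `v` in a simplicial complex. -/
def component (K : PreAbstractSimplicialComplex U) (v : U) : PreAbstractSimplicialComplex U where
  faces := {s | s ∈ K.faces ∧ ∀ w ∈ s, (skeletonGraph K).Reachable v w}
  isRelLowerSet_faces := by
    rintro s ⟨hs, h⟩
    have hK := K.isRelLowerSet_faces hs
    exact ⟨hK.1, fun t hts ht => ⟨hK.2 hts ht, fun w hw => h w (hts hw)⟩⟩

end Complexes

/-! ### Geometric realization, orientation, first homology, genus -/

section Surfaces

variable {W : Type*} [Fintype W]

/-- The geometric realization in barycentric coordinates, with the subspace topology. -/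
def realization (K : PreAbstractSimplicialComplex W) : Set (W → ℝ) :=
  {p | (∀ w, 0 ≤ p w) ∧ ∑ w, p w = 1 ∧ ∃ s ∈ K.faces, Function.support p ⊆ (s : Set W)}

/-- The closed simplex spanned by `s`. -/
def closedSimplex (K : PreAbstractSimplicialComplex W) (s : Finset W) : Set (realization K) :=
  {p | Function.support p.1 ⊆ (s : Set W)}

/-- The closed star of the vertex `f`, as a subset of the geometric realization. -/
def closedStar (K : PreAbstractSimplicialComplex W) (f : W) : Set (realization K) :=
  {p | ∃ s ∈ K.faces, f ∈ s ∧ Function.support p.1 ⊆ (s : Set W)}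

/-- `o a b c = ± 1` says whether the order `a, b, c` agrees with the chosen orientation of the
triangle; the orientations of two distinct triangles cancel along a common edge. -/
def IsOrientation (K : PreAbstractSimplicialComplex W) (o : W → W → W → ℤ) : Prop :=
  (∀ a b c, o b a c = - o a b c ∧ o a c b = - o a b c) ∧
  (∀ a b c, a ≠ b → b ≠ c → a ≠ c → {a, b, c} ∈ K.faces → o a b c = 1 ∨ o a b c = -1) ∧
  (∀ a b c d, a ≠ b → b ≠ c → a ≠ c → b ≠ d → a ≠ d → c ≠ d →
    {a, b, c} ∈ K.faces → {a, b, d} ∈ K.faces → o a b c = - o a b d)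

/-- Rational simplicial 1-chains, as alternating functions supported on the edges: the oriented
edge `[a, b]` corresponds to the function with value `1` at `(a, b)` and `-1` at `(b, a)`. -/
def chains₁ (K : PreAbstractSimplicialComplex W) : Submodule ℚ (W → W → ℚ) where
  carrier := {f | (∀ a b, f b a = - f a b) ∧ ∀ a b, f a b ≠ 0 → {a, b} ∈ K.faces}
  zero_mem' := by simp
  add_mem' := by
    rintro f g ⟨hf, hf'⟩ ⟨hg, hg'⟩
    refine ⟨fun a b => by simp [hf a b, hg a b, add_comm], fun a b h => ?_⟩
    by_cases h0 : f a b = 0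
    · exact hg' a b (by simpa [h0] using h)
    · exact hf' a b h0
  smul_mem' := by
    rintro r f ⟨hf, hf'⟩
    exact ⟨fun a b => by simp [hf a b], fun a b h => hf' a b fun h0 => h (by simp [h0])⟩

/-- Rational simplicial 2-chains, as alternating functions supported on the triangles. -/
def chains₂ (K : PreAbstractSimplicialComplex W) : Submodule ℚ (W → W → W → ℚ) where
  carrier := {f | (∀ a b c, f b a c = - f a b c ∧ f a c b = - f a b c) ∧
    ∀ a b c, f a b c ≠ 0 → {a, b, c} ∈ K.faces}
  zero_mem' := by simp
  add_mem' := by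
    rintro f g ⟨hf, hf'⟩ ⟨hg, hg'⟩
    refine ⟨fun a b c => ⟨?_, ?_⟩, fun a b c h => ?_⟩
    · simp [(hf a b c).1, (hg a b c).1, add_comm]
    · simp [(hf a b c).2, (hg a b c).2, add_comm]
    · by_cases h0 : f a b c = 0
      · exact hg' a b c (by simpa [h0] using h)
      · exact hf' a b c h0
  smul_mem' := by
    rintro r f ⟨hf, hf'⟩
    exact ⟨fun a b c => ⟨by simp [(hf a b c).1], by simp [(hf a b c).2]⟩,
      fun a b c h => hf' a b c fun h0 => h (by simp [h0])⟩

/-- The boundary `[a, b] ↦ [b] - [a]`. -/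
def boundary₁ : (W → W → ℚ) →ₗ[ℚ] (W → ℚ) where
  toFun f := fun b => ∑ a, f a b
  map_add' f g := by ext; simp [Finset.sum_add_distrib]
  map_smul' r f := by ext; simp [Finset.mul_sum]

/-- The boundary `[a, b, c] ↦ [b, c] - [a, c] + [a, b]`. -/
def boundary₂ : (W → W → W → ℚ) →ₗ[ℚ] (W → W → ℚ) where
  toFun f := fun b c => ∑ a, f a b c
  map_add' f g := by ext; simp [Finset.sum_add_distrib]
  map_smul' r f := by ext; simp [Finset.mul_sum]

/-- Simplicial 1-cycles. -/
def cycles₁ (K : PreAbstractSimplicialComplex W) : Submodule ℚ (W → W → ℚ) :=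
  chains₁ K ⊓ LinearMap.ker boundary₁

/-- Simplicial 1-boundaries. -/
def boundaries₁ (K : PreAbstractSimplicialComplex W) : Submodule ℚ (W → W → ℚ) :=
  (chains₂ K).map boundary₂

/-- The first simplicial homology group with rational coefficients. -/
abbrev homology₁ (K : PreAbstractSimplicialComplex W) : Type _ :=
  cycles₁ K ⧸ (boundaries₁ K).comap (cycles₁ K).subtype

/-- The geometric realization of `K` is a compact connected orientable topological surface
(a closed 2-manifold) of genus `g`, where `2 g` is the first Betti number. -/
def IsClosedOrientedSurface (K : PreAbstractSimplicialComplex W) (g : ℕ) : Prop :=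
  CompactSpace (realization K) ∧ T2Space (realization K) ∧ ConnectedSpace (realization K) ∧
  Nonempty (ChartedSpace (EuclideanSpace ℝ (Fin 2)) (realization K)) ∧
  (∃ o, IsOrientation K o) ∧
  Module.finrank ℚ (homology₁ K) = 2 * g

end Surfaces

/-! ### The 2-cell structure obtained by erasing a set `D` of vertices -/

section Cells

variable {W : Type*} [Fintype W] (K : PreAbstractSimplicialComplex W) (D : Set W)

/-- The vertices of the 2-cell structure: the vertices that are not erased. -/
def cellVertices : Set W := {w | {w} ∈ K.faces ∧ w ∉ D}

/-- The edges of the 2-cell structure: the edges between vertices that are not erased. -/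
def cellEdges : Set (Finset W) := {e | e ∈ K.faces ∧ e.card = 2 ∧ ∀ w ∈ e, w ∉ D}

/-- The 2-faces of the 2-cell structure, given by their centers, which are the erased vertices;
the closed 2-face with center `f` is `closedStar K f`. -/
def cellFaces : Set W := {w | {w} ∈ K.faces ∧ w ∈ D}

/-- The edges on the boundary of the 2-face with center `f`. -/
def faceBoundary (f : W) : Set (Finset W) := {e | e ∈ cellEdges K D ∧ insert f e ∈ K.faces}

/-- The number of edges of the 2-cell structure at `v`. -/
def valency (v : W) : ℕ := {e | e ∈ cellEdges K D ∧ v ∈ e}.ncard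

/-- The average of the valencies of all vertices. -/
def averageValency : ℚ :=
  (∑ᶠ v ∈ cellVertices K D, (valency K D v : ℚ)) / ((cellVertices K D).ncard : ℚ)

/-- The `k`-th corner of the regular `n`-gon. -/
def corner (n k : ℕ) : ℂ := Complex.exp (2 * Real.pi * Complex.I * k / n)

/-- The regular (filled) `n`-gon. -/
def regularPolygon (n : ℕ) : Set ℂ := convexHull ℝ (Set.range (corner n))

/-- The 2-face with center `f` is an `n`-gon, without identifications on its boundary: its boundary
is a cycle of `n` distinct vertices and `n` edges, and the closed 2-face is a homeomorphic image of
the regular `n`-gon (a compact set, mapped continuously and injectively to a Hausdorff space) in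
such a way that corners correspond to vertices and sides to edges. -/
def IsNGon (n : ℕ) (f : W) : Prop :=
  ∃ (v : ℕ → W) (φ : ℂ → realization K),
    (∀ k, v (k + n) = v k) ∧ Set.InjOn v (Set.Iio n) ∧
    (∀ k, v k ∈ cellVertices K D) ∧
    faceBoundary K D f = Set.range (fun k => ({v k, v (k + 1)} : Finset W)) ∧
    (faceBoundary K D f).ncard = n ∧
    ContinuousOn φ (regularPolygon n) ∧ Set.InjOn φ (regularPolygon n) ∧
    φ '' regularPolygon n = closedStar K f ∧
    (∀ k, (φ (corner n k)).1 (v k) = 1) ∧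
    (∀ k, φ '' segment ℝ (corner n k) (corner n (k + 1)) = closedSimplex K {v k, v (k + 1)})

/-- The closed 2-faces are `n`-gons that cover the surface, and two different ones meet only along
edges of the 2-cell structure. -/
def IsNGonStructure (n : ℕ) : Prop :=
  (∀ f ∈ cellFaces K D, IsNGon K D n f) ∧
  (⋃ f ∈ cellFaces K D, closedStar K f) = Set.univ ∧
  (∀ f ∈ cellFaces K D, ∀ f' ∈ cellFaces K D, f ≠ f' →
    closedStar K f ∩ closedStar K f' ⊆ ⋃ e ∈ cellEdges K D, closedSimplex K e)

/-- The cell automorphism group: bijections of the vertices that carry edges to edges and boundaries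
of 2-faces to boundaries of 2-faces, together with the permutation of the 2-faces (two 2-faces may
have the same boundary, so that the latter need not be determined by the former). -/
def cellAut : Subgroup (Equiv.Perm (cellVertices K D) × Equiv.Perm (cellFaces K D)) where
  carrier := {φ |
    (∀ u v : cellVertices K D, ({u.1, v.1} : Finset W) ∈ cellEdges K D ↔
      ({(φ.1 u).1, (φ.1 v).1} : Finset W) ∈ cellEdges K D) ∧
    (∀ (f : cellFaces K D) (u v : cellVertices K D),
      ({u.1, v.1} : Finset W) ∈ faceBoundary K D f ↔
      ({(φ.1 u).1, (φ.1 v).1} : Finset W) ∈ faceBoundary K D (φ.2 f))}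
  one_mem' := by simp
  mul_mem' := by
    rintro φ ψ ⟨h1, h2⟩ ⟨k1, k2⟩
    refine ⟨fun u v => ?_, fun f u v => ?_⟩
    · simpa using (k1 u v).trans (h1 (ψ.1 u) (ψ.1 v))
    · simpa using (k2 f u v).trans (h2 (ψ.2 f) (ψ.1 u) (ψ.1 v))
  inv_mem' := by
    rintro φ ⟨h1, h2⟩
    refine ⟨fun u v => ?_, fun f u v => ?_⟩
    · simpa using (h1 (φ.1⁻¹ u) (φ.1⁻¹ v)).symm
    · simpa using (h2 (φ.2⁻¹ f) (φ.1⁻¹ u) (φ.1⁻¹ v)).symm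

/-- The cell automorphism group acts transitively on the 2-faces. -/
def FaceTransitive : Prop :=
  ∀ f f' : cellFaces K D, ∃ φ ∈ cellAut K D, φ.2 f = f'

/-- The cell automorphism group acts transitively on the unoriented edges. -/
def EdgeTransitive : Prop :=
  ∀ u v u' v' : cellVertices K D,
    ({u.1, v.1} : Finset W) ∈ cellEdges K D → ({u'.1, v'.1} : Finset W) ∈ cellEdges K D →
    ∃ φ ∈ cellAut K D, s(φ.1 u, φ.1 v) = s(u', v')

/-- The cell automorphism group acts transitively on the vertices. -/
def VertexTransitive : Prop :=
  ∀ u v : cellVertices K D, ∃ φ ∈ cellAut K D, φ.1 u = v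

end Cells

/-! ### The complex of a group -/

section Groups

variable {G : Type*} [Group G]

/-- The `c`-conjugacy class of `g`: its orbit under conjugation by the powers of `c`. -/
def conjClass (c g : G) : Set G := {h | ∃ k : ℤ, h = c ^ k * g * (c ^ k)⁻¹}

variable (G) in
/-- The complex `X(G)`. `Sum.inl x` is the type 1 vertex `(x, 1)` and `Sum.inr x` the type 2 vertex
`(x, 2)`; the maximal simplices are `[(x, 1), (y, 1), (x y, 2)]` with `x y ≠ y x`. (Central
elements lie in no simplex, hence give no vertices.) -/
def complexX : PreAbstractSimplicialComplex (G ⊕ G) where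
  faces := {s | s.Nonempty ∧ ∃ x y : G, x * y ≠ y * x ∧
    s ⊆ {Sum.inl x, Sum.inl y, Sum.inr (x * y)}}
  isRelLowerSet_faces := by
    rintro s ⟨hs, x, y, h, hsub⟩
    exact ⟨hs, fun t hts ht => ⟨ht, x, y, h, hts.trans hsub⟩⟩

variable (G) in
/-- The desingularization `Y(G)` of `X(G)`, with its triangulation. -/
def complexY : PreAbstractSimplicialComplex (Sheet (complexX G)) :=
  desingularization (complexX G)

variable (G) in
/-- The type 2 vertices of `Y(G)`. -/
def typeTwo : Set (Sheet (complexX G)) := {w | w.1.isRight}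

/-- The corner at `(x, 1)` of the triangle `[(x, 1), (y, 1), (x y, 2)]` in `Y(G)`. -/
def cornerFst (x y : G) : Sheet (complexX G) := sheetAt (complexX G) (Sum.inl x) (Sum.inl y)

/-- The corner at `(y, 1)` of the triangle `[(x, 1), (y, 1), (x y, 2)]` in `Y(G)`. -/
def cornerSnd (x y : G) : Sheet (complexX G) := sheetAt (complexX G) (Sum.inl y) (Sum.inl x)

/-- The corner at `(x y, 2)` of the triangle `[(x, 1), (y, 1), (x y, 2)]` in `Y(G)`. -/
def cornerTwo (x y : G) : Sheet (complexX G) :=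
  sheetAt (complexX G) (Sum.inr (x * y)) (Sum.inl x)

/-- The component `T` of `Y(G)` that contains the triangle `[(x, 1), (y, 1), (x y, 2)]`. Its 2-cell
structure is obtained by erasing the type 2 vertices. -/
def componentT (x y : G) : PreAbstractSimplicialComplex (Sheet (complexX G)) :=
  component (complexY G) (cornerFst x y)

end Groups

end NoncommutingComplex

end

open NoncommutingComplex

noncomputable section

set_option linter.unusedSectionVars false

namespace NoncommutingComplex

/-! ### The fan of sectors spanned by consecutive corners of a regular polygon -/

section Plane

variable {n : ℕ}

/-! Everything is read off from darts, the ordered pairs `(p, q)` with `p q ≠ q p`. A dart has one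
triangle in `Y(G)`, with its tail over `(p, 1)`, its head over `(q, 1)` and its third corner over
`(p q, 2)`. Walking around the tail is the permutation `turn : (p, q) ↦ (p, p q p⁻¹)`, walking
around the type 2 corner is `rotate : (p, q) ↦ (q, q⁻¹ p q)`, and crossing the edge is the swap.
Vertices, 2-faces and edges of the 2-cell structure are the cycles of these three permutations
(`dartTail_eq_iff`, `dartFace_eq_iff`, `dartEdge_eq_iff`).

Each move is a simultaneous conjugation by an element of `⟨x, y⟩`, possibly combined with a swap.
Hence the darts of `T` are the conjugates of `(x, y)` and `(y, x)` under `⟨x, y⟩`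
(`mem_componentT_faces_iff`), this group acts on `T` by cell automorphisms, and transitivity on
edges and faces follows. Two steps of `rotate` are conjugation by `α⁻¹`, so the period of the square
of `rotate` is the size of the `α`-class of `x`, and the period `n` of `rotate` is odd exactly when
`y` lies in that class (`mem_conjClass_mul_iff_odd`). In the odd case a power of `α` carries `(x,
1)` to `(y, 1)`, which gives vertex transitivity. The valency at the tail of `(p, q)` is the period
of `turn`, the size of the `p`-class of `q`, or equally of `p q`.

All vertex links are circles (`hasCircleLink_dartFace`, `hasCircleLink_dartTail`). An explicit map,
linear on each sector of a regular polygon, then turns open stars into planes and closed stars into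
polygons (`exists_chart`, `exists_polygon`).

Connectedness determines the image of the first boundary map, and crossing edges spreads the
coefficient of one triangle of a 2-cycle to all others, so the 2-cycles form a line
(`finrank_cycles₂`). Rank counting gives the first Betti number `2 - V + E - F`. That it is even is
proved with signs: `rotate`, swap and `turn` compose to the identity, and the sign of each is fixed
by its number of cycles (`even_ncard_add`). The remaining formulas count the darts as `2 E = n F = λ
V`; if `λ₁ ≠ λ₂`, the swap exchanges the darts leaving the two kinds of vertices, whence `E = λ₁ V₁
= λ₂ V₂`. -/

theorem corner_eq_exp (n k : ℕ) :
    corner n k = Complex.exp ((2 * Real.pi * k / n : ℝ) * Complex.I) := by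
  unfold corner
  congr 1
  push_cast
  ring

theorem corner_re (n k : ℕ) : (corner n k).re = Real.cos (2 * Real.pi * k / n) := by
  rw [corner_eq_exp, Complex.exp_ofReal_mul_I_re]

theorem corner_im (n k : ℕ) : (corner n k).im = Real.sin (2 * Real.pi * k / n) := by
  rw [corner_eq_exp, Complex.exp_ofReal_mul_I_im]

theorem corner_add (n j k : ℕ) : corner n (j + k) = corner n j * corner n k := by
  unfold corner
  rw [← Complex.exp_add]
  congr 1
  push_cast
  ring

theorem corner_self (hn : 3 ≤ n) : corner n n = 1 := by
  unfold corner
  have : (n : ℂ) ≠ 0 := by norm_cast; omega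
  rw [mul_div_assoc, div_self this, mul_one, Complex.exp_two_pi_mul_I]

theorem corner_add_period (hn : 3 ≤ n) (k : ℕ) : corner n (k + n) = corner n k := by
  rw [corner_add, corner_self hn, mul_one]

theorem corner_mul_conj (n k : ℕ) : corner n k * (starRingEnd ℂ) (corner n k) = 1 := by
  rw [Complex.mul_conj, Complex.normSq_apply, corner_re, corner_im]
  norm_cast
  nlinarith [Real.sin_sq_add_cos_sq (2 * Real.pi * k / n)]

theorem sin_two_pi_div_pos (hn : 3 ≤ n) : 0 < Real.sin (2 * Real.pi / n) := by
  have hn' : (3 : ℝ) ≤ n := by exact_mod_cast hn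
  apply Real.sin_pos_of_pos_of_lt_pi
  · positivity
  · rw [div_lt_iff₀ (by positivity)]
    nlinarith [Real.pi_pos]

/-- The coefficient of `corner n (k + 1)` in the basis `corner n k, corner n (k + 1)`. -/
def sectorSnd (n k : ℕ) : ℂ →ₗ[ℝ] ℝ :=
  (Real.sin (2 * Real.pi / n))⁻¹ •
    Complex.imLm ∘ₗ LinearMap.mulRight ℝ ((starRingEnd ℂ) (corner n k))

/-- The coefficient of `corner n k` in the basis `corner n k, corner n (k + 1)`. -/
def sectorFst (n k : ℕ) : ℂ →ₗ[ℝ] ℝ :=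
  Complex.reLm ∘ₗ LinearMap.mulRight ℝ ((starRingEnd ℂ) (corner n k)) -
    Real.cos (2 * Real.pi / n) • sectorSnd n k

theorem sectorSnd_apply (n k : ℕ) (z : ℂ) : sectorSnd n k z =
    (Real.sin (2 * Real.pi / n))⁻¹ * (z * (starRingEnd ℂ) (corner n k)).im := rfl

theorem sectorFst_apply (n k : ℕ) (z : ℂ) : sectorFst n k z =
    (z * (starRingEnd ℂ) (corner n k)).re - Real.cos (2 * Real.pi / n) * sectorSnd n k z := rfl

theorem corner_one_re (n : ℕ) : (corner n 1).re = Real.cos (2 * Real.pi / n) := by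
  rw [corner_re]; simp

theorem corner_one_im (n : ℕ) : (corner n 1).im = Real.sin (2 * Real.pi / n) := by
  rw [corner_im]; simp

/-- Multiplication by the conjugate of `corner n k` reduces to the basis `1, corner n 1`, where the
second coefficient is read from the imaginary part because `sin (2 π / n) ≠ 0`. -/
theorem sector_decomp (hn : 3 ≤ n) (k : ℕ) (z : ℂ) :
    sectorFst n k z • corner n k + sectorSnd n k z • corner n (k + 1) = z := by
  have hs := (sin_two_pi_div_pos hn).ne'
  have h1 : (sectorFst n k z : ℂ) + sectorSnd n k z * corner n 1 =
      z * (starRingEnd ℂ) (corner n k) := by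
    apply Complex.ext
    · simp only [Complex.add_re, Complex.ofReal_re, Complex.re_ofReal_mul, corner_one_re,
        sectorFst_apply]
      ring
    · simp only [Complex.add_im, Complex.ofReal_im, Complex.im_ofReal_mul, corner_one_im,
        sectorSnd_apply, zero_add]
      field_simp
  calc _ = ((sectorFst n k z : ℂ) + sectorSnd n k z * corner n 1) * corner n k := by
        rw [corner_add, Complex.real_smul, Complex.real_smul]; ring
    _ = z * (corner n k * (starRingEnd ℂ) (corner n k)) := by rw [h1]; ring
    _ = z := by rw [corner_mul_conj, mul_one]

theorem sectorFst_comb (hn : 3 ≤ n) (k : ℕ) (a b : ℝ) :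
    sectorFst n k (a • corner n k + b • corner n (k + 1)) = a ∧
    sectorSnd n k (a • corner n k + b • corner n (k + 1)) = b := by
  have hs := (sin_two_pi_div_pos hn).ne'
  have h : (a • corner n k + b • corner n (k + 1)) * (starRingEnd ℂ) (corner n k) =
      a + b * corner n 1 := by
    rw [corner_add, Complex.real_smul, Complex.real_smul]
    linear_combination (a + b * corner n 1) * corner_mul_conj n k
  have hb : sectorSnd n k (a • corner n k + b • corner n (k + 1)) = b := by
    rw [sectorSnd_apply, h]
    simp only [Complex.add_im, Complex.ofReal_im, Complex.im_ofReal_mul, corner_one_im, zero_add]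
    field_simp
  refine ⟨?_, hb⟩
  rw [sectorFst_apply, hb, h]
  simp [corner_one_re]
  ring

/-- Among the odd multiples of `π / n`, the cosine is largest exactly at the multiples nearest to
those of `2 π`. -/
theorem cos_odd_mul_le (hn : 3 ≤ n) (m : ℤ) :
    Real.cos ((2 * m - 1) * (Real.pi / n)) ≤ Real.cos (Real.pi / n) ∧
    (Real.cos ((2 * m - 1) * (Real.pi / n)) = Real.cos (Real.pi / n) →
      (n : ℤ) ∣ m ∨ (n : ℤ) ∣ m - 1) := by
  have hn' : (3 : ℝ) ≤ n := by exact_mod_cast hn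
  have hn0 : (n : ℝ) ≠ 0 := by positivity
  have hpi := Real.pi_pos
  constructor
  -- Only the residue `r` matters. For `r = 0` the angle is `-π / n`; for `1 ≤ r ≤ n - 1` it lies
  -- between `π / n` and `2 π - π / n`, and after a reflection at `π` the cosine is monotone.
  · set r := m % n with hr
    have hr0 : 0 ≤ r := Int.emod_nonneg _ (by omega)
    have hrn : r < n := Int.emod_lt_of_pos _ (by omega)
    have hm : (m : ℝ) = r + n * ((m / n : ℤ) : ℝ) := by
      have := Int.emod_add_mul_ediv m n
      exact_mod_cast this.symm
    have h1 : (2 * (m : ℝ) - 1) * (Real.pi / n) =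
        (2 * r - 1) * (Real.pi / n) + (m / n : ℤ) * (2 * Real.pi) := by
      rw [hm]; field_simp; ring
    rw [h1, Real.cos_add_int_mul_two_pi, ← Real.cos_abs ((2 * (r : ℝ) - 1) * (Real.pi / n))]
    set t := Real.pi / n with ht
    have htp : 0 < t := by positivity
    have htn : n * t = Real.pi := by rw [ht]; field_simp
    have hrn' : (r : ℝ) + 1 ≤ n := by exact_mod_cast hrn
    rcases eq_or_lt_of_le hr0 with h0 | h0
    · rw [← h0]
      simp
    · have h0' : (1 : ℝ) ≤ r := by exact_mod_cast h0
      rw [abs_of_nonneg (by nlinarith)]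
      rcases le_total ((2 * (r : ℝ) - 1) * t) Real.pi with h | h
      · exact Real.cos_le_cos_of_nonneg_of_le_pi htp.le h (by nlinarith)
      · rw [← Real.cos_two_pi_sub]
        exact Real.cos_le_cos_of_nonneg_of_le_pi htp.le (by linarith) (by nlinarith)
  · intro h
    rw [Real.cos_eq_cos_iff] at h
    have hpos : Real.pi / n ≠ 0 := by positivity
    have htn : Real.pi = n * (Real.pi / n) := by field_simp
    obtain ⟨k, h | h⟩ := h
    · right
      refine ⟨-k, ?_⟩
      have : (m : ℝ) - 1 = n * -k := by
        apply mul_right_cancel₀ hpos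
        rw [htn, mul_div_cancel_left₀ _ hn0] at h
        linarith
      exact_mod_cast this
    · left
      refine ⟨k, ?_⟩
      have : (m : ℝ) = n * k := by
        apply mul_right_cancel₀ hpos
        rw [htn, mul_div_cancel_left₀ _ hn0] at h
        linarith
      exact_mod_cast this

/-- The sum of the two sector coordinates is the linear functional equal to `1` on the line through
side `k`. Its value at `corner n j` is `cos ((2 (j - k) - 1) π / n) / cos (π / n)`, so that line
supports the polygon and touches no other corners. -/
theorem sector_sum_corner (hn : 3 ≤ n) (k j : ℕ) :
    sectorFst n k (corner n j) + sectorSnd n k (corner n j) ≤ 1 ∧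
    (sectorFst n k (corner n j) + sectorSnd n k (corner n j) = 1 →
      j ≡ k [MOD n] ∨ j ≡ k + 1 [MOD n]) := by
  have hn' : (3 : ℝ) ≤ n := by exact_mod_cast hn
  have hpi := Real.pi_pos
  have hs := sin_two_pi_div_pos hn
  have hc : 0 < Real.cos (Real.pi / n) := by
    apply Real.cos_pos_of_mem_Ioo
    constructor
    · have : 0 < Real.pi / n := by positivity
      linarith
    · rw [div_lt_div_iff₀ (by positivity) (by positivity)]
      nlinarith
  have key : sectorFst n k (corner n j) + sectorSnd n k (corner n j) =
      Real.cos ((2 * ((j : ℤ) - k : ℤ) - 1) * (Real.pi / n)) / Real.cos (Real.pi / n) := by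
    have h2 : 2 * Real.pi / n = 2 * (Real.pi / n) := by ring
    have h3 : (2 * (((j : ℤ) - k : ℤ) : ℝ) - 1) * (Real.pi / n) =
      2 * Real.pi * j / n - 2 * Real.pi * k / n - Real.pi / n := by push_cast; ring
    have h4 := Real.sin_two_mul (Real.pi / n)
    have h5 := Real.cos_two_mul' (Real.pi / n)
    have hs' := hs
    rw [h2, h4] at hs'
    have h6 : Real.sin (Real.pi / n) ≠ 0 := by
      intro h; rw [h] at hs'; simp at hs'
    rw [sectorFst_apply, sectorSnd_apply, h3, Real.cos_sub, Real.cos_sub, Real.sin_sub,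
      h2, h4, h5]
    simp only [Complex.mul_re, Complex.mul_im, Complex.conj_re, Complex.conj_im, corner_re,
      corner_im]
    have h7 := Real.sin_sq_add_cos_sq (Real.pi / n)
    field_simp
    generalize Real.sin (Real.pi / n) = s at *
    generalize Real.cos (Real.pi / n) = c at *
    generalize Real.sin (2 * Real.pi * j / n) = s1 at *
    generalize Real.cos (2 * Real.pi * j / n) = c1 at *
    generalize Real.sin (2 * Real.pi * k / n) = s2 at *
    generalize Real.cos (2 * Real.pi * k / n) = c2 at *
    linear_combination (-(c2 * s1 - c1 * s2)) * h7
  obtain ⟨h1, h2⟩ := cos_odd_mul_le hn ((j : ℤ) - k)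
  rw [key]
  refine ⟨(div_le_one hc).2 h1, fun h => ?_⟩
  rw [div_eq_one_iff_eq hc.ne'] at h
  rcases h2 h with h | h
  · left
    exact ((Nat.modEq_iff_dvd).2 h).symm
  · right
    refine ((Nat.modEq_iff_dvd).2 ?_).symm
    push_cast
    rwa [← sub_sub]

theorem periodic_congr {M : Type*} {e : ℕ → M} (he : ∀ k, e (k + n) = e k) {j k : ℕ}
    (h : j ≡ k [MOD n]) : e j = e k := by
  have : Function.Periodic e n := he
  rw [← this.map_mod_nat j, ← this.map_mod_nat k, h]

/-! ### Piecewise linear maps on the fan of sectors -/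

section PiecewiseLinear

variable {M : Type*} [AddCommGroup M] [Module ℝ M]

theorem sector_corner_transfer (hn : 3 ≤ n) {e : ℕ → M} (he : ∀ k, e (k + n) = e k)
    {k j : ℕ} (h : sectorFst n k (corner n j) + sectorSnd n k (corner n j) = 1) :
    e j = sectorFst n k (corner n j) • e k + sectorSnd n k (corner n j) • e (k + 1) := by
  rcases (sector_sum_corner hn k j).2 h with h | h
  · have h1 := sectorFst_comb hn k 1 0
    simp only [one_smul, zero_smul, add_zero] at h1
    rw [periodic_congr he h, periodic_congr (corner_add_period hn) h, h1.1, h1.2]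
    simp
  · have h1 := sectorFst_comb hn k 0 1
    simp only [one_smul, zero_smul, zero_add] at h1
    rw [periodic_congr he h, periodic_congr (corner_add_period hn) h, h1.1, h1.2]
    simp

/-- This makes the piecewise linear map well defined where sectors meet, without listing which
sectors meet. The functional of side `k` is at most `1` at corners, which gives `a + b ≤ a' + b'`;
by symmetry equality holds throughout. So a corner with nonzero coefficient on one side is an end of
the side used on the other. -/
theorem sector_comb_unique (hn : 3 ≤ n) {e : ℕ → M} (he : ∀ k, e (k + n) = e k)
    {k j : ℕ} {a b a' b' : ℝ} (ha : 0 ≤ a) (hb : 0 ≤ b) (ha' : 0 ≤ a') (hb' : 0 ≤ b')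
    (h : a • corner n k + b • corner n (k + 1) = a' • corner n j + b' • corner n (j + 1)) :
    a • e k + b • e (k + 1) = a' • e j + b' • e (j + 1) := by
  have hle : ∀ {k j : ℕ} {a b a' b' : ℝ}, 0 ≤ a' → 0 ≤ b' →
      a • corner n k + b • corner n (k + 1) = a' • corner n j + b' • corner n (j + 1) →
      a + b = a' * (sectorFst n k (corner n j) + sectorSnd n k (corner n j)) +
        b' * (sectorFst n k (corner n (j + 1)) + sectorSnd n k (corner n (j + 1))) := by
    intro k j a b a' b' ha' hb' h
    have h1 := sectorFst_comb hn k a b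
    rw [h, map_add, map_add, map_smul, map_smul, map_smul, map_smul] at h1
    simp only [smul_eq_mul] at h1
    linarith
  have e1 := hle ha' hb' h
  have e2 := hle ha hb h.symm
  have i1 := (sector_sum_corner hn k j).1
  have i2 := (sector_sum_corner hn k (j + 1)).1
  have i3 := (sector_sum_corner hn j k).1
  have i4 := (sector_sum_corner hn j (k + 1)).1
  -- Equality forces either a zero coefficient or a corner on the supporting line, and in the second
  -- case `sector_corner_transfer` rewrites `e i`.
  have tr : ∀ (t : ℝ) (i : ℕ),
      t * (sectorFst n k (corner n i) + sectorSnd n k (corner n i)) = t →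
      t • e i = t • (sectorFst n k (corner n i) • e k + sectorSnd n k (corner n i) • e (k + 1)) := by
    intro t i hi
    rcases eq_or_ne t 0 with h0 | h0
    · simp [h0]
    · rw [← sector_corner_transfer hn he (mul_left_cancel₀ h0 (hi.trans (mul_one t).symm))]
  have j1 := mul_le_mul_of_nonneg_left i1 ha'
  have j2 := mul_le_mul_of_nonneg_left i2 hb'
  have j3 := mul_le_mul_of_nonneg_left i3 ha
  have j4 := mul_le_mul_of_nonneg_left i4 hb
  rw [tr a' j (by linarith), tr b' (j + 1) (by linarith)]
  have h1 := sectorFst_comb hn k a b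
  rw [h, map_add, map_add, map_smul, map_smul, map_smul, map_smul] at h1
  simp only [smul_eq_mul] at h1
  rw [← h1.1, ← h1.2]
  module

/-- Every point of the plane lies in a sector. -/
theorem exists_sector (hn : 3 ≤ n) (z : ℂ) :
    ∃ k < n, 0 ≤ sectorFst n k z ∧ 0 ≤ sectorSnd n k z := by
  have hn' : (3 : ℝ) ≤ n := by exact_mod_cast hn
  have hpi := Real.pi_pos
  have hs := sin_two_pi_div_pos hn
  set φ := 2 * Real.pi / n with hφ
  have hφ0 : 0 < φ := by positivity
  have hφn : n * φ = 2 * Real.pi := by rw [hφ]; field_simp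
  have hφπ : φ ≤ Real.pi := by nlinarith
  -- The sector index is the number of full steps `φ` in the argument, possibly negative, taken
  -- modulo `n`; the remaining angle `δ` lies in `[0, φ)`, so both `sin δ` and `sin (φ - δ)` are
  -- nonnegative.
  set k₀ := ⌊z.arg / φ⌋ with hk₀
  set δ := z.arg - k₀ * φ with hδ
  have hδ0 : 0 ≤ δ := by
    have := (le_div_iff₀ hφ0).1 (Int.floor_le (z.arg / φ))
    linarith
  have hδ1 : δ < φ := by
    have := (div_lt_iff₀ hφ0).1 (Int.lt_floor_add_one (z.arg / φ))
    linarith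
  have hr0 : 0 ≤ k₀ % n := Int.emod_nonneg _ (by omega)
  have hrn : k₀ % n < n := Int.emod_lt_of_pos _ (by omega)
  obtain ⟨k, hk⟩ := Int.eq_ofNat_of_zero_le hr0
  have hm : (k₀ : ℝ) = k + n * ((k₀ / n : ℤ) : ℝ) := by
    have := Int.emod_add_mul_ediv k₀ n
    rw [hk] at this
    exact_mod_cast this.symm
  have hang : z.arg - 2 * Real.pi * k / n = δ + (k₀ / n : ℤ) * (2 * Real.pi) := by
    rw [hδ, hm, hφ]; field_simp; ring
  have hre : (z * (starRingEnd ℂ) (corner n k)).re = ‖z‖ * Real.cos δ := by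
    have h1 : Real.cos (z.arg - 2 * Real.pi * k / n) = Real.cos δ := by
      rw [hang, Real.cos_add_int_mul_two_pi]
    rw [← h1, Real.cos_sub, Complex.mul_re, Complex.conj_re, Complex.conj_im, corner_re,
      corner_im, ← Complex.norm_mul_cos_arg z, ← Complex.norm_mul_sin_arg z]
    ring
  have him : (z * (starRingEnd ℂ) (corner n k)).im = ‖z‖ * Real.sin δ := by
    have h2 : Real.sin (z.arg - 2 * Real.pi * k / n) = Real.sin δ := by
      rw [hang, Real.sin_add_int_mul_two_pi]
    rw [← h2, Real.sin_sub, Complex.mul_im, Complex.conj_re, Complex.conj_im, corner_re,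
      corner_im, ← Complex.norm_mul_cos_arg z, ← Complex.norm_mul_sin_arg z]
    ring
  have hsnd : sectorSnd n k z = ‖z‖ * Real.sin δ / Real.sin φ := by
    rw [sectorSnd_apply, him, ← hφ]
    ring
  refine ⟨k, by omega, ?_, ?_⟩
  · have : sectorFst n k z = ‖z‖ * Real.sin (φ - δ) / Real.sin φ := by
      rw [sectorFst_apply, hsnd, hre, Real.sin_sub φ δ, ← hφ]
      field_simp
    rw [this]
    have := Real.sin_nonneg_of_nonneg_of_le_pi (x := φ - δ) (by linarith) (by linarith)
    positivity
  · rw [hsnd]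
    have := Real.sin_nonneg_of_nonneg_of_le_pi hδ0 (by linarith)
    positivity

/-- The piecewise linear map of the plane that is linear on each sector and maps `corner n k`
to `e k`. -/
def plMap (n : ℕ) (e : ℕ → M) (z : ℂ) : M :=
  if h : ∃ k < n, 0 ≤ sectorFst n k z ∧ 0 ≤ sectorSnd n k z then
    sectorFst n h.choose z • e h.choose + sectorSnd n h.choose z • e (h.choose + 1)
  else 0

theorem plMap_comb (hn : 3 ≤ n) {e : ℕ → M} (he : ∀ k, e (k + n) = e k) (k : ℕ) {a b : ℝ}
    (ha : 0 ≤ a) (hb : 0 ≤ b) :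
    plMap n e (a • corner n k + b • corner n (k + 1)) = a • e k + b • e (k + 1) := by
  have h := exists_sector hn (a • corner n k + b • corner n (k + 1))
  rw [plMap, dif_pos h]
  exact sector_comb_unique hn he h.choose_spec.2.1 h.choose_spec.2.2 ha hb (sector_decomp hn _ _)

theorem plMap_eq_of_sector (hn : 3 ≤ n) {e : ℕ → M} (he : ∀ k, e (k + n) = e k) {k : ℕ} {z : ℂ}
    (ha : 0 ≤ sectorFst n k z) (hb : 0 ≤ sectorSnd n k z) :
    plMap n e z = sectorFst n k z • e k + sectorSnd n k z • e (k + 1) := by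
  conv_lhs => rw [← sector_decomp hn k z]
  exact plMap_comb hn he k ha hb

/-- The finitely many closed sectors cover the plane and the map is linear on each. -/
theorem continuous_plMap [TopologicalSpace M] [ContinuousAdd M] [ContinuousSMul ℝ M]
    (hn : 3 ≤ n) {e : ℕ → M} (he : ∀ k, e (k + n) = e k) : Continuous (plMap n e) := by
  have hc : ∀ L : ℂ →ₗ[ℝ] ℝ, Continuous L := fun L => L.continuous_of_finiteDimensional
  refine LocallyFinite.continuous
    (f := fun k : Fin n => {z : ℂ | 0 ≤ sectorFst n k z ∧ 0 ≤ sectorSnd n k z})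
    (locallyFinite_of_finite _) ?_ ?_ ?_
  · refine Set.eq_univ_of_forall fun z => ?_
    obtain ⟨k, hk, h⟩ := exists_sector hn z
    exact Set.mem_iUnion.2 ⟨⟨k, hk⟩, h⟩
  · intro k
    exact (isClosed_le continuous_const (hc _)).inter (isClosed_le continuous_const (hc _))
  · intro k
    refine ContinuousOn.congr (f := fun z => sectorFst n k z • e k + sectorSnd n k z • e (k + 1))
      ?_ fun z hz => plMap_eq_of_sector hn he hz.1 hz.2
    exact (((hc _).smul continuous_const).add ((hc _).smul continuous_const)).continuousOn

end PiecewiseLinear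

/-- The sum of the corners is unchanged by multiplication with `corner n 1 ≠ 1`, so it vanishes and
the centroid is the origin. -/
theorem zero_mem_regularPolygon (hn : 3 ≤ n) : (0 : ℂ) ∈ regularPolygon n := by
  have hn' : (n : ℝ) ≠ 0 := by norm_cast; omega
  have hsum : ∑ k ∈ Finset.range n, corner n k = 0 := by
    have h1 : corner n 1 * ∑ k ∈ Finset.range n, corner n k = ∑ k ∈ Finset.range n, corner n k := by
      rw [Finset.mul_sum]
      simp_rw [← corner_add, add_comm 1]
      rw [← add_left_inj (corner n 0), ← Finset.sum_range_succ' (fun k => corner n k),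
        Finset.sum_range_succ]
      rw [corner_self hn]
      simp [corner]
    have h2 : corner n 1 ≠ 1 := by
      intro h
      have := corner_one_im n
      rw [h] at this
      exact (sin_two_pi_div_pos hn).ne this
    by_contra h
    exact h2 (mul_right_cancel₀ h (by rw [h1, one_mul]))
  have := (convex_convexHull ℝ (Set.range (corner n))).sum_mem (t := Finset.range n)
    (w := fun _ => (n : ℝ)⁻¹) (z := corner n) (fun _ _ => by positivity)
    (by simp [hn']) (fun k _ => subset_convexHull _ _ ⟨k, rfl⟩)
  rwa [← Finset.smul_sum, hsum, smul_zero] at this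

/-- The piecewise linear map with value `1` at all corners is the gauge of the polygon: the
half-plane of the relevant side gives one direction, a convex combination of two corners and the
center the other. -/
theorem mem_regularPolygon_iff (hn : 3 ≤ n) (z : ℂ) :
    z ∈ regularPolygon n ↔ plMap n (fun _ => (1 : ℝ)) z ≤ 1 := by
  obtain ⟨k, -, ha, hb⟩ := exists_sector hn z
  rw [plMap_eq_of_sector hn (fun _ => rfl) ha hb]
  simp only [smul_eq_mul, mul_one]
  constructor
  · intro hz
    have hsub : regularPolygon n ⊆ {z | (sectorFst n k + sectorSnd n k) z ≤ 1} := by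
      refine convexHull_min ?_ (convex_halfSpace_le (sectorFst n k + sectorSnd n k).isLinear 1)
      rintro _ ⟨j, rfl⟩
      exact (sector_sum_corner hn k j).1
    exact hsub hz
  · intro h
    rw [← sector_decomp hn k z]
    have hc := convex_convexHull ℝ (Set.range (corner n))
    have := hc.sum_mem (t := Finset.univ) (w := ![sectorFst n k z, sectorSnd n k z,
      1 - (sectorFst n k z + sectorSnd n k z)]) (z := ![corner n k, corner n (k + 1), 0])
      (by intro i _; fin_cases i <;> simp [ha, hb, h])
      (by simp [Fin.sum_univ_three])
      (by
        intro i _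
        fin_cases i
        · exact subset_convexHull _ _ ⟨k, rfl⟩
        · exact subset_convexHull _ _ ⟨k + 1, rfl⟩
        · exact zero_mem_regularPolygon hn)
    rw [regularPolygon]
    simpa [Fin.sum_univ_three] using this

end Plane

/-! ### Topology of the geometric realization -/

section Topology

variable {W : Type*} [Fintype W] {K : PreAbstractSimplicialComplex W}

theorem isCompact_realization (K : PreAbstractSimplicialComplex W) :
    IsCompact (realization K) := by
  have h : realization K = ⋃ s ∈ K.faces,
      stdSimplex ℝ W ∩ {p | Function.support p ⊆ (s : Set W)} := by
    ext p
    simp only [realization, stdSimplex, Set.mem_ofPred_eq, Set.mem_iUnion, Set.mem_inter_iff]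
    tauto
  rw [h]
  refine (Set.toFinite K.faces).isCompact_biUnion fun s _ => (isCompact_stdSimplex ℝ W).inter_right ?_
  have : {p : W → ℝ | Function.support p ⊆ (s : Set W)} = ⋂ w ∈ (sᶜ : Finset W), {p | p w = 0} := by
    ext p
    simp only [Function.support_subset_iff', Set.mem_ofPred_eq, Set.mem_iInter, Finset.mem_compl,
      Finset.mem_coe]
  rw [this]
  exact isClosed_biInter fun w _ => isClosed_eq (continuous_apply w) continuous_const

theorem single_mem_realization {w : W} (hw : {w} ∈ K.faces) :
    (Pi.single w 1 : W → ℝ) ∈ realization K := by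
  refine ⟨fun v => ?_, by simp, {w}, hw, ?_⟩
  · by_cases h : v = w
    · subst h; simp
    · simp [h]
  · intro v hv
    by_contra h
    exact hv (by simp at h; simp [h])

theorem segment_subset_realization {s : Finset W} (hs : s ∈ K.faces) {p q : W → ℝ}
    (hp : p ∈ stdSimplex ℝ W) (hq : q ∈ stdSimplex ℝ W) (hps : Function.support p ⊆ (s : Set W))
    (hqs : Function.support q ⊆ (s : Set W)) : segment ℝ p q ⊆ realization K := by
  rintro r hr
  have h1 := (convex_stdSimplex ℝ W).segment_subset hp hq hr
  refine ⟨h1.1, h1.2, s, hs, ?_⟩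
  obtain ⟨a, b, -, -, -, rfl⟩ := hr
  intro w hw
  by_contra h
  have e1 : p w = 0 := by_contra fun h' => h (hps h')
  have e2 : q w = 0 := by_contra fun h' => h (hqs h')
  exact hw (by simp [e1, e2])

/-- Walks in the 1-skeleton give paths between vertices, and each point is joined by a segment to a
vertex of a simplex carrying it. -/
theorem connectedSpace_realization {v : W} (hv : {v} ∈ K.faces)
    (hreach : ∀ w, {w} ∈ K.faces → (skeletonGraph K).Reachable v w) :
    ConnectedSpace (realization K) := by
  have hstd : ∀ w : W, (Pi.single w 1 : W → ℝ) ∈ stdSimplex ℝ W := single_mem_stdSimplex ℝ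
  have hsupp : ∀ {w : W} {s : Finset W}, w ∈ s →
      Function.support (Pi.single w 1 : W → ℝ) ⊆ (s : Set W) := by
    intro w s hw u hu
    by_cases h : u = w
    · rwa [h]
    · exact absurd (by simp [h]) hu
  have h1 : ∀ w, (skeletonGraph K).Reachable v w →
      JoinedIn (realization K) (Pi.single v 1) (Pi.single w 1) := by
    rintro w ⟨p⟩
    induction p with
    | nil => exact JoinedIn.refl (single_mem_realization hv)
    | @cons a b c h p ih =>
      have hb : {b} ∈ K.faces := (K.isRelLowerSet_faces h.2).2 (by simp) (by simp)
      refine JoinedIn.trans (JoinedIn.of_segment_subset ?_) (ih hb fun w hw => ?_)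
      · exact segment_subset_realization h.2 (hstd _) (hstd _) (hsupp (by simp)) (hsupp (by simp))
      · exact (SimpleGraph.Adj.reachable h).symm.trans (hreach w hw)
  rw [← isConnected_iff_connectedSpace]
  refine IsPathConnected.isConnected ⟨_, single_mem_realization hv, fun {p} hp => ?_⟩
  obtain ⟨s, hs, hps⟩ := hp.2.2
  obtain ⟨w, hw⟩ := (K.isRelLowerSet_faces hs).1
  refine (h1 w (hreach w ((K.isRelLowerSet_faces hs).2 (by simpa using hw) (by simp)))).trans
    (JoinedIn.of_segment_subset ?_)
  exact segment_subset_realization hs (hstd _) ⟨hp.1, hp.2.1⟩ (hsupp hw) hps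

/-! ### Vertices whose link is a circle -/

/-- The link of the vertex `w` is the circle with vertices `u 0, …, u (n - 1)`. -/
structure HasCircleLink (K : PreAbstractSimplicialComplex W) (w : W) (n : ℕ) (u : ℕ → W) :
    Prop where
  three_le : 3 ≤ n
  periodic : ∀ k, u (k + n) = u k
  injOn : Set.InjOn u (Set.Iio n)
  ne : ∀ k, u k ≠ w
  mem_faces_iff : ∀ s : Finset W, w ∈ s → (s ∈ K.faces ↔ ∃ k, s ⊆ {w, u k, u (k + 1)})

namespace HasCircleLink

variable {w : W} {n : ℕ} {u : ℕ → W}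

theorem add_one_ne (h : HasCircleLink K w n u) (k : ℕ) : u k ≠ u (k + 1) := by
  have hp : Function.Periodic u n := h.periodic
  have hn := h.three_le
  rw [← hp.map_mod_nat k, ← hp.map_mod_nat (k + 1)]
  intro he
  have := h.injOn (Set.mem_Iio.2 (Nat.mod_lt _ (by omega))) (Set.mem_Iio.2 (Nat.mod_lt _ (by omega))) he
  rw [Nat.add_mod, Nat.mod_eq_of_lt (a := 1) (by omega)] at this
  have hk := Nat.mod_lt k (show 0 < n by omega)
  rcases Nat.lt_or_ge (k % n + 1) n with h1 | h1
  · rw [Nat.mod_eq_of_lt h1] at this; omega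
  · have h2 : k % n + 1 = n := by omega
    rw [h2, Nat.mod_self] at this; omega

theorem single_periodic (h : HasCircleLink K w n u) (k : ℕ) :
    (Pi.single (u (k + n)) 1 : W → ℝ) = Pi.single (u k) 1 := by
  rw [h.periodic]

/-- A point of the closed star of a vertex with circle link, at scale `r` from the center. -/
def diskPoint (w : W) (n : ℕ) (u : ℕ → W) (r : ℝ) (z : ℂ) : W → ℝ :=
  r • plMap n (fun k => (Pi.single (u k) 1 : W → ℝ)) z +
    (1 - r * plMap n (fun _ => (1 : ℝ)) z) • Pi.single w 1

theorem diskPoint_comb (h : HasCircleLink K w n u) (r : ℝ) (k : ℕ) {a b : ℝ} (ha : 0 ≤ a)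
    (hb : 0 ≤ b) : diskPoint w n u r (a • corner n k + b • corner n (k + 1)) =
      (r * a) • Pi.single (u k) 1 + (r * b) • Pi.single (u (k + 1)) 1 +
        (1 - r * (a + b)) • Pi.single w 1 := by
  rw [diskPoint, plMap_comb h.three_le h.single_periodic k ha hb,
    plMap_comb h.three_le (fun _ => rfl) k ha hb]
  simp only [smul_add, smul_smul, smul_eq_mul, mul_one]

theorem exists_comb (h : HasCircleLink K w n u) (z : ℂ) : ∃ (k : ℕ) (a b : ℝ), 0 ≤ a ∧ 0 ≤ b ∧
    a • corner n k + b • corner n (k + 1) = z ∧ plMap n (fun _ => (1 : ℝ)) z = a + b := by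
  obtain ⟨k, -, ha, hb⟩ := exists_sector h.three_le z
  exact ⟨k, _, _, ha, hb, sector_decomp h.three_le k z,
    by rw [plMap_eq_of_sector h.three_le (fun _ => rfl) ha hb]; simp⟩

theorem plMap_one_nonneg (h : HasCircleLink K w n u) (z : ℂ) :
    0 ≤ plMap n (fun _ => (1 : ℝ)) z := by
  obtain ⟨k, a, b, ha, hb, -, hz⟩ := h.exists_comb z
  rw [hz]; positivity

theorem comb_mem_realization (h : HasCircleLink K w n u) (k : ℕ) {a b c : ℝ} (ha : 0 ≤ a)
    (hb : 0 ≤ b) (hc : 0 ≤ c) (habc : a + b + c = 1) :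
    (a • Pi.single (u k) 1 + b • Pi.single (u (k + 1)) 1 + c • Pi.single w 1 : W → ℝ) ∈
      realization K := by
  refine ⟨fun v => ?_, ?_, {w, u k, u (k + 1)}, ?_, ?_⟩
  · simp only [Pi.add_apply, Pi.smul_apply, Pi.single_apply, smul_eq_mul]
    positivity
  · simp [Finset.sum_add_distrib, ← Finset.mul_sum, habc]
  · exact (h.mem_faces_iff _ (by simp)).2 ⟨k, subset_rfl⟩
  · intro v hv
    by_contra h'
    simp only [Finset.coe_insert, Finset.coe_singleton, Set.mem_insert_iff,
      Set.mem_singleton_iff, not_or] at h'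
    exact hv (by simp [h'])

theorem exists_eq_comb (h : HasCircleLink K w n u) {p : W → ℝ} (hp : p ∈ realization K)
    {s : Finset W} (hs : s ∈ K.faces) (hw : w ∈ s) (hps : Function.support p ⊆ (s : Set W)) :
    ∃ (k : ℕ) (a b c : ℝ), 0 ≤ a ∧ 0 ≤ b ∧ 0 ≤ c ∧ a + b + c = 1 ∧
      p = a • Pi.single (u k) 1 + b • Pi.single (u (k + 1)) 1 + c • Pi.single w 1 := by
  obtain ⟨k, hk⟩ := (h.mem_faces_iff s hw).1 hs
  have hpeq : p = p (u k) • Pi.single (u k) 1 + p (u (k + 1)) • Pi.single (u (k + 1)) 1 +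
      p w • Pi.single w 1 := by
    ext v
    have h1 := h.add_one_ne k
    have h2 := h.ne k
    have h3 := h.ne (k + 1)
    by_cases hv : v ∈ ({w, u k, u (k + 1)} : Finset W)
    · simp only [Finset.mem_insert, Finset.mem_singleton] at hv
      rcases hv with rfl | rfl | rfl
      · simp [h2.symm, h3.symm]
      · simp [h1, h2]
      · simp [h1.symm, h3]
    · have h0 : p v = 0 := by_contra fun h' => hv (hk (hps h'))
      simp only [Finset.mem_insert, Finset.mem_singleton, not_or] at hv
      simp [h0, hv]
  refine ⟨k, p (u k), p (u (k + 1)), p w, hp.1 _, hp.1 _, hp.1 _, ?_, hpeq⟩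
  have := hp.2.1
  rw [hpeq] at this
  simpa [Finset.sum_add_distrib, ← Finset.mul_sum] using this

theorem diskPoint_mem (h : HasCircleLink K w n u) {r : ℝ} {z : ℂ} (hr : 0 ≤ r)
    (hrz : r * plMap n (fun _ => (1 : ℝ)) z ≤ 1) : diskPoint w n u r z ∈ realization K := by
  obtain ⟨k, a, b, ha, hb, hz, hz'⟩ := h.exists_comb z
  rw [hz'] at hrz
  rw [← hz, h.diskPoint_comb r k ha hb]
  exact h.comb_mem_realization k (by positivity) (by positivity) (by linarith) (by ring)

/-- The linear map to the plane that sends the center to `0` and the circle to a regular polygon. -/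
def diskMap (n : ℕ) (u : ℕ → W) : (W → ℝ) →ₗ[ℝ] ℂ :=
  ∑ j ∈ Finset.range n, (LinearMap.proj (u j)).smulRight (corner n j)

theorem diskMap_center (h : HasCircleLink K w n u) : diskMap n u (Pi.single w 1) = 0 := by
  simp only [diskMap, LinearMap.sum_apply, LinearMap.smulRight_apply, LinearMap.proj_apply]
  exact Finset.sum_eq_zero fun j _ => by rw [Pi.single_apply, if_neg (h.ne j), zero_smul]

theorem diskMap_single (h : HasCircleLink K w n u) (k : ℕ) :
    diskMap n u (Pi.single (u k) 1) = corner n k := by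
  have hn := h.three_le
  have hu : Function.Periodic u n := h.periodic
  have hc : Function.Periodic (corner n) n := corner_add_period hn
  rw [← hu.map_mod_nat k, ← hc.map_mod_nat k]
  have hk := Nat.mod_lt k (show 0 < n by omega)
  simp only [diskMap, LinearMap.sum_apply, LinearMap.smulRight_apply, LinearMap.proj_apply]
  rw [Finset.sum_eq_single_of_mem (k % n) (Finset.mem_range.2 hk)]
  · simp
  · intro j hj hjk
    rw [Pi.single_apply, if_neg, zero_smul]
    exact fun he => hjk (h.injOn (Finset.mem_range.1 hj) hk he)

theorem diskMap_comb (h : HasCircleLink K w n u) (k : ℕ) (a b c : ℝ) :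
    diskMap n u (a • Pi.single (u k) 1 + b • Pi.single (u (k + 1)) 1 + c • Pi.single w 1) =
      a • corner n k + b • corner n (k + 1) := by
  simp only [map_add, map_smul, h.diskMap_single, h.diskMap_center, smul_zero, add_zero]

/-- A single linear map inverts the piecewise linear one up to scale. It supplies the inverse of the
chart and the injectivity of the polygon map with no comparison of sectors. -/
theorem diskMap_diskPoint (h : HasCircleLink K w n u) (r : ℝ) (z : ℂ) :
    diskMap n u (diskPoint w n u r z) = r • z := by
  obtain ⟨k, a, b, ha, hb, rfl, -⟩ := h.exists_comb z
  rw [h.diskPoint_comb r k ha hb, h.diskMap_comb, smul_add, smul_smul, smul_smul]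

theorem continuous_diskPoint (h : HasCircleLink K w n u) {r : ℂ → ℝ} (hr : Continuous r) :
    Continuous fun z => diskPoint w n u (r z) z := by
  unfold diskPoint
  exact (hr.smul (continuous_plMap h.three_le h.single_periodic)).add
    ((continuous_const.sub (hr.mul (continuous_plMap h.three_le fun _ => rfl))).smul
      continuous_const)

theorem comb_apply_center (h : HasCircleLink K w n u) (k : ℕ) (a b c : ℝ) :
    (a • Pi.single (u k) 1 + b • Pi.single (u (k + 1)) 1 + c • Pi.single w 1 : W → ℝ) w = c := by
  simp [(h.ne k).symm, (h.ne (k + 1)).symm]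

/-- The open star of a vertex with circle link is homeomorphic to the plane. -/
theorem exists_chart (h : HasCircleLink K w n u) :
    ∃ e : OpenPartialHomeomorph (realization K) ℂ, e.source = {p | 0 < p.1 w} := by
  -- Write `s` for the gauge of the polygon. The scale `1 / (1 + s)` compresses the plane onto the
  -- open star, and the coordinate at `w` becomes `1 - s / (1 + s) = 1 / (1 + s)`; division by this
  -- coordinate therefore undoes the compression.
  have hpos : ∀ z, 0 < 1 + plMap n (fun _ => (1 : ℝ)) z := fun z => by
    linarith [h.plMap_one_nonneg z]
  have hmem : ∀ z, diskPoint w n u (1 + plMap n (fun _ => (1 : ℝ)) z)⁻¹ z ∈ realization K := by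
    intro z
    refine h.diskPoint_mem (inv_nonneg.2 (hpos z).le) ?_
    rw [inv_mul_le_iff₀ (hpos z)]
    linarith
  have happ : ∀ z, diskPoint w n u (1 + plMap n (fun _ => (1 : ℝ)) z)⁻¹ z w =
      (1 + plMap n (fun _ => (1 : ℝ)) z)⁻¹ := by
    intro z
    have := (hpos z).ne'
    obtain ⟨k, a, b, ha, hb, hz, hz'⟩ := h.exists_comb z
    rw [hz'] at this ⊢
    rw [← hz, h.diskPoint_comb _ k ha hb, h.comb_apply_center]
    field_simp
    ring
  have hcw : Continuous fun p : realization K => p.1 w :=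
    (continuous_apply w).comp continuous_subtype_val
  refine ⟨{ toFun := fun p => (p.1 w)⁻¹ • diskMap n u p.1
            invFun := fun z => ⟨_, hmem z⟩
            source := {p | 0 < p.1 w}
            target := Set.univ
            map_source' := fun _ _ => trivial
            map_target' := fun z _ => by
              change 0 < diskPoint w n u (1 + plMap n (fun _ => (1 : ℝ)) z)⁻¹ z w
              rw [happ]
              exact inv_pos.2 (hpos z)
            left_inv' := ?_
            right_inv' := ?_
            open_source := isOpen_lt continuous_const hcw
            open_target := isOpen_univ
            continuousOn_toFun := ?_
            continuousOn_invFun := ?_ }, rfl⟩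
  · intro p hp
    apply Subtype.ext
    have hp' : 0 < p.1 w := hp
    obtain ⟨s, hs, hps⟩ := p.2.2.2
    obtain ⟨k, a, b, c, ha, hb, hc, habc, hpe⟩ := h.exists_eq_comb p.2 hs (hps hp'.ne') hps
    have hcw : p.1 w = c := by rw [hpe, h.comb_apply_center]
    rw [hcw] at hp'
    have hz : (p.1 w)⁻¹ • diskMap n u p.1 =
        (c⁻¹ * a) • corner n k + (c⁻¹ * b) • corner n (k + 1) := by
      rw [hcw, hpe, h.diskMap_comb, smul_add, smul_smul, smul_smul]
    have hs : plMap n (fun _ => (1 : ℝ)) ((p.1 w)⁻¹ • diskMap n u p.1) = c⁻¹ * a + c⁻¹ * b := by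
      rw [hz, plMap_comb h.three_le (fun _ => rfl) k (by positivity) (by positivity)]
      simp
    have hr : (1 + (c⁻¹ * a + c⁻¹ * b))⁻¹ = c := by
      have : 1 + (c⁻¹ * a + c⁻¹ * b) = c⁻¹ := by
        field_simp; linarith
      rw [this, inv_inv]
    change diskPoint w n u (1 + plMap n (fun _ => (1 : ℝ)) ((p.1 w)⁻¹ • diskMap n u p.1))⁻¹
      ((p.1 w)⁻¹ • diskMap n u p.1) = p.1
    have hc' := hp'.ne'
    rw [hs, hr, hz, h.diskPoint_comb c k (by positivity) (by positivity), mul_add,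
      mul_inv_cancel_left₀ hc', mul_inv_cancel_left₀ hc', show 1 - (a + b) = c by linarith]
    exact hpe.symm
  · intro z _
    change (diskPoint w n u (1 + plMap n (fun _ => (1 : ℝ)) z)⁻¹ z w)⁻¹ •
      diskMap n u (diskPoint w n u (1 + plMap n (fun _ => (1 : ℝ)) z)⁻¹ z) = z
    rw [happ, h.diskMap_diskPoint, smul_smul, inv_inv, mul_inv_cancel₀ (hpos z).ne', one_smul]
  · refine ContinuousOn.smul (hcw.continuousOn.inv₀ fun p hp => (show 0 < p.1 w from hp).ne') ?_
    exact ((diskMap n u).continuous_of_finiteDimensional.comp continuous_subtype_val).continuousOn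
  · refine (Continuous.subtype_mk (h.continuous_diskPoint ?_) _).continuousOn
    exact (continuous_const.add (continuous_plMap h.three_le fun _ => rfl)).inv₀
      fun z => (hpos z).ne'

/-- The closed star of a vertex with circle link is a polygon. -/
theorem exists_polygon (h : HasCircleLink K w n u) :
    ∃ φ : ℂ → realization K, ContinuousOn φ (regularPolygon n) ∧ Set.InjOn φ (regularPolygon n) ∧
      φ '' regularPolygon n = closedStar K w ∧ (∀ k, (φ (corner n k)).1 (u k) = 1) ∧
      ∀ k, φ '' segment ℝ (corner n k) (corner n (k + 1)) = closedSimplex K {u k, u (k + 1)} := by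
  have hn := h.three_le
  -- The maximum is `1` on the polygon; outside it serves only to keep the values in the
  -- realization, since the map must be defined on all of `ℂ`.
  have hpos : ∀ z, 0 < max 1 (plMap n (fun _ => (1 : ℝ)) z) := fun z => by positivity
  have hmem : ∀ z, diskPoint w n u (max 1 (plMap n (fun _ => (1 : ℝ)) z))⁻¹ z ∈ realization K := by
    intro z
    refine h.diskPoint_mem (inv_nonneg.2 (hpos z).le) ?_
    rw [inv_mul_le_iff₀ (hpos z), mul_one]
    exact le_max_right _ _
  have hval : ∀ (k : ℕ) (a b : ℝ), 0 ≤ a → 0 ≤ b → a + b ≤ 1 →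
      diskPoint w n u (max 1 (plMap n (fun _ => (1 : ℝ))
        (a • corner n k + b • corner n (k + 1))))⁻¹ (a • corner n k + b • corner n (k + 1)) =
      a • Pi.single (u k) 1 + b • Pi.single (u (k + 1)) 1 + (1 - (a + b)) • Pi.single w 1 := by
    intro k a b ha hb hab
    rw [plMap_comb hn (fun _ => rfl) k ha hb, h.diskPoint_comb _ k ha hb]
    simp only [smul_eq_mul, mul_one]
    rw [max_eq_left hab]
    simp
  have hsupp : ∀ k (a b c : ℝ), Function.support
      (a • Pi.single (u k) 1 + b • Pi.single (u (k + 1)) 1 + c • Pi.single w 1 : W → ℝ) ⊆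
      (({w, u k, u (k + 1)} : Finset W) : Set W) := by
    intro k a b c v hv
    by_contra h'
    simp only [Finset.coe_insert, Finset.coe_singleton, Set.mem_insert_iff,
      Set.mem_singleton_iff, not_or] at h'
    exact hv (by simp [h'])
  have hface : ∀ k, {w, u k, u (k + 1)} ∈ K.faces := fun k =>
    (h.mem_faces_iff _ (by simp)).2 ⟨k, subset_rfl⟩
  refine ⟨fun z => ⟨_, hmem z⟩, ?_, ?_, ?_, ?_, ?_⟩
  · refine (Continuous.subtype_mk (h.continuous_diskPoint ?_) _).continuousOn
    exact (continuous_const.max (continuous_plMap hn fun _ => rfl)).inv₀ fun z => (hpos z).ne'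
  · intro z hz z' hz' he
    rw [mem_regularPolygon_iff hn] at hz hz'
    have := congrArg (diskMap n u) (congrArg Subtype.val he)
    simpa only [h.diskMap_diskPoint, max_eq_left hz, max_eq_left hz', inv_one, one_smul] using this
  · apply Set.Subset.antisymm
    · rintro _ ⟨z, hz, rfl⟩
      rw [mem_regularPolygon_iff hn] at hz
      obtain ⟨k, a, b, ha, hb, hzk, hzs⟩ := h.exists_comb z
      refine ⟨{w, u k, u (k + 1)}, hface k, by simp, ?_⟩
      change Function.support (diskPoint w n u _ z) ⊆ _
      rw [← hzk, hval k a b ha hb (by rwa [hzs] at hz)]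
      exact hsupp _ _ _ _
    · rintro p ⟨s, hs, hw, hps⟩
      obtain ⟨k, a, b, c, ha, hb, hc, habc, hpe⟩ := h.exists_eq_comb p.2 hs hw hps
      refine ⟨a • corner n k + b • corner n (k + 1), ?_, Subtype.ext ?_⟩
      · rw [mem_regularPolygon_iff hn, plMap_comb hn (fun _ => rfl) k ha hb]
        simp only [smul_eq_mul, mul_one]
        linarith
      · change diskPoint w n u _ _ = _
        rw [hval k a b ha hb (by linarith), hpe, show 1 - (a + b) = c by linarith]
  · intro k
    have := hval k 1 0 zero_le_one le_rfl (by norm_num)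
    rw [one_smul, zero_smul, add_zero] at this
    change diskPoint w n u _ _ _ = _
    rw [this]
    simp
  · intro k
    apply Set.Subset.antisymm
    · rintro _ ⟨_, ⟨a, b, ha, hb, hab, rfl⟩, rfl⟩
      change Function.support (diskPoint w n u _ _) ⊆ _
      rw [hval k a b ha hb hab.le, hab]
      intro v hv
      by_contra h'
      simp only [Finset.coe_insert, Finset.coe_singleton, Set.mem_insert_iff,
        Set.mem_singleton_iff, not_or] at h'
      exact hv (by simp [h'])
    · intro p hp
      have hps : Function.support p.1 ⊆ (({w, u k, u (k + 1)} : Finset W) : Set W) :=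
        Set.Subset.trans hp (by simp)
      have hpe : p.1 = p.1 (u k) • Pi.single (u k) 1 + p.1 (u (k + 1)) • Pi.single (u (k + 1)) 1 +
          (0 : ℝ) • Pi.single w 1 := by
        have h1 := h.add_one_ne k
        ext v
        by_cases hv : v ∈ ({u k, u (k + 1)} : Finset W)
        · simp only [Finset.mem_insert, Finset.mem_singleton] at hv
          rcases hv with rfl | rfl
          · simp [h1]
          · simp [h1.symm]
        · have h0 : p.1 v = 0 := by_contra fun h' => hv (hp h')
          simp only [Finset.mem_insert, Finset.mem_singleton, not_or] at hv
          simp [h0, hv]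
      have hsum := p.2.2.1
      rw [hpe] at hsum
      simp only [Pi.add_apply, Pi.smul_apply, smul_eq_mul, Finset.sum_add_distrib,
        ← Finset.mul_sum, Finset.sum_pi_single', Finset.mem_univ, if_true, mul_one, zero_mul,
        add_zero] at hsum
      refine ⟨p.1 (u k) • corner n k + p.1 (u (k + 1)) • corner n (k + 1),
        ⟨_, _, p.2.1 _, p.2.1 _, ?_, rfl⟩, Subtype.ext ?_⟩
      · exact hsum
      · change diskPoint w n u _ _ = _
        rw [hval k _ _ (p.2.1 _) (p.2.1 _) hsum.le, hsum, sub_self]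
        exact hpe.symm

/-- A vertex with circle link whose circle contains no erased vertex is the center of a polygonal
2-face. -/
theorem isNGon (h : HasCircleLink K w n u) {D : Set W} (hw : w ∈ D) (hu : ∀ k, u k ∉ D) :
    IsNGon K D n w := by
  have hn := h.three_le
  have hface : ∀ k, {w, u k, u (k + 1)} ∈ K.faces := fun k =>
    (h.mem_faces_iff _ (by simp)).2 ⟨k, subset_rfl⟩
  have hsub : ∀ k s, s ⊆ {w, u k, u (k + 1)} → s.Nonempty → s ∈ K.faces := fun k s hs hne =>
    (K.isRelLowerSet_faces (hface k)).2 hs hne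
  have hb : faceBoundary K D w = Set.range (fun k => ({u k, u (k + 1)} : Finset W)) := by
    ext e
    constructor
    · rintro ⟨⟨he, hcard, hD⟩, hwe⟩
      obtain ⟨k, hk⟩ := (h.mem_faces_iff _ (by simp)).1 hwe
      refine ⟨k, (Finset.eq_of_subset_of_card_le (fun v hv => ?_) ?_).symm⟩
      · have := hk (Finset.mem_insert_of_mem hv)
        rw [Finset.mem_insert] at this
        exact this.resolve_left fun hvw => hD v hv (hvw ▸ hw)
      · rw [hcard, Finset.card_pair (h.add_one_ne k)]
    · rintro ⟨k, rfl⟩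
      refine ⟨⟨hsub k _ (by simp) (by simp), Finset.card_pair (h.add_one_ne k), ?_⟩, hface k⟩
      intro v hv
      simp only [Finset.mem_insert, Finset.mem_singleton] at hv
      rcases hv with rfl | rfl <;> exact hu _
  have hup : Function.Periodic u n := h.periodic
  obtain ⟨φ, h1, h2, h3, h4, h5⟩ := h.exists_polygon
  refine ⟨u, φ, h.periodic, h.injOn, fun k => ⟨hsub k _ (by simp) (by simp), hu k⟩, hb, ?_,
    h1, h2, h3, h4, h5⟩
  have hb' : faceBoundary K D w =
      (fun k => ({u k, u (k + 1)} : Finset W)) '' (Finset.range n : Set ℕ) := by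
    rw [hb]
    apply Set.Subset.antisymm
    · rintro _ ⟨k, rfl⟩
      refine ⟨k % n, by simpa using Nat.mod_lt _ (by omega), ?_⟩
      have e1 : u (k % n) = u k := hup.map_mod_nat k
      have e2 : u (k % n + 1) = u (k + 1) := by
        rw [← hup.map_mod_nat (k % n + 1), ← hup.map_mod_nat (k + 1), Nat.mod_add_mod]
      simp only [e1, e2]
    · rintro _ ⟨k, -, rfl⟩
      exact ⟨k, rfl⟩
  rw [hb', Set.InjOn.ncard_image, Set.ncard_coe_finset, Finset.card_range]
  intro i hi j hj hij
  simp only [Finset.coe_range, Set.mem_Iio] at hi hj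
  have key : ∀ i j, i < n → j < n → u i ∈ ({u j, u (j + 1)} : Finset W) → i = j ∨ i = (j + 1) % n := by
    intro i j hi hj hm
    simp only [Finset.mem_insert, Finset.mem_singleton] at hm
    rcases hm with hm | hm
    · exact Or.inl (h.injOn hi hj hm)
    · right
      rw [← hup.map_mod_nat (j + 1)] at hm
      exact h.injOn hi (Set.mem_Iio.2 (Nat.mod_lt _ (by omega))) hm
  have hij' : ({u i, u (i + 1)} : Finset W) = {u j, u (j + 1)} := hij
  have a1 := key i j hi hj (by rw [← hij']; simp)
  have a2 := key j i hj hi (by rw [hij']; simp)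
  rcases a1 with a1 | a1
  · exact a1
  rcases a2 with a2 | a2
  · exact a2.symm
  -- What remains is `i ≡ j + 1` and `j ≡ i + 1` modulo `n`, impossible for `n ≥ 3`.
  exfalso
  rcases Nat.lt_or_ge (j + 1) n with b1 | b1
  · rw [Nat.mod_eq_of_lt b1] at a1
    rcases Nat.lt_or_ge (i + 1) n with b2 | b2
    · rw [Nat.mod_eq_of_lt b2] at a2; omega
    · rw [show i + 1 = n by omega, Nat.mod_self] at a2; omega
  · rw [show j + 1 = n by omega, Nat.mod_self] at a1
    rw [a1, Nat.mod_eq_of_lt (by omega)] at a2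
    omega

end HasCircleLink

/-- Some barycentric coordinate of every point is positive, so the open stars of vertices cover the
realization. No compatibility of charts is needed for a topological manifold. -/
theorem nonempty_chartedSpace_realization
    (hK : ∀ w, {w} ∈ K.faces → ∃ n u, HasCircleLink K w n u) :
    Nonempty (ChartedSpace (EuclideanSpace ℝ (Fin 2)) (realization K)) := by
  have hc : ∀ p : realization K, ∃ e : OpenPartialHomeomorph (realization K)
      (EuclideanSpace ℝ (Fin 2)), p ∈ e.source := by
    intro p
    obtain ⟨s, hs, hps⟩ := p.2.2.2
    have : ∃ w, 0 < p.1 w := by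
      by_contra h
      push Not at h
      have := p.2.2.1
      rw [Finset.sum_eq_zero fun w _ => le_antisymm (h w) (p.2.1 w)] at this
      exact zero_ne_one this
    obtain ⟨w, hw⟩ := this
    obtain ⟨n, u, hu⟩ := hK w ((K.isRelLowerSet_faces hs).2
      (by simpa using hps hw.ne') (by simp))
    obtain ⟨e, he⟩ := hu.exists_chart
    refine ⟨e.trans Complex.orthonormalBasisOneI.repr.toHomeomorph.toOpenPartialHomeomorph, ?_⟩
    rw [OpenPartialHomeomorph.trans_source, he]
    exact ⟨hw, trivial⟩
  choose e he using hc
  exact ⟨{ atlas := Set.range e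
           chartAt := e
           mem_chart_source := he
           chart_mem_atlas := fun p => ⟨p, rfl⟩ }⟩

end Topology

/-! ### Cyclic permutations of triples -/

section CyclicPerm

variable {W : Type*}

/-- The triple `a, b, c` is a cyclic permutation of `A, B, C`. -/
def IsCyclicPerm (A B C a b c : W) : Prop :=
  (a = A ∧ b = B ∧ c = C) ∨ (a = B ∧ b = C ∧ c = A) ∨ (a = C ∧ b = A ∧ c = B)

theorem IsCyclicPerm.insert_eq {A B C a b c : W} (h : IsCyclicPerm A B C a b c) :
    ({a, b, c} : Finset W) = {A, B, C} := by
  rcases h with ⟨rfl, rfl, rfl⟩ | ⟨rfl, rfl, rfl⟩ | ⟨rfl, rfl, rfl⟩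
  · rfl
  · ext; simp; tauto
  · ext; simp; tauto

theorem IsCyclicPerm.not_swap {A B C a b c : W} (hAB : A ≠ B) (hBC : B ≠ C) (hAC : A ≠ C)
    (h : IsCyclicPerm A B C a b c) : ¬ IsCyclicPerm A B C b a c := by
  rintro (⟨h1, h2, h3⟩ | ⟨h1, h2, h3⟩ | ⟨h1, h2, h3⟩) <;>
    rcases h with ⟨k1, k2, k3⟩ | ⟨k1, k2, k3⟩ | ⟨k1, k2, k3⟩
  · exact hAB (h1.symm.trans k2)
  · exact hAC (h1.symm.trans k2)
  · exact hBC (h2.symm.trans k1)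
  · exact hAC (k1.symm.trans h2)
  · exact hBC (h1.symm.trans k2)
  · exact hAB (k2.symm.trans h1)
  · exact hBC (k2.symm.trans h1)
  · exact hAB (h2.symm.trans k1)
  · exact hAC (k2.symm.trans h1)

theorem isCyclicPerm_rotate {A B C a b c : W} :
    IsCyclicPerm A B C b c a ↔ IsCyclicPerm A B C a b c := by
  unfold IsCyclicPerm; tauto

theorem isCyclicPerm_of_insert_eq {A B C a b c : W} (hab : a ≠ b) (hbc : b ≠ c) (hac : a ≠ c)
    (h : ({a, b, c} : Finset W) = {A, B, C}) :
    IsCyclicPerm A B C a b c ∨ IsCyclicPerm A B C b a c := by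
  have ha : a ∈ ({A, B, C} : Finset W) := h ▸ by simp
  have hb : b ∈ ({A, B, C} : Finset W) := h ▸ by simp
  have hc : c ∈ ({A, B, C} : Finset W) := h ▸ by simp
  simp only [Finset.mem_insert, Finset.mem_singleton] at ha hb hc
  unfold IsCyclicPerm
  rcases ha with rfl | rfl | rfl <;> rcases hb with rfl | rfl | rfl <;>
    rcases hc with rfl | rfl | rfl <;> simp at hab hbc hac ⊢

end CyclicPerm

/-! ### The first Betti number of a connected complex of dimension 2 -/

section Homology

variable {W : Type*} [Fintype W] {K : PreAbstractSimplicialComplex W}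

theorem boundary₁_apply (f : W → W → ℚ) (b : W) : boundary₁ f b = ∑ a, f a b := rfl

theorem boundary₂_apply (f : W → W → W → ℚ) (b c : W) : boundary₂ f b c = ∑ a, f a b c := rfl

theorem chains₁_self {f : W → W → ℚ} (hf : f ∈ chains₁ K) (a : W) : f a a = 0 := by
  linarith [hf.1 a a]

theorem chains₂_self {f : W → W → W → ℚ} (hf : f ∈ chains₂ K) (a b : W) :
    f a a b = 0 ∧ f a b b = 0 ∧ f a b a = 0 := by
  have h1 := hf.1 a a b
  have h2 := hf.1 a b b
  have h3 := hf.1 a b a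
  have h4 := hf.1 b a a
  exact ⟨by linarith [h1.1], by linarith [h2.2], by linarith [h3.1, h4.2]⟩

/-- After an order `s e, t e` is chosen on every edge, an alternating function is given freely by
its values at the chosen pairs. -/
theorem finrank_chains₁ (K : PreAbstractSimplicialComplex W) :
    Module.finrank ℚ (chains₁ K) = {e | e ∈ K.faces ∧ e.card = 2}.ncard := by
  have hst : ∀ e : {e // e ∈ K.faces ∧ e.card = 2}, ∃ s t, s ≠ t ∧ e.1 = {s, t} :=
    fun e => Finset.card_eq_two.1 e.2.2
  choose s t hne he using hst
  let Φ : chains₁ K →ₗ[ℚ] ({e // e ∈ K.faces ∧ e.card = 2} → ℚ) :=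
    { toFun := fun f e => f.1 (s e) (t e)
      map_add' := fun _ _ => rfl
      map_smul' := fun _ _ => rfl }
  have hinj : Function.Injective Φ := by
    rw [injective_iff_map_eq_zero]
    rintro ⟨f, hf⟩ h0
    apply Subtype.ext
    funext a b
    change f a b = 0
    by_contra hab
    have hne' : a ≠ b := fun h => hab (h ▸ chains₁_self hf a)
    let e : {e // e ∈ K.faces ∧ e.card = 2} := ⟨{a, b}, hf.2 a b hab, Finset.card_pair hne'⟩
    have h1 : f (s e) (t e) = 0 := congrFun h0 e
    have h2 : ({a, b} : Finset W) = {s e, t e} := he e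
    have ha : a ∈ ({s e, t e} : Finset W) := h2 ▸ by simp
    have hb : b ∈ ({s e, t e} : Finset W) := h2 ▸ by simp
    simp only [Finset.mem_insert, Finset.mem_singleton] at ha hb
    rcases ha with ha | ha <;> rcases hb with hb | hb
    · exact hne' (ha.trans hb.symm)
    · exact hab (by rw [ha, hb, h1])
    · exact hab (by rw [ha, hb, hf.1, h1, neg_zero])
    · exact hne' (ha.trans hb.symm)
  have hsurj : Function.Surjective Φ := by
    intro g
    let f : W → W → ℚ := fun a b => ∑ e, g e *
      ((if a = s e ∧ b = t e then 1 else 0) - (if b = s e ∧ a = t e then 1 else 0))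
    have hf : f ∈ chains₁ K := by
      refine ⟨fun a b => ?_, fun a b hab => ?_⟩
      · simp only [f, ← Finset.sum_neg_distrib]
        exact Finset.sum_congr rfl fun e _ => by ring
      · obtain ⟨e, -, h⟩ := Finset.exists_ne_zero_of_sum_ne_zero hab
        by_cases h1 : a = s e ∧ b = t e
        · rw [h1.1, h1.2, ← he e]; exact e.2.1
        · by_cases h2 : b = s e ∧ a = t e
          · rw [h2.1, h2.2, Finset.pair_comm, ← he e]; exact e.2.1
          · simp [h1, h2] at h
    refine ⟨⟨f, hf⟩, funext fun e => ?_⟩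
    change f (s e) (t e) = g e
    simp only [f]
    rw [Finset.sum_eq_single_of_mem e (Finset.mem_univ _)]
    · simp [hne e, (hne e).symm]
    · intro e' _ hee
      rw [if_neg, if_neg, sub_zero, mul_zero]
      · rintro ⟨h1, h2⟩
        exact hee (Subtype.ext (by rw [he e', he e, h1, h2, Finset.pair_comm]))
      · rintro ⟨h1, h2⟩
        exact hee (Subtype.ext (by rw [he e', he e, h1, h2]))
  rw [(LinearEquiv.ofBijective Φ ⟨hinj, hsurj⟩).finrank_eq, Module.finrank_fintype_fun_eq_card,
    ← Nat.card_eq_fintype_card]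
  rfl

/-- The same argument with a chosen order on every triangle. The six orders split into the cyclic
permutations of the chosen one, with sign `+`, and their reversals, with sign `-`. -/
theorem finrank_chains₂ (K : PreAbstractSimplicialComplex W) :
    Module.finrank ℚ (chains₂ K) = {e | e ∈ K.faces ∧ e.card = 3}.ncard := by
  have hst : ∀ e : {e // e ∈ K.faces ∧ e.card = 3}, ∃ r s t, r ≠ s ∧ r ≠ t ∧ s ≠ t ∧
      e.1 = {r, s, t} := fun e => Finset.card_eq_three.1 e.2.2
  choose r s t hrs hrt hst he using hst
  let Φ : chains₂ K →ₗ[ℚ] ({e // e ∈ K.faces ∧ e.card = 3} → ℚ) :=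
    { toFun := fun f e => f.1 (r e) (s e) (t e)
      map_add' := fun _ _ => rfl
      map_smul' := fun _ _ => rfl }
  have hinj : Function.Injective Φ := by
    rw [injective_iff_map_eq_zero]
    rintro ⟨f, hf⟩ h0
    apply Subtype.ext
    funext a b c
    change f a b c = 0
    by_contra habc
    have hab : a ≠ b := fun h => habc (h ▸ (chains₂_self hf a c).1)
    have hbc : b ≠ c := fun h => habc (h ▸ (chains₂_self hf a b).2.1)
    have hac : a ≠ c := fun h => habc (h ▸ (chains₂_self hf a b).2.2)
    let e : {e // e ∈ K.faces ∧ e.card = 3} :=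
      ⟨{a, b, c}, hf.2 a b c habc, Finset.card_eq_three.2 ⟨a, b, c, hab, hac, hbc, rfl⟩⟩
    have h1 : f (r e) (s e) (t e) = 0 := congrFun h0 e
    have h2 : f (s e) (t e) (r e) = 0 := by rw [(hf.1 _ _ _).2, (hf.1 _ _ _).1, h1]; simp
    have h3 : f (t e) (r e) (s e) = 0 := by rw [(hf.1 _ _ _).1, (hf.1 _ _ _).2, h1]; simp
    rcases isCyclicPerm_of_insert_eq hab hbc hac (he e) with
      (⟨ha, hb, hc⟩ | ⟨ha, hb, hc⟩ | ⟨ha, hb, hc⟩) | (⟨ha, hb, hc⟩ | ⟨ha, hb, hc⟩ | ⟨ha, hb, hc⟩)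
    · exact habc (by rw [ha, hb, hc, h1])
    · exact habc (by rw [ha, hb, hc, h2])
    · exact habc (by rw [ha, hb, hc, h3])
    · exact habc (by rw [(hf.1 _ _ _).1, ha, hb, hc, h1, neg_zero])
    · exact habc (by rw [(hf.1 _ _ _).1, ha, hb, hc, h2, neg_zero])
    · exact habc (by rw [(hf.1 _ _ _).1, ha, hb, hc, h3, neg_zero])
  have hsurj : Function.Surjective Φ := by
    intro g
    let f : W → W → W → ℚ := fun a b c => ∑ e, g e *
      ((if IsCyclicPerm (r e) (s e) (t e) a b c then 1 else 0) -
        (if IsCyclicPerm (r e) (s e) (t e) b a c then 1 else 0))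
    have hf : f ∈ chains₂ K := by
      refine ⟨fun a b c => ⟨?_, ?_⟩, fun a b c hab => ?_⟩
      · simp only [f, ← Finset.sum_neg_distrib]
        exact Finset.sum_congr rfl fun e _ => by ring
      · simp only [f, ← Finset.sum_neg_distrib]
        refine Finset.sum_congr rfl fun e _ => ?_
        rw [← isCyclicPerm_rotate (a := b) (b := a) (c := c),
          ← isCyclicPerm_rotate (a := c) (b := a) (c := b)]
        ring
      · obtain ⟨e, -, h⟩ := Finset.exists_ne_zero_of_sum_ne_zero hab
        by_cases h1 : IsCyclicPerm (r e) (s e) (t e) a b c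
        · rw [h1.insert_eq, ← he e]; exact e.2.1
        · by_cases h2 : IsCyclicPerm (r e) (s e) (t e) b a c
          · rw [Finset.insert_comm, h2.insert_eq, ← he e]; exact e.2.1
          · simp [h1, h2] at h
    refine ⟨⟨f, hf⟩, funext fun e => ?_⟩
    change f (r e) (s e) (t e) = g e
    simp only [f]
    rw [Finset.sum_eq_single_of_mem e (Finset.mem_univ _)]
    · have h0 : IsCyclicPerm (r e) (s e) (t e) (r e) (s e) (t e) := Or.inl ⟨rfl, rfl, rfl⟩
      rw [if_pos h0, if_neg, sub_zero, mul_one]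
      rintro (⟨h, -⟩ | ⟨-, h, -⟩ | ⟨-, -, h⟩)
      · exact hrs e h.symm
      · exact hrt e h
      · exact hst e h.symm
    · intro e' _ hee
      rw [if_neg, if_neg, sub_zero, mul_zero]
      · intro h
        exact hee (Subtype.ext (by rw [he e', he e, ← h.insert_eq, Finset.insert_comm]))
      · intro h
        exact hee (Subtype.ext (by rw [he e', he e, ← h.insert_eq]))
  rw [(LinearEquiv.ofBijective Φ ⟨hinj, hsurj⟩).finrank_eq, Module.finrank_fintype_fun_eq_card,
    ← Nat.card_eq_fintype_card]
  rfl

theorem boundaries₁_le_cycles₁ (K : PreAbstractSimplicialComplex W) :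
    boundaries₁ K ≤ cycles₁ K := by
  rintro _ ⟨f, hf, rfl⟩
  refine ⟨⟨fun a b => ?_, fun a b hab => ?_⟩, ?_⟩
  · rw [boundary₂_apply, boundary₂_apply, ← Finset.sum_neg_distrib]
    exact Finset.sum_congr rfl fun c _ => (hf.1 c a b).2
  · rw [boundary₂_apply] at hab
    obtain ⟨c, -, hc⟩ := Finset.exists_ne_zero_of_sum_ne_zero hab
    exact (K.isRelLowerSet_faces (hf.2 c a b hc)).2 (Finset.subset_insert _ _) (by simp)
  · rw [SetLike.mem_coe, LinearMap.mem_ker]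
    funext c
    rw [boundary₁_apply]
    simp_rw [boundary₂_apply]
    -- Exchanging the summation variables changes the sign of an alternating function, so the
    -- iterated boundary equals its own negative.
    have h : ∑ b, ∑ a, f a b c = - ∑ b, ∑ a, f a b c := by
      conv_lhs => rw [Finset.sum_comm]
      simp_rw [← Finset.sum_neg_distrib]
      exact Finset.sum_congr rfl fun a _ => Finset.sum_congr rfl fun b _ => (hf.1 b a c).1
    simp only [Pi.zero_apply]
    linarith

/-- Rational simplicial 0-chains. -/
def chains₀ (K : PreAbstractSimplicialComplex W) : Submodule ℚ (W → ℚ) where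
  carrier := {f | ∀ a, f a ≠ 0 → {a} ∈ K.faces}
  zero_mem' := by simp
  add_mem' := by
    intro f g hf hg a h
    by_cases h0 : f a = 0
    · exact hg a (by simpa [h0] using h)
    · exact hf a h0
  smul_mem' := by
    intro r f hf a h
    exact hf a fun h0 => h (by simp [h0])

theorem finrank_chains₀ (K : PreAbstractSimplicialComplex W) :
    Module.finrank ℚ (chains₀ K) = {w | {w} ∈ K.faces}.ncard := by
  let Φ : chains₀ K →ₗ[ℚ] ({w // {w} ∈ K.faces} → ℚ) :=
    { toFun := fun f e => f.1 e
      map_add' := fun _ _ => rfl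
      map_smul' := fun _ _ => rfl }
  have hinj : Function.Injective Φ := by
    rw [injective_iff_map_eq_zero]
    rintro ⟨f, hf⟩ h0
    apply Subtype.ext
    funext a
    by_contra h
    exact h (congrFun h0 ⟨a, hf a h⟩)
  have hsurj : Function.Surjective Φ := by
    intro g
    refine ⟨⟨fun a => if h : {a} ∈ K.faces then g ⟨a, h⟩ else 0, fun a ha => ?_⟩, funext fun e => ?_⟩
    · by_contra h
      exact ha (dif_neg h)
    · exact dif_pos e.2
  rw [(LinearEquiv.ofBijective Φ ⟨hinj, hsurj⟩).finrank_eq, Module.finrank_fintype_fun_eq_card,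
    ← Nat.card_eq_fintype_card]
  rfl

/-- The sum of the coefficients of a 0-chain. -/
def augmentation : (W → ℚ) →ₗ[ℚ] ℚ := ∑ w, LinearMap.proj w

theorem augmentation_apply (f : W → ℚ) : augmentation f = ∑ w, f w := by
  simp [augmentation]

/-- The differences `[w] - [v]` telescope along walks from `v`, and they span the 0-chains of
augmentation zero. -/
theorem map_boundary₁_chains₁ {v : W}
    (hreach : ∀ w, {w} ∈ K.faces → (skeletonGraph K).Reachable v w) :
    (chains₁ K).map boundary₁ = chains₀ K ⊓ LinearMap.ker augmentation := by
  apply le_antisymm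
  · rintro _ ⟨f, hf, rfl⟩
    refine ⟨fun b hb => ?_, ?_⟩
    · rw [boundary₁_apply] at hb
      obtain ⟨a, -, ha⟩ := Finset.exists_ne_zero_of_sum_ne_zero hb
      exact (K.isRelLowerSet_faces (hf.2 a b ha)).2 (by simp) (by simp)
    · rw [SetLike.mem_coe, LinearMap.mem_ker, augmentation_apply]
      simp_rw [boundary₁_apply]
      have h : ∑ b, ∑ a, f a b = - ∑ b, ∑ a, f a b := by
        conv_lhs => rw [Finset.sum_comm]
        simp_rw [← Finset.sum_neg_distrib]
        exact Finset.sum_congr rfl fun a _ => Finset.sum_congr rfl fun b _ => hf.1 b a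
      linarith
  · have h1 : ∀ a b, (skeletonGraph K).Reachable a b →
        (Pi.single b 1 - Pi.single a 1 : W → ℚ) ∈ (chains₁ K).map boundary₁ := by
      rintro a b ⟨p⟩
      induction p with
      | nil => simp
      | @cons a b c h p ih =>
        rw [← sub_add_sub_cancel (Pi.single c (1 : ℚ) : W → ℚ) (Pi.single b 1) (Pi.single a 1)]
        refine add_mem ih ⟨fun i j => (if i = a ∧ j = b then 1 else 0) -
          (if j = a ∧ i = b then 1 else 0), ⟨fun i j => by ring, fun i j hij => ?_⟩, ?_⟩
        · by_cases h1 : i = a ∧ j = b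
          · rw [h1.1, h1.2]; exact h.2
          · by_cases h2 : j = a ∧ i = b
            · rw [h2.1, h2.2, Finset.pair_comm]; exact h.2
            · simp [h1, h2] at hij
        · funext j
          rw [boundary₁_apply, Finset.sum_sub_distrib]
          congr 1
          · by_cases hj : j = b
            · subst hj; simp
            · simp [hj]
          · by_cases hj : j = a
            · subst hj; simp
            · simp [hj]
    rintro f ⟨hf, hf0⟩
    rw [SetLike.mem_coe, LinearMap.mem_ker, augmentation_apply] at hf0
    have h2 : f = ∑ w, f w • (Pi.single w 1 - Pi.single v 1 : W → ℚ) := by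
      simp_rw [smul_sub, Finset.sum_sub_distrib, ← Finset.sum_smul, hf0, zero_smul, sub_zero]
      funext j
      simp [Finset.sum_apply, Pi.single_apply]
    rw [h2]
    refine Submodule.sum_mem _ fun w _ => ?_
    by_cases h0 : f w = 0
    · simp [h0]
    · exact Submodule.smul_mem _ _ (h1 v w (hreach w (hf w h0)))

theorem finrank_inf_ker_add_finrank_map {M N : Type*} [AddCommGroup M] [Module ℚ M]
    [AddCommGroup N] [Module ℚ N] [FiniteDimensional ℚ M] (f : M →ₗ[ℚ] N) (p : Submodule ℚ M) :
    Module.finrank ℚ (p ⊓ LinearMap.ker f : Submodule ℚ M) + Module.finrank ℚ (p.map f) =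
      Module.finrank ℚ p := by
  have h := (f.domRestrict p).finrank_range_add_finrank_ker
  rw [LinearMap.range_domRestrict, LinearMap.ker_domRestrict] at h
  rw [← h, ← Submodule.map_comap_subtype, Submodule.finrank_map_subtype_eq, add_comm]

/-- Rank-nullity in degrees 0, 1 and 2, with connectedness giving one dimension in degree 0 and
`hker` one in degree 2. The result is additive to avoid truncated subtraction. -/
theorem finrank_homology₁ {v : W} (hv : {v} ∈ K.faces)
    (hreach : ∀ w, {w} ∈ K.faces → (skeletonGraph K).Reachable v w)
    (hker : Module.finrank ℚ
      (chains₂ K ⊓ LinearMap.ker boundary₂ : Submodule ℚ (W → W → W → ℚ)) = 1) :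
    Module.finrank ℚ (homology₁ K) + {w | {w} ∈ K.faces}.ncard +
      {e | e ∈ K.faces ∧ e.card = 3}.ncard = {e | e ∈ K.faces ∧ e.card = 2}.ncard + 2 := by
  have h1 := Submodule.finrank_quotient_add_finrank ((boundaries₁ K).comap (cycles₁ K).subtype)
  rw [(Submodule.comapSubtypeEquivOfLe (boundaries₁_le_cycles₁ K)).finrank_eq] at h1
  have h2 := finrank_inf_ker_add_finrank_map boundary₂ (chains₂ K)
  have h3 := finrank_inf_ker_add_finrank_map boundary₁ (chains₁ K)
  have h4 := finrank_inf_ker_add_finrank_map augmentation (chains₀ K)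
  have h5 : (chains₀ K).map augmentation = ⊤ := by
    rw [eq_top_iff]
    rintro r -
    refine ⟨Pi.single v r, fun a ha => ?_, by simp [augmentation_apply]⟩
    by_cases h : a = v
    · rwa [h]
    · simp [h] at ha
  rw [h5, finrank_top, Module.finrank_self, finrank_chains₀] at h4
  rw [map_boundary₁_chains₁ hreach, finrank_chains₁] at h3
  rw [hker, finrank_chains₂] at h2
  change Module.finrank ℚ (cycles₁ K) + _ = _ at h3
  change _ + Module.finrank ℚ (boundaries₁ K) = _ at h2
  change Module.finrank ℚ (homology₁ K) + _ = _ at h1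
  omega

end Homology

/-! ### Sheets -/

instance decidableEqSumSelf {G : Type*} : DecidableEq (G ⊕ G) :=
  fun a b => Classical.propDecidable (a = b)

instance decidableEqSheet {U : Type*} (K : PreAbstractSimplicialComplex U) :
    DecidableEq (Sheet K) :=
  fun a b => Classical.propDecidable (a = b)


section Sheets

variable {U : Type*} {K : PreAbstractSimplicialComplex U}

theorem sheetAt_eq_iff {v u u' : U} :
    sheetAt K v u = sheetAt K v u' ↔ (linkGraph K v).Reachable u u' := by
  simp [sheetAt]

/-- Every vertex on a walk from `v` is itself reachable from `v`, so the edges of the walk survive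
in the component. -/
theorem reachable_component {v w : U} (h : (skeletonGraph K).Reachable v w) :
    (skeletonGraph (component K v)).Reachable v w := by
  rw [SimpleGraph.reachable_iff_reflTransGen] at h
  induction h with
  | refl => exact SimpleGraph.Reachable.refl _
  | @tail a b hva hab ih =>
    rw [← SimpleGraph.reachable_iff_reflTransGen] at hva
    refine ih.trans (SimpleGraph.Adj.reachable ⟨hab.1, hab.2, fun w hw => ?_⟩)
    simp only [Finset.mem_insert, Finset.mem_singleton] at hw
    rcases hw with rfl | rfl
    · exact hva
    · exact hva.trans hab.reachable

end Sheets

/-! ### Darts: pairs of noncommuting elements -/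

section Darts

variable {G : Type*} [Group G]

/-- The next dart around a 2-face. -/
def rotate : Equiv.Perm (G × G) where
  toFun ω := (ω.2, ω.2⁻¹ * ω.1 * ω.2)
  invFun ω := (ω.1 * ω.2 * ω.1⁻¹, ω.1)
  left_inv ω := by ext <;> simp [mul_assoc]
  right_inv ω := by ext <;> simp [mul_assoc]

/-- The next dart around a type 1 vertex. -/
def turn : Equiv.Perm (G × G) where
  toFun ω := (ω.1, ω.1 * ω.2 * ω.1⁻¹)
  invFun ω := (ω.1, ω.1⁻¹ * ω.2 * ω.1)
  left_inv ω := by ext <;> simp [mul_assoc]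
  right_inv ω := by ext <;> simp [mul_assoc]

/-- Simultaneous conjugation. -/
def conjDart (h : G) : Equiv.Perm (G × G) :=
  Equiv.prodCongr (MulAut.conj h).toEquiv (MulAut.conj h).toEquiv

theorem rotate_apply (p q : G) : rotate (p, q) = (q, q⁻¹ * p * q) := rfl

theorem turn_apply (p q : G) : turn (p, q) = (p, p * q * p⁻¹) := rfl

theorem conjDart_apply (h p q : G) : conjDart h (p, q) = (h * p * h⁻¹, h * q * h⁻¹) := rfl

theorem conjDart_mul (h k : G) (ω : G × G) :
    conjDart (h * k) ω = conjDart h (conjDart k ω) := by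
  obtain ⟨p, q⟩ := ω
  simp [conjDart_apply, mul_assoc]

theorem conjDart_one (ω : G × G) : conjDart 1 ω = ω := by
  obtain ⟨p, q⟩ := ω
  simp [conjDart_apply]

theorem conjDart_rotate (h : G) (ω : G × G) : conjDart h (rotate ω) = rotate (conjDart h ω) := by
  obtain ⟨p, q⟩ := ω
  simp [conjDart_apply, rotate_apply, mul_assoc]

theorem conjDart_turn (h : G) (ω : G × G) : conjDart h (turn ω) = turn (conjDart h ω) := by
  obtain ⟨p, q⟩ := ω
  simp [conjDart_apply, turn_apply, mul_assoc]

theorem conjDart_swap (h : G) (ω : G × G) : conjDart h ω.swap = (conjDart h ω).swap := rfl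

/-- With `rotate_eq` this is the source of the symmetry of the component: the moves from triangle to
triangle are conjugations up to a swap. -/
theorem turn_eq_conjDart (ω : G × G) : turn ω = conjDart ω.1 ω := by
  obtain ⟨p, q⟩ := ω
  simp [conjDart_apply, turn_apply]

theorem rotate_eq (ω : G × G) : rotate ω = (conjDart ω.2⁻¹ ω).swap := by
  obtain ⟨p, q⟩ := ω
  simp [conjDart_apply, rotate_apply, mul_assoc]

theorem rotate_rotate (ω : G × G) : rotate (rotate ω) = conjDart (ω.1 * ω.2)⁻¹ ω := by
  obtain ⟨p, q⟩ := ω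
  simp [conjDart_apply, rotate_apply, mul_assoc]

theorem rotate_zpow_mul (k : ℤ) (ω : G × G) :
    ((rotate ^ k) ω).1 * ((rotate ^ k) ω).2 = ω.1 * ω.2 := by
  have h1 : ∀ ω : G × G, (rotate ω).1 * (rotate ω).2 = ω.1 * ω.2 := by
    rintro ⟨p, q⟩
    simp [rotate_apply, mul_assoc]
  have h2 : ∀ ω : G × G, (rotate⁻¹ ω).1 * (rotate⁻¹ ω).2 = ω.1 * ω.2 := fun ω => by
    rw [← h1 (rotate⁻¹ ω), Equiv.Perm.coe_inv, Equiv.apply_symm_apply]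
  induction k generalizing ω with
  | zero => rfl
  | succ k ih => rw [zpow_add_one, Equiv.Perm.mul_apply, ih, h1]
  | pred k ih => rw [zpow_sub_one, Equiv.Perm.mul_apply, ih, h2]

theorem turn_zpow (k : ℤ) (p q : G) : (turn ^ k) (p, q) = (p, p ^ k * q * (p ^ k)⁻¹) := by
  induction k with
  | zero => simp
  | succ k ih =>
    rw [add_comm, zpow_one_add, Equiv.Perm.mul_apply, ih, turn_apply, zpow_one_add]
    simp [mul_assoc]
  | pred k ih =>
    rw [sub_eq_neg_add, zpow_add, Equiv.Perm.mul_apply, ih, zpow_neg_one, Equiv.Perm.inv_eq_iff_eq,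
      turn_apply, zpow_add, zpow_neg_one]
    simp [mul_assoc]

/-- The two elements of the dart do not commute. -/
def IsNoncomm (ω : G × G) : Prop := ω.1 * ω.2 ≠ ω.2 * ω.1

theorem IsNoncomm.ne {ω : G × G} (h : IsNoncomm ω) : ω.1 ≠ ω.2 := fun he => h (by rw [he])

theorem IsNoncomm.swap {ω : G × G} (h : IsNoncomm ω) : IsNoncomm ω.swap := fun he => h he.symm

theorem IsNoncomm.conjDart {ω : G × G} (h : IsNoncomm ω) (g : G) : IsNoncomm (conjDart g ω) := by
  intro he
  apply h
  have h1 : MulAut.conj g ω.1 * MulAut.conj g ω.2 = MulAut.conj g ω.2 * MulAut.conj g ω.1 := he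
  rw [← map_mul, ← map_mul] at h1
  exact (MulAut.conj g).injective h1

theorem IsNoncomm.rotate {ω : G × G} (h : IsNoncomm ω) : IsNoncomm (rotate ω) := by
  rw [rotate_eq]; exact (h.conjDart _).swap

theorem IsNoncomm.turn {ω : G × G} (h : IsNoncomm ω) : IsNoncomm (turn ω) := by
  rw [turn_eq_conjDart]; exact h.conjDart _

theorem mem_complexX_faces {s : Finset (G ⊕ G)} {ω : G × G} (hω : IsNoncomm ω) (hs : s.Nonempty)
    (h : s ⊆ {Sum.inl ω.1, Sum.inl ω.2, Sum.inr (ω.1 * ω.2)}) : s ∈ (complexX G).faces :=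
  ⟨hs, ω.1, ω.2, hω, fun z hz => by simpa using h hz⟩

theorem exists_dart_of_mem_complexX_faces {a b c : G ⊕ G} (hab : a ≠ b) (hbc : b ≠ c) (hac : a ≠ c)
    (h : {a, b, c} ∈ (complexX G).faces) : ∃ ω : G × G, IsNoncomm ω ∧
      ({a, b, c} : Finset (G ⊕ G)) = {Sum.inl ω.1, Sum.inl ω.2, Sum.inr (ω.1 * ω.2)} := by
  obtain ⟨-, p, q, hpq, h⟩ := h
  have h' : ({a, b, c} : Finset (G ⊕ G)) ⊆ {Sum.inl p, Sum.inl q, Sum.inr (p * q)} :=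
    fun z hz => by simpa using h hz
  refine ⟨(p, q), hpq, Finset.eq_of_subset_of_card_le h' ?_⟩
  rw [Finset.card_eq_three.2 ⟨a, b, c, hab, hac, hbc, rfl⟩]
  exact Finset.card_le_three

theorem linkGraph_inl_adj {p : G} {u w : G ⊕ G} (h : (linkGraph (complexX G) (Sum.inl p)).Adj u w) :
    ∃ q, p * q ≠ q * p ∧
      ((u = Sum.inl q ∧ (w = Sum.inr (p * q) ∨ w = Sum.inr (q * p))) ∨
      (w = Sum.inl q ∧ (u = Sum.inr (p * q) ∨ u = Sum.inr (q * p)))) := by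
  obtain ⟨hu, hw, huw, hf⟩ := h
  obtain ⟨⟨p', q'⟩, hω, he⟩ := exists_dart_of_mem_complexX_faces hu.symm huw hw.symm hf
  rcases isCyclicPerm_of_insert_eq hu.symm huw hw.symm he with
    (⟨h1, h2, h3⟩ | ⟨h1, h2, h3⟩ | ⟨h1, h2, h3⟩) | (⟨h1, h2, h3⟩ | ⟨h1, h2, h3⟩ | ⟨h1, h2, h3⟩)
  · obtain rfl := Sum.inl.inj h1
    exact ⟨q', hω, Or.inl ⟨h2, Or.inl h3⟩⟩
  · obtain rfl := Sum.inl.inj h1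
    exact ⟨p', hω.symm, Or.inr ⟨h3, Or.inr h2⟩⟩
  · exact absurd h1 (by simp)
  · obtain rfl := Sum.inl.inj h2
    exact ⟨p', hω.symm, Or.inl ⟨h1, Or.inr h3⟩⟩
  · exact absurd h2 (by simp)
  · obtain rfl := Sum.inl.inj h2
    exact ⟨q', hω, Or.inr ⟨h3, Or.inl h1⟩⟩

theorem linkGraph_inr_adj {r : G} {u w : G ⊕ G} (h : (linkGraph (complexX G) (Sum.inr r)).Adj u w) :
    ∃ ω : G × G, IsNoncomm ω ∧ ω.1 * ω.2 = r ∧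
      ((u = Sum.inl ω.1 ∧ w = Sum.inl ω.2) ∨ (u = Sum.inl ω.2 ∧ w = Sum.inl ω.1)) := by
  obtain ⟨hu, hw, huw, hf⟩ := h
  obtain ⟨ω, hω, he⟩ := exists_dart_of_mem_complexX_faces hu.symm huw hw.symm hf
  refine ⟨ω, hω, ?_⟩
  rcases isCyclicPerm_of_insert_eq hu.symm huw hw.symm he with
    (⟨h1, h2, h3⟩ | ⟨h1, h2, h3⟩ | ⟨h1, h2, h3⟩) | (⟨h1, h2, h3⟩ | ⟨h1, h2, h3⟩ | ⟨h1, h2, h3⟩)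
  · exact absurd h1 (by simp)
  · exact absurd h1 (by simp)
  · exact ⟨(Sum.inr.inj h1).symm, Or.inl ⟨h2, h3⟩⟩
  · exact absurd h2 (by simp)
  · exact ⟨(Sum.inr.inj h2).symm, Or.inr ⟨h1, h3⟩⟩
  · exact absurd h2 (by simp)

/-- The type 1 vertex of `Y(G)` from which the dart starts. -/
def dartTail (ω : G × G) : Sheet (complexX G) := cornerFst ω.1 ω.2

/-- The type 1 vertex of `Y(G)` at which the dart ends. -/
def dartHead (ω : G × G) : Sheet (complexX G) := cornerSnd ω.1 ω.2

/-- The type 2 vertex of `Y(G)` of the triangle of the dart. -/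
def dartFace (ω : G × G) : Sheet (complexX G) := cornerTwo ω.1 ω.2

theorem dartTail_swap (ω : G × G) : dartTail ω.swap = dartHead ω := rfl

theorem dartHead_swap (ω : G × G) : dartHead ω.swap = dartTail ω := rfl

theorem linkGraph_adj_of_isNoncomm {ω : G × G} (h : IsNoncomm ω) :
    (linkGraph (complexX G) (Sum.inl ω.1)).Adj (Sum.inl ω.2) (Sum.inr (ω.1 * ω.2)) ∧
    (linkGraph (complexX G) (Sum.inl ω.2)).Adj (Sum.inl ω.1) (Sum.inr (ω.1 * ω.2)) ∧
    (linkGraph (complexX G) (Sum.inr (ω.1 * ω.2))).Adj (Sum.inl ω.1) (Sum.inl ω.2) := by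
  have hne : ∀ {p q : G}, p ≠ q → (Sum.inl p : G ⊕ G) ≠ Sum.inl q := fun h => by simpa using h
  refine ⟨⟨hne h.ne.symm, by simp, by simp, ?_⟩, ⟨hne h.ne, by simp, by simp, ?_⟩,
    ⟨by simp, by simp, hne h.ne, ?_⟩⟩
  · exact mem_complexX_faces h (by simp) subset_rfl
  · exact mem_complexX_faces h (by simp) (by rw [Finset.insert_comm])
  · refine mem_complexX_faces h (by simp) fun z hz => ?_
    simp only [Finset.mem_insert, Finset.mem_singleton] at hz ⊢
    tauto

/-- A sheet at one corner of a triangle can be named by either of the other corners, as these are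
adjacent in the link. Naming it by the type 2 corner makes sheets of neighbouring triangles
comparable. -/
theorem dartTail_eq (ω : G × G) (h : IsNoncomm ω) :
    dartTail ω = sheetAt (complexX G) (Sum.inl ω.1) (Sum.inr (ω.1 * ω.2)) :=
  sheetAt_eq_iff.2 (linkGraph_adj_of_isNoncomm h).1.reachable

theorem dartHead_eq (ω : G × G) (h : IsNoncomm ω) :
    dartHead ω = sheetAt (complexX G) (Sum.inl ω.2) (Sum.inr (ω.1 * ω.2)) :=
  sheetAt_eq_iff.2 (linkGraph_adj_of_isNoncomm h).2.1.reachable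

theorem dartFace_eq (ω : G × G) (h : IsNoncomm ω) :
    dartFace ω = sheetAt (complexX G) (Sum.inr (ω.1 * ω.2)) (Sum.inl ω.2) :=
  sheetAt_eq_iff.2 (linkGraph_adj_of_isNoncomm h).2.2.reachable

/-- Since `p q = (p q p⁻¹) p`, the triangle of the dart and that of the swapped turned dart share
the link vertex `(p q, 2)`. For commuting entries `turn` does nothing, so no hypothesis is required.
-/
theorem dartTail_turn (ω : G × G) : dartTail (turn ω) = dartTail ω := by
  by_cases h : IsNoncomm ω
  · rw [dartTail_eq ω h, ← dartHead_swap, dartHead_eq _ h.turn.swap]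
    obtain ⟨p, q⟩ := ω
    simp [turn_apply]
  · have : turn ω = ω := by
      obtain ⟨p, q⟩ := ω
      simp only [IsNoncomm, not_not] at h
      rw [turn_apply, h, mul_inv_cancel_right]
    rw [this]

theorem dartFace_rotate {ω : G × G} (h : IsNoncomm ω) : dartFace (rotate ω) = dartFace ω := by
  rw [dartFace_eq ω h]
  obtain ⟨p, q⟩ := ω
  simp [dartFace, cornerTwo, rotate_apply, mul_assoc]

theorem dartTail_rotate (ω : G × G) : dartTail (rotate ω) = dartHead ω := by
  rw [← dartTail_swap, ← dartTail_turn (rotate ω)]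
  congr 1
  obtain ⟨p, q⟩ := ω
  simp [rotate_apply, turn_apply, mul_assoc]

theorem apply_zpow_eq {α β : Type*} {f : Equiv.Perm α} {g : α → β} {P : α → Prop}
    (hP : ∀ a, P a ↔ P (f a)) (hg : ∀ a, P a → g (f a) = g a) (k : ℤ) {a : α} (ha : P a) :
    g ((f ^ k) a) = g a ∧ P ((f ^ k) a) := by
  induction k generalizing a with
  | zero => exact ⟨rfl, ha⟩
  | succ k ih =>
    rw [zpow_add_one, Equiv.Perm.mul_apply]
    have := ih ((hP a).1 ha)
    exact ⟨this.1.trans (hg a ha), this.2⟩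
  | pred k ih =>
    rw [zpow_sub_one, Equiv.Perm.mul_apply]
    have h1 : P (f⁻¹ a) := by rw [hP, Equiv.Perm.coe_inv, Equiv.apply_symm_apply]; exact ha
    have := ih h1
    refine ⟨this.1.trans ?_, this.2⟩
    rw [← hg _ h1, Equiv.Perm.coe_inv, Equiv.apply_symm_apply]

theorem reachable_invariant {V : Type*} {H : SimpleGraph V} {P : V → Prop}
    (hP : ∀ u w, H.Adj u w → P u → P w) {u w : V} (h : H.Reachable u w) (hu : P u) : P w := by
  obtain ⟨p⟩ := h
  induction p with
  | nil => exact hu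
  | cons h' p ih => exact ih (hP _ _ h' hu)

theorem dartTail_eq_iff {ω ω' : G × G} : dartTail ω = dartTail ω' ↔ turn.SameCycle ω ω' := by
  constructor
  · intro h
    obtain ⟨p, q⟩ := ω
    obtain ⟨p', q'⟩ := ω'
    obtain rfl : p = p' := Sum.inl.inj (congrArg Sigma.fst h)
    have h := sheetAt_eq_iff.1 h
    -- The invariant carried along a path in the link: `(q', 1)` stands for the dart `(p, q')` and
    -- `(r, 2)` for `(p, p⁻¹ r)`. Across a link edge the dart either stays the same or changes by
    -- one application of `turn` or its inverse.
    let P : G ⊕ G → Prop := fun u => u.elim (fun q' => turn.SameCycle (p, q) (p, q'))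
      (fun r => turn.SameCycle (p, q) (p, p⁻¹ * r))
    have hturn : ∀ q₁ q₂ : G, p * q₁ = q₂ * p → (turn.SameCycle (p, q) (p, q₁) ↔
        turn.SameCycle (p, q) (p, q₂)) := by
      intro q₁ q₂ h
      have : turn (p, q₁) = (p, q₂) := by rw [turn_apply, h, mul_inv_cancel_right]
      rw [← this, Equiv.Perm.sameCycle_apply_right]
    refine reachable_invariant (P := P) ?_ h (Equiv.Perm.SameCycle.refl _ _)
    intro u w huw hu
    obtain ⟨q₁, -, ⟨rfl, rfl | rfl⟩ | ⟨rfl, rfl | rfl⟩⟩ := linkGraph_inl_adj huw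
    · simpa [P] using hu
    · exact (hturn _ _ (by simp)).2 hu
    · simpa [P] using hu
    · exact (hturn _ _ (by simp)).1 hu
  · rintro ⟨k, rfl⟩
    exact (apply_zpow_eq (P := fun _ => True) (fun _ => Iff.rfl) (fun a _ => dartTail_turn a) k
      trivial).1.symm

theorem isNoncomm_rotate_iff (ω : G × G) : IsNoncomm ω ↔ IsNoncomm (rotate ω) := by
  refine ⟨IsNoncomm.rotate, fun h => ?_⟩
  rw [rotate_eq] at h
  have := (h.swap.conjDart ω.2)
  rwa [Prod.swap_swap, ← conjDart_mul, mul_inv_cancel, conjDart_one] at this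

theorem dartFace_eq_iff {ω ω' : G × G} (hω : IsNoncomm ω) :
    dartFace ω = dartFace ω' ↔ rotate.SameCycle ω ω' := by
  constructor
  · intro h
    obtain ⟨p, q⟩ := ω
    obtain ⟨p', q'⟩ := ω'
    have hpq : p * q = p' * q' := Sum.inr.inj (congrArg Sigma.fst h)
    obtain rfl : q' = p'⁻¹ * (p * q) := by rw [hpq, inv_mul_cancel_left]
    have h1 : sheetAt (complexX G) (Sum.inr (p * q)) (Sum.inl p) =
        sheetAt (complexX G) (Sum.inr (p * q)) (Sum.inl p') := by
      simpa [dartFace, cornerTwo] using h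
    have h2 := sheetAt_eq_iff.1 h1
    -- In the link of a type 2 vertex, `(p', 1)` determines its dart because the product is fixed,
    -- and link edges are steps of `rotate`. Type 2 vertices do not occur in paths there.
    let P : G ⊕ G → Prop := fun u => u.elim
      (fun p' => rotate.SameCycle (p, q) (p', p'⁻¹ * (p * q))) (fun r => False)
    refine reachable_invariant (P := P) ?_ h2 ?_
    · intro u w huw hu
      obtain ⟨⟨p₁, q₁⟩, -, he, h⟩ := linkGraph_inr_adj huw
      have hr : rotate (p₁, p₁⁻¹ * (p * q)) = (q₁, q₁⁻¹ * (p * q)) := by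
        simp only at he
        rw [← he]
        simp [rotate_apply, mul_assoc]
      obtain ⟨rfl, rfl⟩ | ⟨rfl, rfl⟩ := h
      · change rotate.SameCycle (p, q) (q₁, q₁⁻¹ * (p * q))
        rw [← hr, Equiv.Perm.sameCycle_apply_right]
        exact hu
      · change rotate.SameCycle (p, q) (q₁, q₁⁻¹ * (p * q)) at hu
        rw [← hr, Equiv.Perm.sameCycle_apply_right] at hu
        exact hu
    · change rotate.SameCycle (p, q) (p, p⁻¹ * (p * q))
      rw [inv_mul_cancel_left]
  · rintro ⟨k, rfl⟩
    exact (apply_zpow_eq isNoncomm_rotate_iff (fun a ha => dartFace_rotate ha) k hω).1.symm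

/-- The triangle of `Y(G)` of the dart. -/
def dartTriangle (ω : G × G) : Finset (Sheet (complexX G)) :=
  {dartTail ω, dartHead ω, dartFace ω}

/-- The order of the corners in the definition of the desingularization is immaterial, because each
sheet may be named by either neighbouring corner; so only the dart remains. -/
theorem mem_complexY_faces_iff {s : Finset (Sheet (complexX G))} :
    s ∈ (complexY G).faces ↔ s.Nonempty ∧ ∃ ω : G × G, IsNoncomm ω ∧ s ⊆ dartTriangle ω := by
  constructor
  · rintro ⟨hs, a, b, c, hab, hbc, hac, hf, hsub⟩
    obtain ⟨ω, hω, he⟩ := exists_dart_of_mem_complexX_faces hab hbc hac hf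
    refine ⟨hs, ω, hω, hsub.trans ?_⟩
    have e1 := dartTail_eq ω hω
    have e2 := dartHead_eq ω hω
    have e3 := dartFace_eq ω hω
    rcases isCyclicPerm_of_insert_eq hab hbc hac he with
      (⟨rfl, rfl, rfl⟩ | ⟨rfl, rfl, rfl⟩ | ⟨rfl, rfl, rfl⟩) |
      (⟨rfl, rfl, rfl⟩ | ⟨rfl, rfl, rfl⟩ | ⟨rfl, rfl, rfl⟩)
    all_goals
      intro z hz
      simp only [Finset.mem_insert, Finset.mem_singleton, dartTriangle, e1, e2, e3] at hz ⊢
      simp only [dartTail, cornerFst, dartHead, cornerSnd, dartFace, cornerTwo] at e1 e2 e3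
      simp only [e1, e2, e3] at hz
      tauto
  · rintro ⟨hs, ω, hω, hsub⟩
    refine ⟨hs, Sum.inl ω.1, Sum.inl ω.2, Sum.inr (ω.1 * ω.2), by simpa using hω.ne, by simp,
      by simp, mem_complexX_faces hω (by simp) subset_rfl, ?_⟩
    rw [← dartHead_eq ω hω]
    intro z hz
    have hz' := hsub hz
    simp only [dartTriangle, Finset.mem_insert, Finset.mem_singleton] at hz' ⊢
    exact hz'

end Darts

/-! ### Minimal periods of permutations -/

section MinimalPeriod

variable {α : Type*} {f : Equiv.Perm α} {a : α}

theorem minimalPeriod_apply_of_commute {e : Equiv.Perm α} (he : ∀ a, e (f a) = f (e a)) (a : α) :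
    Function.minimalPeriod f (e a) = Function.minimalPeriod f a := by
  rw [Function.minimalPeriod_eq_minimalPeriod_iff]
  intro n
  have : (f^[n]) (e a) = e ((f^[n]) a) := by
    induction n with
    | zero => rfl
    | succ n ih => rw [Function.iterate_succ_apply', ih, Function.iterate_succ_apply', he]
  unfold Function.IsPeriodicPt Function.IsFixedPt
  rw [this, e.injective.eq_iff]

theorem pow_add_minimalPeriod_apply (k : ℕ) :
    (f ^ (k + Function.minimalPeriod f a)) a = (f ^ k) a := by
  rw [← Equiv.Perm.iterate_eq_pow, ← Equiv.Perm.iterate_eq_pow,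
    Function.iterate_add_minimalPeriod_eq]

theorem pow_injOn_Iio_minimalPeriod :
    Set.InjOn (fun k : ℕ => (f ^ k) a) (Set.Iio (Function.minimalPeriod f a)) := by
  have := Function.iterate_injOn_Iio_minimalPeriod (f := f) (x := a)
  simpa only [Equiv.Perm.iterate_eq_pow] using this

theorem minimalPeriod_pos' [Finite α] : 0 < Function.minimalPeriod f a :=
  Function.minimalPeriod_pos_of_mem_periodicPts (f.injective.mem_periodicPts a)

theorem sameCycle_pow (f : Equiv.Perm α) (k : ℕ) (a : α) : f.SameCycle a ((f ^ k) a) :=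
  ⟨k, by rw [zpow_natCast]⟩

end MinimalPeriod

/-! ### The darts and the links of the component -/

section Orbit

variable {G : Type*} [Group G] {x y : G}

/-- The darts of the component of the dart `(x, y)`. -/
def dartOrbit (x y : G) : Set (G × G) :=
  {ω | ∃ h ∈ Subgroup.closure {x, y}, ω = conjDart h (x, y) ∨ ω = conjDart h (y, x)}

theorem self_mem_dartOrbit : (x, y) ∈ dartOrbit x y :=
  ⟨1, one_mem _, Or.inl (conjDart_one _).symm⟩

theorem swap_mem_dartOrbit {ω : G × G} (h : ω ∈ dartOrbit x y) : ω.swap ∈ dartOrbit x y := by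
  obtain ⟨g, hg, rfl | rfl⟩ := h
  · exact ⟨g, hg, Or.inr rfl⟩
  · exact ⟨g, hg, Or.inl rfl⟩

theorem conjDart_mem_dartOrbit {ω : G × G} (h : ω ∈ dartOrbit x y) {g : G}
    (hg : g ∈ Subgroup.closure {x, y}) : conjDart g ω ∈ dartOrbit x y := by
  obtain ⟨k, hk, rfl | rfl⟩ := h
  · exact ⟨g * k, mul_mem hg hk, Or.inl (conjDart_mul _ _ _).symm⟩
  · exact ⟨g * k, mul_mem hg hk, Or.inr (conjDart_mul _ _ _).symm⟩

/-- Because the entries stay in `⟨x, y⟩`, the moves `turn` and `rotate`, which conjugate by entries,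
preserve the orbit. -/
theorem fst_mem_closure {ω : G × G} (h : ω ∈ dartOrbit x y) : ω.1 ∈ Subgroup.closure {x, y} := by
  have hx : x ∈ Subgroup.closure {x, y} := Subgroup.subset_closure (by simp)
  have hy : y ∈ Subgroup.closure {x, y} := Subgroup.subset_closure (by simp)
  obtain ⟨k, hk, rfl | rfl⟩ := h
  · exact mul_mem (mul_mem hk hx) (inv_mem hk)
  · exact mul_mem (mul_mem hk hy) (inv_mem hk)

theorem snd_mem_closure {ω : G × G} (h : ω ∈ dartOrbit x y) : ω.2 ∈ Subgroup.closure {x, y} :=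
  fst_mem_closure (swap_mem_dartOrbit h)

theorem turn_mem_dartOrbit_iff {ω : G × G} : ω ∈ dartOrbit x y ↔ turn ω ∈ dartOrbit x y := by
  refine ⟨fun h => ?_, fun h => ?_⟩
  · rw [turn_eq_conjDart]
    exact conjDart_mem_dartOrbit h (fst_mem_closure h)
  · have h1 : ω.1 ∈ Subgroup.closure {x, y} := fst_mem_closure (ω := turn ω) h
    rw [turn_eq_conjDart] at h
    have := conjDart_mem_dartOrbit h (inv_mem h1)
    rwa [← conjDart_mul, inv_mul_cancel, conjDart_one] at this

theorem rotate_mem_dartOrbit_iff {ω : G × G} : ω ∈ dartOrbit x y ↔ rotate ω ∈ dartOrbit x y := by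
  refine ⟨fun h => ?_, fun h => ?_⟩
  · rw [rotate_eq]
    exact swap_mem_dartOrbit (conjDart_mem_dartOrbit h (inv_mem (snd_mem_closure h)))
  · have h1 : ω.2 ∈ Subgroup.closure {x, y} := fst_mem_closure h
    rw [rotate_eq] at h
    have := conjDart_mem_dartOrbit (swap_mem_dartOrbit h) h1
    rwa [Prod.swap_swap, ← conjDart_mul, mul_inv_cancel, conjDart_one] at this

theorem mem_dartOrbit_of_sameCycle_turn {ω ω' : G × G} (h : ω ∈ dartOrbit x y)
    (h' : turn.SameCycle ω ω') : ω' ∈ dartOrbit x y := by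
  obtain ⟨k, rfl⟩ := h'
  exact (apply_zpow_eq (g := fun _ => ()) (fun a => turn_mem_dartOrbit_iff (ω := a))
    (fun _ _ => rfl) k h).2

theorem mem_dartOrbit_of_sameCycle_rotate {ω ω' : G × G} (h : ω ∈ dartOrbit x y)
    (h' : rotate.SameCycle ω ω') : ω' ∈ dartOrbit x y := by
  obtain ⟨k, rfl⟩ := h'
  exact (apply_zpow_eq (g := fun _ => ()) (fun a => rotate_mem_dartOrbit_iff (ω := a))
    (fun _ _ => rfl) k h).2

theorem isNoncomm_of_mem_dartOrbit (hxy : x * y ≠ y * x) {ω : G × G} (h : ω ∈ dartOrbit x y) :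
    IsNoncomm ω := by
  have h0 : IsNoncomm (x, y) := hxy
  obtain ⟨k, hk, rfl | rfl⟩ := h
  · exact h0.conjDart k
  · exact h0.swap.conjDart k

theorem mem_dartTriangle {ω : G × G} {w : Sheet (complexX G)} :
    w ∈ dartTriangle ω ↔ w = dartTail ω ∨ w = dartHead ω ∨ w = dartFace ω := by
  simp [dartTriangle]

theorem dartTail_ne_dartFace (ω ω' : G × G) : dartTail ω ≠ dartFace ω' := fun h => by
  have : (Sum.inl ω.1 : G ⊕ G) = Sum.inr (ω'.1 * ω'.2) := congrArg Sigma.fst h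
  exact absurd this (by simp)

theorem fst_eq_of_dartTail_eq {ω ω' : G × G} (h : dartTail ω = dartTail ω') : ω.1 = ω'.1 :=
  Sum.inl.inj (congrArg Sigma.fst h)

theorem mul_eq_of_dartFace_eq {ω ω' : G × G} (h : dartFace ω = dartFace ω') :
    ω.1 * ω.2 = ω'.1 * ω'.2 :=
  Sum.inr.inj (congrArg Sigma.fst h)

theorem dartTail_ne_dartHead {ω : G × G} (h : IsNoncomm ω) : dartTail ω ≠ dartHead ω := fun he =>
  h.ne (fst_eq_of_dartTail_eq (ω' := ω.swap) he)

/-- A triangle that shares a vertex with a triangle of the orbit is a triangle of the orbit. -/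
theorem mem_dartOrbit_of_mem_dartTriangle (hxy : x * y ≠ y * x) {ω ω' : G × G}
    (h : ω ∈ dartOrbit x y) {w : Sheet (complexX G)} (hw : w ∈ dartTriangle ω)
    (hw' : w ∈ dartTriangle ω') : ω' ∈ dartOrbit x y := by
  have tail : ∀ ω ω' : G × G, ω ∈ dartOrbit x y → dartTail ω = dartTail ω' →
      ω' ∈ dartOrbit x y :=
    fun ω ω' h he => mem_dartOrbit_of_sameCycle_turn h (dartTail_eq_iff.1 he)
  rw [mem_dartTriangle] at hw hw'
  rcases hw with rfl | rfl | rfl <;> rcases hw' with hw' | hw' | hw'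
  · exact tail _ _ h hw'
  · exact swap_mem_dartOrbit (tail _ ω'.swap h hw')
  · exact absurd hw' (dartTail_ne_dartFace _ _)
  · exact tail _ _ (swap_mem_dartOrbit h) hw'
  · exact swap_mem_dartOrbit (tail _ ω'.swap (swap_mem_dartOrbit h) hw')
  · exact absurd hw' (dartTail_ne_dartFace ω.swap _)
  · exact absurd hw'.symm (dartTail_ne_dartFace _ _)
  · exact absurd hw'.symm (dartTail_ne_dartFace ω'.swap _)
  · exact mem_dartOrbit_of_sameCycle_rotate h
      ((dartFace_eq_iff (isNoncomm_of_mem_dartOrbit hxy h)).1 hw')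

theorem complexY_adj {ω : G × G} (hω : IsNoncomm ω) {v w : Sheet (complexX G)}
    (hv : v ∈ dartTriangle ω) (hw : w ∈ dartTriangle ω) :
    (skeletonGraph (complexY G)).Reachable v w := by
  by_cases h : v = w
  · rw [h]
  · refine SimpleGraph.Adj.reachable ⟨h, mem_complexY_faces_iff.2 ⟨by simp, ω, hω, fun z hz => ?_⟩⟩
    simp only [Finset.mem_insert, Finset.mem_singleton] at hz
    rcases hz with rfl | rfl
    · exact hv
    · exact hw

/-- The orbit, defined by conjugation, is generated from `(x, y)` by swap and `turn`. Extending a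
conjugator on the right by `x` turns the conjugated dart once, since conjugation commutes with
`turn`; extending it by `y` does the same after a swap. -/
theorem dartOrbit_induction {P : G × G → Prop} (h0 : P (x, y))
    (hswap : ∀ ω ∈ dartOrbit x y, P ω → P ω.swap)
    (hturn : ∀ ω ∈ dartOrbit x y, P ω ↔ P (turn ω)) {ω : G × G} (hω : ω ∈ dartOrbit x y) :
    P ω := by
  have hmem : ∀ g ∈ Subgroup.closure {x, y}, conjDart g (x, y) ∈ dartOrbit x y :=
    fun g hg => ⟨g, hg, Or.inl rfl⟩
  have hiff : ∀ ω ∈ dartOrbit x y, P ω ↔ P ω.swap := fun ω h =>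
    ⟨hswap ω h, hswap ω.swap (swap_mem_dartOrbit h)⟩
  have hx : ∀ g ∈ Subgroup.closure {x, y}, P (conjDart (g * x) (x, y)) ↔ P (conjDart g (x, y)) := by
    intro g hg
    rw [conjDart_mul, ← turn_eq_conjDart (x, y), conjDart_turn, ← hturn _ (hmem g hg)]
  have hy : ∀ g ∈ Subgroup.closure {x, y}, P (conjDart (g * y) (x, y)) ↔ P (conjDart g (x, y)) := by
    intro g hg
    have hy : y ∈ Subgroup.closure {x, y} := Subgroup.subset_closure (by simp)
    rw [hiff _ (hmem _ (mul_mem hg hy)), hiff _ (hmem g hg), ← conjDart_swap, ← conjDart_swap,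
      Prod.swap_prod_mk, conjDart_mul, ← turn_eq_conjDart (y, x), conjDart_turn, ← hturn]
    exact swap_mem_dartOrbit (hmem g hg)
  have main : ∀ g ∈ Subgroup.closure {x, y}, P (conjDart g (x, y)) := by
    intro g hg
    induction hg using Subgroup.closure_induction_right with
    | one => rwa [conjDart_one]
    | mul_right g hg s hs ih =>
      rcases hs with rfl | rfl
      · exact (hx g hg).2 ih
      · exact (hy g hg).2 ih
    | mul_inv_cancel g hg s hs ih =>
      have hg' := mul_mem hg (inv_mem (Subgroup.subset_closure hs))
      rcases hs with rfl | rfl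
      · exact (hx _ hg').1 (by rwa [inv_mul_cancel_right])
      · exact (hy _ hg').1 (by rwa [inv_mul_cancel_right])
  obtain ⟨g, hg, rfl | rfl⟩ := hω
  · exact main g hg
  · exact hswap _ (hmem g hg) (main g hg)

theorem reachable_of_mem_dartOrbit (hxy : x * y ≠ y * x) {ω : G × G} (h : ω ∈ dartOrbit x y)
    {w : Sheet (complexX G)} (hw : w ∈ dartTriangle ω) :
    (skeletonGraph (complexY G)).Reachable (cornerFst x y) w := by
  have htail : ∀ ω ∈ dartOrbit x y, (skeletonGraph (complexY G)).Reachable (dartTail ω)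
      (dartHead ω) := fun ω hω => complexY_adj (isNoncomm_of_mem_dartOrbit hxy hω)
    (mem_dartTriangle.2 (Or.inl rfl)) (mem_dartTriangle.2 (Or.inr (Or.inl rfl)))
  have h1 : (skeletonGraph (complexY G)).Reachable (cornerFst x y) (dartTail ω) := by
    refine dartOrbit_induction
      (P := fun ω => (skeletonGraph (complexY G)).Reachable (cornerFst x y) (dartTail ω))
      (SimpleGraph.Reachable.refl _) (fun ω hω h => h.trans (htail ω hω)) (fun ω hω => ?_) h
    rw [dartTail_turn]
  exact h1.trans (complexY_adj (isNoncomm_of_mem_dartOrbit hxy h) (mem_dartTriangle.2 (Or.inl rfl)) hw)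

/-- The orbit contains every triangle touching one of its triangles, so the component cannot leave
it; conversely, generation by swap and `turn` makes all its triangles reachable. -/
theorem mem_componentT_faces_iff (hxy : x * y ≠ y * x) {s : Finset (Sheet (complexX G))} :
    s ∈ (componentT x y).faces ↔ s.Nonempty ∧ ∃ ω ∈ dartOrbit x y, s ⊆ dartTriangle ω := by
  constructor
  · rintro ⟨hs, hr⟩
    obtain ⟨hne, ω, hω, hsub⟩ := mem_complexY_faces_iff.1 hs
    refine ⟨hne, ω, ?_, hsub⟩
    obtain ⟨w, hw⟩ := hne
    have : ∃ ω' ∈ dartOrbit x y, w ∈ dartTriangle ω' := by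
      refine reachable_invariant (P := fun w => ∃ ω' ∈ dartOrbit x y, w ∈ dartTriangle ω') ?_
        (hr w hw) ⟨(x, y), self_mem_dartOrbit, by rw [mem_dartTriangle]; exact Or.inl rfl⟩
      rintro u v ⟨-, huv⟩ ⟨ω', hω', hu⟩
      obtain ⟨-, ω'', -, hsub'⟩ := mem_complexY_faces_iff.1 huv
      exact ⟨ω'', mem_dartOrbit_of_mem_dartTriangle hxy hω' hu (hsub' (by simp)),
        hsub' (by simp)⟩
    obtain ⟨ω', hω', hw'⟩ := this
    exact mem_dartOrbit_of_mem_dartTriangle hxy hω' hw' (hsub hw)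
  · rintro ⟨hne, ω, hω, hsub⟩
    exact ⟨mem_complexY_faces_iff.2 ⟨hne, ω, isNoncomm_of_mem_dartOrbit hxy hω, hsub⟩,
      fun w hw => reachable_of_mem_dartOrbit hxy hω (hsub hw)⟩

theorem singleton_mem_componentT_iff (hxy : x * y ≠ y * x) {w : Sheet (complexX G)} :
    {w} ∈ (componentT x y).faces ↔
      ∃ ω ∈ dartOrbit x y, w = dartTail ω ∨ w = dartFace ω := by
  rw [mem_componentT_faces_iff hxy]
  constructor
  · rintro ⟨-, ω, hω, h⟩
    have := mem_dartTriangle.1 (h (Finset.mem_singleton_self w))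
    rcases this with h | h | h
    · exact ⟨ω, hω, Or.inl h⟩
    · exact ⟨ω.swap, swap_mem_dartOrbit hω, Or.inl h⟩
    · exact ⟨ω, hω, Or.inr h⟩
  · rintro ⟨ω, hω, h⟩
    refine ⟨by simp, ω, hω, ?_⟩
    rw [Finset.singleton_subset_iff, mem_dartTriangle]
    tauto

theorem componentT_reachable {w : Sheet (complexX G)}
    (hw : {w} ∈ (componentT x y).faces) :
    (skeletonGraph (componentT x y)).Reachable (cornerFst x y) w :=
  reachable_component (hw.2 w (by simp))

/-! ### Links in the component -/

/-- The underlying identity is `rotate (turn ω).swap = ω`, the relation among the three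
permutations. -/
theorem dartFace_swap_turn {ω : G × G} (h : IsNoncomm ω) :
    dartFace (turn ω).swap = dartFace ω := by
  rw [← dartFace_rotate h.turn.swap]
  congr 1
  obtain ⟨p, q⟩ := ω
  simp [turn_apply, rotate_apply, mul_assoc]

theorem turn_pow_fst (k : ℕ) (ω : G × G) : ((turn ^ k) ω).1 = ω.1 := by
  have := turn_zpow (k : ℤ) ω.1 ω.2
  rw [zpow_natCast] at this
  rw [show ω = (ω.1, ω.2) from rfl, this]

theorem rotate_pow_mul (k : ℕ) (ω : G × G) :
    ((rotate ^ k) ω).1 * ((rotate ^ k) ω).2 = ω.1 * ω.2 := by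
  rw [← zpow_natCast, rotate_zpow_mul]

/-- The vertices of the link of `dartTail ω`. -/
def tailLink (ω : G × G) (j : ℕ) : Sheet (complexX G) :=
  if Even j then dartHead ((turn ^ (j / 2)) ω) else dartFace ((turn ^ (j / 2)) ω)

theorem tailLink_even (ω : G × G) (k : ℕ) : tailLink ω (2 * k) = dartHead ((turn ^ k) ω) := by
  simp [tailLink]

theorem tailLink_odd (ω : G × G) (k : ℕ) : tailLink ω (2 * k + 1) = dartFace ((turn ^ k) ω) := by
  rw [tailLink, if_neg (by simp), show (2 * k + 1) / 2 = k by omega]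

variable [Finite G]

theorem two_le_minimalPeriod_turn {ω : G × G} (h : IsNoncomm ω) :
    2 ≤ Function.minimalPeriod turn ω := by
  have h0 : 0 < Function.minimalPeriod turn ω := minimalPeriod_pos'
  have h1 : Function.minimalPeriod turn ω ≠ 1 := by
    intro h1
    have h2 : turn ω = ω := Function.minimalPeriod_eq_one_iff_isFixedPt.1 h1
    obtain ⟨p, q⟩ := ω
    rw [turn_apply] at h2
    exact h (mul_inv_eq_iff_eq_mul.1 (Prod.ext_iff.1 h2).2)
  omega

theorem three_le_minimalPeriod_rotate {ω : G × G} (h : IsNoncomm ω) :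
    3 ≤ Function.minimalPeriod rotate ω := by
  have h0 : 0 < Function.minimalPeriod rotate ω := minimalPeriod_pos'
  have hp := Function.isPeriodicPt_minimalPeriod rotate ω
  obtain ⟨p, q⟩ := ω
  by_contra hlt
  have h12 : Function.minimalPeriod rotate (p, q) = 1 ∨ Function.minimalPeriod rotate (p, q) = 2 := by
    omega
  rcases h12 with h1 | h1 <;> rw [h1] at hp
  · exact h.ne (Prod.ext_iff.1 hp).1.symm
  · have : q⁻¹ * p * q = p := (Prod.ext_iff.1 hp).1
    rw [mul_assoc, inv_mul_eq_iff_eq_mul] at this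
    exact h this

/-- All darts around the face have the same product, so each is determined by its first entry. This
keeps the boundary vertices distinct even as vertices of `X(G)`. -/
theorem hasCircleLink_dartFace (hxy : x * y ≠ y * x) {ω : G × G} (hω : ω ∈ dartOrbit x y) :
    HasCircleLink (componentT x y) (dartFace ω) (Function.minimalPeriod rotate ω)
      (fun k => dartTail ((rotate ^ k) ω)) where
  three_le := three_le_minimalPeriod_rotate (isNoncomm_of_mem_dartOrbit hxy hω)
  periodic k := by rw [pow_add_minimalPeriod_apply]
  injOn := by
    intro i hi j hj hij
    refine pow_injOn_Iio_minimalPeriod hi hj ?_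
    have h1 := fst_eq_of_dartTail_eq hij
    have h2 := (rotate_pow_mul i ω).trans (rotate_pow_mul j ω).symm
    rw [h1] at h2
    exact Prod.ext h1 (mul_left_cancel h2)
  ne k := dartTail_ne_dartFace _ _
  mem_faces_iff s hs := by
    rw [mem_componentT_faces_iff hxy]
    have htri : ∀ k : ℕ, dartTriangle ((rotate ^ k) ω) =
        {dartFace ω, dartTail ((rotate ^ k) ω), dartTail ((rotate ^ (k + 1)) ω)} := by
      intro k
      rw [(dartFace_eq_iff (isNoncomm_of_mem_dartOrbit hxy hω)).2 (sameCycle_pow rotate k ω),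
        pow_succ', Equiv.Perm.mul_apply, dartTail_rotate, dartTriangle]
      ext; simp; tauto
    constructor
    · rintro ⟨-, ω', hω', hsub⟩
      have h1 : dartFace ω = dartFace ω' := by
        rcases mem_dartTriangle.1 (hsub hs) with h | h | h
        · exact absurd h.symm (dartTail_ne_dartFace _ _)
        · exact absurd h.symm (dartTail_ne_dartFace ω'.swap _)
        · exact h
      obtain ⟨k, -, -, rfl⟩ :=
        ((dartFace_eq_iff (isNoncomm_of_mem_dartOrbit hxy hω)).1 h1).exists_pow_eq''
      exact ⟨k, hsub.trans (htri k).subset⟩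
    · rintro ⟨k, hk⟩
      exact ⟨⟨_, hs⟩, (rotate ^ k) ω, mem_dartOrbit_of_sameCycle_rotate hω (sameCycle_pow _ k ω),
        hk.trans (htri k).symm.subset⟩

/-- The circle alternates between heads and type 2 vertices, hence the factor `2`. Its edges are of
two kinds: from head `k` to face `k` by the dart after `k` turns, and from face `k` to head `k + 1`
by the swap of the dart after `k + 1` turns. -/
theorem hasCircleLink_dartTail (hxy : x * y ≠ y * x) {ω : G × G} (hω : ω ∈ dartOrbit x y) :
    HasCircleLink (componentT x y) (dartTail ω) (2 * Function.minimalPeriod turn ω)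
      (tailLink ω) where
  three_le := by
    have := two_le_minimalPeriod_turn (isNoncomm_of_mem_dartOrbit hxy hω)
    omega
  periodic k := by
    rcases Nat.even_or_odd' k with ⟨m, rfl | rfl⟩
    · rw [← mul_add, tailLink_even, tailLink_even, pow_add_minimalPeriod_apply]
    · rw [add_right_comm, ← mul_add, tailLink_odd, tailLink_odd, pow_add_minimalPeriod_apply]
  injOn := by
    intro i hi j hj hij
    rw [Set.mem_Iio] at hi hj
    have hsnd : ∀ a b : ℕ, ((turn ^ a) ω).2 = ((turn ^ b) ω).2 → (turn ^ a) ω = (turn ^ b) ω :=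
      fun a b h => Prod.ext ((turn_pow_fst a ω).trans (turn_pow_fst b ω).symm) h
    rcases Nat.even_or_odd' i with ⟨a, rfl | rfl⟩ <;> rcases Nat.even_or_odd' j with ⟨b, rfl | rfl⟩
    · rw [tailLink_even, tailLink_even] at hij
      have := pow_injOn_Iio_minimalPeriod (f := turn) (a := ω)
        (show a < _ by omega) (show b < _ by omega)
        (hsnd a b (fst_eq_of_dartTail_eq (ω := Prod.swap _) (ω' := Prod.swap _) hij))
      omega
    · rw [tailLink_even, tailLink_odd] at hij
      exact absurd hij (dartTail_ne_dartFace (Prod.swap _) _)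
    · rw [tailLink_even, tailLink_odd] at hij
      exact absurd hij.symm (dartTail_ne_dartFace (Prod.swap _) _)
    · rw [tailLink_odd, tailLink_odd] at hij
      have h1 := mul_eq_of_dartFace_eq hij
      rw [turn_pow_fst, turn_pow_fst] at h1
      have := pow_injOn_Iio_minimalPeriod (f := turn) (a := ω)
        (show a < _ by omega) (show b < _ by omega) (hsnd a b (mul_left_cancel h1))
      omega
  ne k := by
    rcases Nat.even_or_odd' k with ⟨m, rfl | rfl⟩
    · rw [tailLink_even]
      intro h
      have h1 := isNoncomm_of_mem_dartOrbit hxy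
        (mem_dartOrbit_of_sameCycle_turn hω (sameCycle_pow turn m ω))
      have h2 := fst_eq_of_dartTail_eq (ω := Prod.swap _) h
      exact h1.ne ((turn_pow_fst m ω).trans h2.symm)
    · rw [tailLink_odd]
      exact (dartTail_ne_dartFace _ _).symm
  mem_faces_iff s hs := by
    rw [mem_componentT_faces_iff hxy]
    have hmem : ∀ k : ℕ, (turn ^ k) ω ∈ dartOrbit x y := fun k =>
      mem_dartOrbit_of_sameCycle_turn hω (sameCycle_pow turn k ω)
    have htail : ∀ k : ℕ, dartTail ((turn ^ k) ω) = dartTail ω := fun k =>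
      (dartTail_eq_iff.2 (sameCycle_pow turn k ω)).symm
    have htri : ∀ k : ℕ, dartTriangle ((turn ^ k) ω) =
        {dartTail ω, tailLink ω (2 * k), tailLink ω (2 * k + 1)} := by
      intro k
      rw [tailLink_even, tailLink_odd, ← htail k, dartTriangle]
    have htri' : ∀ k : ℕ, dartTriangle ((turn ^ (k + 1)) ω).swap =
        {dartTail ω, tailLink ω (2 * k + 1), tailLink ω (2 * k + 1 + 1)} := by
      intro k
      rw [show 2 * k + 1 + 1 = 2 * (k + 1) by ring, tailLink_even, tailLink_odd, ← htail (k + 1),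
        dartTriangle, dartTail_swap, dartHead_swap, pow_succ', Equiv.Perm.mul_apply,
        dartFace_swap_turn (isNoncomm_of_mem_dartOrbit hxy (hmem k))]
      ext; simp; tauto
    constructor
    · rintro ⟨-, ω', hω', hsub⟩
      rcases mem_dartTriangle.1 (hsub hs) with h | h | h
      · obtain ⟨k, -, -, rfl⟩ := (dartTail_eq_iff.1 h).exists_pow_eq''
        exact ⟨2 * k, hsub.trans (htri k).subset⟩
      · obtain ⟨k, hk, -, hk'⟩ := (dartTail_eq_iff (ω' := ω'.swap).1 h).exists_pow_eq''
        -- The exponent can be taken positive within a cycle; its predecessor is needed because an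
        -- incoming triangle lies between face `m` and head `m + 1`.
        obtain ⟨m, rfl⟩ : ∃ m, k = m + 1 := ⟨k - 1, by omega⟩
        have := htri' m
        rw [hk', Prod.swap_swap] at this
        exact ⟨2 * m + 1, hsub.trans this.subset⟩
      · exact absurd h (dartTail_ne_dartFace _ _)
    · rintro ⟨k, hk⟩
      rcases Nat.even_or_odd' k with ⟨m, rfl | rfl⟩
      · exact ⟨⟨_, hs⟩, _, hmem m, hk.trans (htri m).symm.subset⟩
      · exact ⟨⟨_, hs⟩, _, swap_mem_dartOrbit (hmem (m + 1)), hk.trans (htri' m).symm.subset⟩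

end Orbit

/-! ### Orientation -/

section Orientation

variable {G : Type*} [Group G] {x y : G}

theorem dart_eq_of_tail_head {ω ω' : G × G} (h1 : dartTail ω = dartTail ω')
    (h2 : dartHead ω = dartHead ω') : ω = ω' :=
  Prod.ext (fst_eq_of_dartTail_eq h1) (fst_eq_of_dartTail_eq (ω := ω.swap) (ω' := ω'.swap) h2)

theorem dart_eq_of_tail_face {ω ω' : G × G} (h1 : dartTail ω = dartTail ω')
    (h2 : dartFace ω = dartFace ω') : ω = ω' := by
  have h3 := fst_eq_of_dartTail_eq h1
  have h4 := mul_eq_of_dartFace_eq h2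
  rw [h3] at h4
  exact Prod.ext h3 (mul_left_cancel h4)

theorem dart_eq_of_head_face {ω ω' : G × G} (h1 : dartHead ω = dartHead ω')
    (h2 : dartFace ω = dartFace ω') : ω = ω' := by
  have h3 : ω.2 = ω'.2 := fst_eq_of_dartTail_eq (ω := ω.swap) (ω' := ω'.swap) h1
  have h4 := mul_eq_of_dartFace_eq h2
  rw [h3] at h4
  exact Prod.ext (mul_right_cancel h4) h3

theorem dartHead_ne_dartFace (ω ω' : G × G) : dartHead ω ≠ dartFace ω' :=
  dartTail_ne_dartFace ω.swap ω'

/-- The triple is an oriented triangle of the component. -/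
def IsPositive (x y : G) (a b c : Sheet (complexX G)) : Prop :=
  ∃ ω ∈ dartOrbit x y, IsCyclicPerm (dartTail ω) (dartHead ω) (dartFace ω) a b c

theorem isPositive_rotate {a b c : Sheet (complexX G)} :
    IsPositive x y b c a ↔ IsPositive x y a b c := by
  simp only [IsPositive, isCyclicPerm_rotate]

/-- The types of `a` and `b` tell which two corners they are, and any two corners determine the
dart. -/
theorem IsPositive.unique {a b c d : Sheet (complexX G)} (h : IsPositive x y a b c)
    (h' : IsPositive x y a b d) : c = d := by
  obtain ⟨ω, -, ⟨h1, h2, h3⟩ | ⟨h1, h2, h3⟩ | ⟨h1, h2, h3⟩⟩ := h <;>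
  obtain ⟨ω', -, ⟨k1, k2, k3⟩ | ⟨k1, k2, k3⟩ | ⟨k1, k2, k3⟩⟩ := h'
  · rw [h3, k3, dart_eq_of_tail_head (h1.symm.trans k1) (h2.symm.trans k2)]
  · exact absurd (h2.symm.trans k2) (dartHead_ne_dartFace _ _)
  · exact absurd (h1.symm.trans k1) (dartTail_ne_dartFace _ _)
  · exact absurd (k2.symm.trans h2) (dartHead_ne_dartFace _ _)
  · rw [h3, k3, dart_eq_of_head_face (h1.symm.trans k1) (h2.symm.trans k2)]
  · exact absurd (h1.symm.trans k1) (dartHead_ne_dartFace _ _)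
  · exact absurd (k1.symm.trans h1) (dartTail_ne_dartFace _ _)
  · exact absurd (k1.symm.trans h1) (dartHead_ne_dartFace _ _)
  · rw [h3, k3, dart_eq_of_tail_face (h2.symm.trans k2) (h1.symm.trans k1)]

/-- A dart and its swap share tail and head as a pair, but their type 2 corners lie over `p q` and
`q p`, which differ. -/
theorem dartTriangle_injective {ω ω' : G × G} (hω : IsNoncomm ω)
    (h : dartTriangle ω ⊆ dartTriangle ω') : ω = ω' := by
  have h1 := mem_dartTriangle.1 (h (mem_dartTriangle.2 (Or.inl rfl)))
  have h2 := mem_dartTriangle.1 (h (mem_dartTriangle.2 (Or.inr (Or.inl rfl))))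
  have h3 := mem_dartTriangle.1 (h (mem_dartTriangle.2 (Or.inr (Or.inr rfl))))
  have h3 : dartFace ω = dartFace ω' := by
    rcases h3 with h3 | h3 | h3
    · exact absurd h3.symm (dartTail_ne_dartFace _ _)
    · exact absurd h3.symm (dartHead_ne_dartFace _ _)
    · exact h3
  rcases h1 with h1 | h1 | h1
  · exact dart_eq_of_tail_face h1 h3
  · exfalso
    rcases h2 with h2 | h2 | h2
    · have e1 : ω.1 = ω'.2 := fst_eq_of_dartTail_eq (ω' := ω'.swap) h1
      have e2 : ω.2 = ω'.1 := fst_eq_of_dartTail_eq (ω := ω.swap) h2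
      have e3 := mul_eq_of_dartFace_eq h3
      rw [← e1, ← e2] at e3
      exact hω e3
    · exact dartTail_ne_dartHead hω (h1.trans h2.symm)
    · exact dartHead_ne_dartFace _ _ h2
  · exact absurd h1 (dartTail_ne_dartFace _ _)

theorem IsPositive.not_swap (hxy : x * y ≠ y * x) {a b c : Sheet (complexX G)}
    (h : IsPositive x y a b c) : ¬ IsPositive x y b a c := by
  rintro ⟨ω', hω', h'⟩
  obtain ⟨ω, hω, h⟩ := h
  have hn := isNoncomm_of_mem_dartOrbit hxy hω
  obtain rfl : ω = ω' := by
    refine dartTriangle_injective hn ?_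
    rw [dartTriangle, dartTriangle, ← h.insert_eq, ← h'.insert_eq, Finset.insert_comm]
  have e1 := dartTail_ne_dartHead hn
  have e2 := dartTail_ne_dartFace ω ω
  have e3 := dartHead_ne_dartFace ω ω
  exact h.not_swap e1 e3 e2 h'

theorem isPositive_or_of_mem_faces (hxy : x * y ≠ y * x) {a b c : Sheet (complexX G)}
    (hab : a ≠ b) (hbc : b ≠ c) (hac : a ≠ c) (h : {a, b, c} ∈ (componentT x y).faces) :
    IsPositive x y a b c ∨ IsPositive x y b a c := by
  obtain ⟨-, ω, hω, hsub⟩ := (mem_componentT_faces_iff hxy).1 h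
  have heq : ({a, b, c} : Finset (Sheet (complexX G))) = dartTriangle ω := by
    refine Finset.eq_of_subset_of_card_le hsub ?_
    rw [Finset.card_eq_three.2 ⟨a, b, c, hab, hac, hbc, rfl⟩]
    exact Finset.card_le_three
  rcases isCyclicPerm_of_insert_eq hab hbc hac heq with h | h
  · exact Or.inl ⟨ω, hω, h⟩
  · exact Or.inr ⟨ω, hω, h⟩

theorem IsPositive.mem_faces (hxy : x * y ≠ y * x) {a b c : Sheet (complexX G)}
    (h : IsPositive x y a b c) : {a, b, c} ∈ (componentT x y).faces := by
  obtain ⟨ω, hω, h⟩ := h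
  exact (mem_componentT_faces_iff hxy).2 ⟨by simp, ω, hω, h.insert_eq.subset⟩

/-- The orientation of the component. -/
def orientation (x y : G) (a b c : Sheet (complexX G)) : ℤ :=
  (if IsPositive x y a b c then 1 else 0) - (if IsPositive x y b a c then 1 else 0)

theorem orientation_of_isPositive (hxy : x * y ≠ y * x) {a b c : Sheet (complexX G)}
    (h : IsPositive x y a b c) : orientation x y a b c = 1 := by
  rw [orientation, if_pos h, if_neg (h.not_swap hxy), sub_zero]

theorem orientation_swap (a b c : Sheet (complexX G)) :
    orientation x y b a c = - orientation x y a b c ∧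
    orientation x y a c b = - orientation x y a b c := by
  refine ⟨(neg_sub _ _).symm, ?_⟩
  rw [orientation, orientation, neg_sub, isPositive_rotate (a := b) (b := a),
    ← isPositive_rotate (a := c) (b := a) (c := b)]

theorem isOrientation_orientation [Finite G] (hxy : x * y ≠ y * x) :
    IsOrientation (componentT x y) (orientation x y) := by
  have hneg : ∀ {a b c}, IsPositive x y b a c → orientation x y a b c = -1 := fun h => by
    rw [(orientation_swap _ _ _).1, orientation_of_isPositive hxy h]
  refine ⟨orientation_swap, fun a b c hab hbc hac hf => ?_, ?_⟩
  · rcases isPositive_or_of_mem_faces hxy hab hbc hac hf with h | h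
    · exact Or.inl (orientation_of_isPositive hxy h)
    · exact Or.inr (hneg h)
  · intro a b c d hab hbc hac hbd had hcd hf hf'
    rcases isPositive_or_of_mem_faces hxy hab hbc hac hf with h | h <;>
      rcases isPositive_or_of_mem_faces hxy hab hbd had hf' with h' | h'
    · exact absurd (h.unique h') hcd
    · rw [orientation_of_isPositive hxy h, hneg h', neg_neg]
    · rw [hneg h, orientation_of_isPositive hxy h']
    · exact absurd (h.unique h') hcd

/-! ### The 2-cycles -/

variable [Finite G]

/-- Only the two triangles on the edge `a b` contribute to the boundary there, with opposite signs.
-/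
theorem cycles₂_apply_eq (hxy : x * y ≠ y * x) {f : Sheet (complexX G) → Sheet (complexX G) →
    Sheet (complexX G) → ℚ} (hf : f ∈ chains₂ (componentT x y)) (hf0 : boundary₂ f = 0)
    {a b c d : Sheet (complexX G)} (hc : IsPositive x y a b c) (hd : IsPositive x y b a d) :
    f a b c = f b a d := by
  have hcd : c ≠ d := by
    rintro rfl
    exact hc.not_swap hxy hd
  have h0 : ∑ e, f e a b = 0 := congrFun (congrFun hf0 a) b
  have hcyc : ∀ e, f e a b = f a b e := fun e => by
    rw [(hf.1 a e b).1, (hf.1 a b e).2, neg_neg]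
  simp_rw [hcyc] at h0
  rw [Finset.sum_eq_add c d hcd] at h0
  · rw [(hf.1 a b d).1]
    linarith
  · rintro e - ⟨hec, hed⟩
    by_contra hne
    have hab : a ≠ b := fun h => hne (h ▸ (chains₂_self hf a e).1)
    have hbe : b ≠ e := fun h => hne (h ▸ (chains₂_self hf a b).2.1)
    have hae : a ≠ e := fun h => hne (h ▸ (chains₂_self hf a b).2.2)
    rcases isPositive_or_of_mem_faces hxy hab hbe hae (hf.2 _ _ _ hne) with h | h
    · exact hec (h.unique hc)
    · exact hed (h.unique hd)
  · simp
  · simp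

theorem chains₂_isCyclicPerm {W : Type*} [Fintype W] {K : PreAbstractSimplicialComplex W}
    {f : W → W → W → ℚ} (hf : f ∈ chains₂ K) {A B C a b c : W} (h : IsCyclicPerm A B C a b c) :
    f a b c = f A B C := by
  have hcyc : ∀ a b c, f b c a = f a b c := fun a b c => by
    rw [(hf.1 _ _ _).2, (hf.1 _ _ _).1, neg_neg]
  rcases h with ⟨rfl, rfl, rfl⟩ | ⟨rfl, rfl, rfl⟩ | ⟨rfl, rfl, rfl⟩
  · rfl
  · exact hcyc _ _ _
  · exact (hcyc _ _ _).symm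

/-- The orientation itself is a cycle, the fundamental class. Conversely, a cycle has equal
coefficients on triangles with a common edge, hence is a multiple of it by `dartOrbit_induction`. -/
theorem finrank_cycles₂ (hxy : x * y ≠ y * x) :
    Module.finrank ℚ (chains₂ (componentT x y) ⊓ LinearMap.ker boundary₂ : Submodule ℚ
      (Sheet (complexX G) → Sheet (complexX G) → Sheet (complexX G) → ℚ)) = 1 := by
  set o : Sheet (complexX G) → Sheet (complexX G) → Sheet (complexX G) → ℚ :=
    fun a b c => orientation x y a b c with ho
  have hzero : ∀ a b c, o a b c ≠ 0 → IsPositive x y a b c ∨ IsPositive x y b a c := by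
    intro a b c h
    by_contra h'
    push Not at h'
    exact h (by simp [ho, orientation, h'])
  have hchain : o ∈ chains₂ (componentT x y) := by
    refine ⟨fun a b c => ⟨?_, ?_⟩, fun a b c h => ?_⟩
    · simp only [ho, (orientation_swap a b c).1]; push_cast; rfl
    · simp only [ho, (orientation_swap a b c).2]; push_cast; rfl
    · rcases hzero a b c h with h | h
      · exact h.mem_faces hxy
      · rw [Finset.insert_comm]; exact h.mem_faces hxy
  have hpos : ∀ {a b c}, IsPositive x y a b c → o a b c = 1 := fun h => by
    simp only [ho, orientation_of_isPositive hxy h, Int.cast_one]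
  -- The triangle across an edge: the swap across tail and head, `rotate` across head and face, its
  -- inverse across face and tail.
  have hswapR : ∀ {a b c}, IsPositive x y a b c → ∃ d, IsPositive x y b a d := by
    rintro a b c ⟨ω, hω, ⟨rfl, rfl, rfl⟩ | ⟨rfl, rfl, rfl⟩ | ⟨rfl, rfl, rfl⟩⟩
    · exact ⟨_, ω.swap, swap_mem_dartOrbit hω, Or.inl ⟨rfl, rfl, rfl⟩⟩
    · refine ⟨dartHead (rotate ω), rotate ω, rotate_mem_dartOrbit_iff.1 hω,
        Or.inr (Or.inr ⟨?_, ?_, rfl⟩)⟩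
      · exact (dartFace_rotate (isNoncomm_of_mem_dartOrbit hxy hω)).symm
      · exact (dartTail_rotate ω).symm
    · obtain ⟨ω', rfl⟩ := rotate.surjective ω
      have hω' := rotate_mem_dartOrbit_iff.2 hω
      refine ⟨dartTail ω', ω', hω', Or.inr (Or.inl ⟨?_, ?_, rfl⟩)⟩
      · exact dartTail_rotate ω'
      · exact dartFace_rotate (isNoncomm_of_mem_dartOrbit hxy hω')
  have hker : boundary₂ o = 0 := by
    funext a b
    rw [boundary₂_apply]
    have hcyc : ∀ e, o e a b = o a b e := fun e => by
      rw [(hchain.1 a e b).1, (hchain.1 a b e).2, neg_neg]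
    simp_rw [hcyc]
    by_cases h : ∃ c, IsPositive x y a b c ∨ IsPositive x y b a c
    · have : ∃ c d, IsPositive x y a b c ∧ IsPositive x y b a d := by
        obtain ⟨c, h | h⟩ := h
        · obtain ⟨d, hd⟩ := hswapR h
          exact ⟨c, d, h, hd⟩
        · obtain ⟨d, hd⟩ := hswapR h
          exact ⟨d, c, hd, h⟩
      obtain ⟨c, d, hc, hd⟩ := this
      have hcd : c ≠ d := by
        rintro rfl
        exact hc.not_swap hxy hd
      rw [Finset.sum_eq_add c d hcd]
      · rw [hpos hc, (hchain.1 b a d).1, hpos hd]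
        simp
      · rintro e - ⟨hec, hed⟩
        by_contra hne
        rcases hzero _ _ _ hne with h | h
        · exact hec (h.unique hc)
        · exact hed (h.unique hd)
      · simp
      · simp
    · push Not at h
      refine Finset.sum_eq_zero fun e _ => ?_
      by_contra hne
      rcases hzero _ _ _ hne with h' | h'
      · exact (h e).1 h'
      · exact (h e).2 h'
  have hpos0 : IsPositive x y (dartTail (x, y)) (dartHead (x, y)) (dartFace (x, y)) :=
    ⟨_, self_mem_dartOrbit, Or.inl ⟨rfl, rfl, rfl⟩⟩
  refine (finrank_eq_one_iff_of_nonzero' ⟨o, hchain, hker⟩ ?_).2 ?_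
  · intro h
    have h1 : o (dartTail (x, y)) (dartHead (x, y)) (dartFace (x, y)) = 0 :=
      congrFun (congrFun (congrFun (congrArg Subtype.val h) _) _) _
    rw [hpos hpos0] at h1
    exact one_ne_zero h1
  · rintro ⟨f, hf, hf0⟩
    have hf0' : boundary₂ f = 0 := hf0
    refine ⟨f (dartTail (x, y)) (dartHead (x, y)) (dartFace (x, y)), Subtype.ext ?_⟩
    set r := f (dartTail (x, y)) (dartHead (x, y)) (dartFace (x, y)) with hr
    have hswap : ∀ ω ∈ dartOrbit x y, f (dartTail ω) (dartHead ω) (dartFace ω) =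
        f (dartTail ω.swap) (dartHead ω.swap) (dartFace ω.swap) := fun ω hω =>
      cycles₂_apply_eq hxy hf hf0' ⟨ω, hω, Or.inl ⟨rfl, rfl, rfl⟩⟩
        ⟨ω.swap, swap_mem_dartOrbit hω, Or.inl ⟨rfl, rfl, rfl⟩⟩
    have hrot : ∀ ω ∈ dartOrbit x y, f (dartTail ω) (dartHead ω) (dartFace ω) =
        f (dartTail (rotate ω)) (dartHead (rotate ω)) (dartFace (rotate ω)) := by
      intro ω hω
      have h1 : IsCyclicPerm (dartTail ω) (dartHead ω) (dartFace ω)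
        (dartHead ω) (dartFace ω) (dartTail ω) := Or.inr (Or.inl ⟨rfl, rfl, rfl⟩)
      have h2 : IsCyclicPerm (dartTail (rotate ω)) (dartHead (rotate ω)) (dartFace (rotate ω))
          (dartFace ω) (dartHead ω) (dartHead (rotate ω)) :=
        Or.inr (Or.inr ⟨(dartFace_rotate (isNoncomm_of_mem_dartOrbit hxy hω)).symm,
          (dartTail_rotate ω).symm, rfl⟩)
      rw [← chains₂_isCyclicPerm hf h1, ← chains₂_isCyclicPerm hf h2]
      exact cycles₂_apply_eq hxy hf hf0' ⟨_, hω, h1⟩ ⟨_, rotate_mem_dartOrbit_iff.1 hω, h2⟩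
    have hconst : ∀ ω ∈ dartOrbit x y, f (dartTail ω) (dartHead ω) (dartFace ω) = r := by
      intro ω hω
      refine dartOrbit_induction
        (P := fun ω => f (dartTail ω) (dartHead ω) (dartFace ω) = r) rfl ?_ ?_ hω
      · intro ω hω h
        rw [← hswap ω hω, h]
      · intro ω hω
        have hω' := turn_mem_dartOrbit_iff.1 hω
        have : rotate (turn ω).swap = ω := by
          obtain ⟨p, q⟩ := ω
          simp [turn_apply, rotate_apply, mul_assoc]
        rw [hswap _ hω', hrot _ (swap_mem_dartOrbit hω'), this]
    have hval : ∀ {a b c}, IsPositive x y a b c → f a b c = r := by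
      rintro a b c ⟨ω, hω, h⟩
      rw [chains₂_isCyclicPerm hf h, hconst ω hω]
    funext a b c
    change r * o a b c = f a b c
    by_cases h : IsPositive x y a b c
    · rw [hpos h, hval h, mul_one]
    by_cases h' : IsPositive x y b a c
    · rw [(hchain.1 b a c).1, (hf.1 b a c).1, hpos h', hval h', mul_neg, mul_one]
    · have h1 : o a b c = 0 := by
        by_contra hne
        rcases hzero _ _ _ hne with h1 | h1
        · exact h h1
        · exact h' h1
      have h2 : f a b c = 0 := by
        by_contra hne
        have hab : a ≠ b := fun h => hne (h ▸ (chains₂_self hf a c).1)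
        have hbe : b ≠ c := fun h => hne (h ▸ (chains₂_self hf a b).2.1)
        have hae : a ≠ c := fun h => hne (h ▸ (chains₂_self hf a b).2.2)
        rcases isPositive_or_of_mem_faces hxy hab hbe hae (hf.2 _ _ _ hne) with h1 | h1
        · exact h h1
        · exact h' h1
      rw [h1, h2, mul_zero]

end Orientation

/-! ### Cells of the component -/

section ComponentCells

variable {G : Type*} [Group G] {x y : G}

theorem dartTail_notMem_typeTwo (ω : G × G) : dartTail ω ∉ typeTwo G := by
  simp [typeTwo, dartTail, cornerFst, sheetAt]

theorem dartHead_notMem_typeTwo (ω : G × G) : dartHead ω ∉ typeTwo G :=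
  dartTail_notMem_typeTwo ω.swap

theorem dartFace_mem_typeTwo (ω : G × G) : dartFace ω ∈ typeTwo G := by
  simp [typeTwo, dartFace, cornerTwo, sheetAt]

theorem mem_cellVertices_iff [Finite G] (hxy : x * y ≠ y * x) {w : Sheet (complexX G)} :
    w ∈ cellVertices (componentT x y) (typeTwo G) ↔ ∃ ω ∈ dartOrbit x y, w = dartTail ω := by
  rw [cellVertices, Set.mem_ofPred_eq, singleton_mem_componentT_iff hxy]
  constructor
  · rintro ⟨⟨ω, hω, rfl | rfl⟩, hD⟩
    · exact ⟨ω, hω, rfl⟩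
    · exact absurd (dartFace_mem_typeTwo ω) hD
  · rintro ⟨ω, hω, rfl⟩
    exact ⟨⟨ω, hω, Or.inl rfl⟩, dartTail_notMem_typeTwo ω⟩

theorem mem_cellFaces_iff [Finite G] (hxy : x * y ≠ y * x) {w : Sheet (complexX G)} :
    w ∈ cellFaces (componentT x y) (typeTwo G) ↔ ∃ ω ∈ dartOrbit x y, w = dartFace ω := by
  rw [cellFaces, Set.mem_ofPred_eq, singleton_mem_componentT_iff hxy]
  constructor
  · rintro ⟨⟨ω, hω, rfl | rfl⟩, hD⟩
    · exact absurd hD (dartTail_notMem_typeTwo ω)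
    · exact ⟨ω, hω, rfl⟩
  · rintro ⟨ω, hω, rfl⟩
    exact ⟨⟨ω, hω, Or.inr rfl⟩, dartFace_mem_typeTwo ω⟩

theorem mem_cellEdges_iff [Finite G] (hxy : x * y ≠ y * x) {e : Finset (Sheet (complexX G))} :
    e ∈ cellEdges (componentT x y) (typeTwo G) ↔
      ∃ ω ∈ dartOrbit x y, e = {dartTail ω, dartHead ω} := by
  rw [cellEdges, Set.mem_ofPred_eq, mem_componentT_faces_iff hxy]
  constructor
  · rintro ⟨⟨-, ω, hω, hsub⟩, hcard, hD⟩
    refine ⟨ω, hω, Finset.eq_of_subset_of_card_le (fun w hw => ?_) ?_⟩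
    · rcases mem_dartTriangle.1 (hsub hw) with h | h | h
      · simp [h]
      · simp [h]
      · exact absurd (h ▸ dartFace_mem_typeTwo ω) (hD w hw)
    · rw [hcard]
      exact Finset.card_le_two
  · rintro ⟨ω, hω, rfl⟩
    refine ⟨⟨by simp, ω, hω, ?_⟩, Finset.card_pair
      (dartTail_ne_dartHead (isNoncomm_of_mem_dartOrbit hxy hω)), ?_⟩
    · intro w hw
      rw [mem_dartTriangle]
      simp only [Finset.mem_insert, Finset.mem_singleton] at hw
      tauto
    · intro w hw
      simp only [Finset.mem_insert, Finset.mem_singleton] at hw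
      rcases hw with rfl | rfl
      · exact dartTail_notMem_typeTwo ω
      · exact dartHead_notMem_typeTwo ω

/-- Conjugation commutes with `rotate`, and the swap of a dart is its rotation up to conjugation, so
one period serves all faces. -/
theorem minimalPeriod_rotate_of_mem_dartOrbit {ω : G × G} (h : ω ∈ dartOrbit x y) :
    Function.minimalPeriod rotate ω = Function.minimalPeriod rotate (x, y) := by
  have hconj : ∀ g ω, Function.minimalPeriod rotate (conjDart (G := G) g ω) =
      Function.minimalPeriod rotate ω := fun g ω =>
    minimalPeriod_apply_of_commute (conjDart_rotate g) ω
  have hrot : ∀ ω : G × G, Function.minimalPeriod rotate (rotate ω) =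
      Function.minimalPeriod rotate ω := fun ω => minimalPeriod_apply_of_commute (fun _ => rfl) ω
  obtain ⟨g, -, rfl | rfl⟩ := h
  · exact hconj g _
  · rw [hconj, ← hrot (x, y), rotate_eq, ← conjDart_swap, hconj]
    rfl

variable [Finite G]

theorem isNGonStructure_componentT (hxy : x * y ≠ y * x) :
    IsNGonStructure (componentT x y) (typeTwo G) (Function.minimalPeriod rotate (x, y)) := by
  refine ⟨fun f hf => ?_, ?_, fun f hf f' hf' hne => ?_⟩
  · obtain ⟨ω, hω, rfl⟩ := (mem_cellFaces_iff hxy).1 hf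
    rw [← minimalPeriod_rotate_of_mem_dartOrbit hω]
    exact (hasCircleLink_dartFace hxy hω).isNGon (dartFace_mem_typeTwo ω)
      fun k => dartTail_notMem_typeTwo _
  · refine Set.eq_univ_of_forall fun p => ?_
    obtain ⟨s, hs, hps⟩ := p.2.2.2
    obtain ⟨-, ω, hω, hsub⟩ := (mem_componentT_faces_iff hxy).1 hs
    refine Set.mem_biUnion ((mem_cellFaces_iff hxy).2 ⟨ω, hω, rfl⟩)
      ⟨dartTriangle ω, (mem_componentT_faces_iff hxy).2 ⟨by simp [dartTriangle], ω, hω, subset_rfl⟩,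
        by simp [dartTriangle], hps.trans (by exact_mod_cast hsub)⟩
  · obtain ⟨ω₀, hω₀, rfl⟩ := (mem_cellFaces_iff hxy).1 hf
    obtain ⟨ω₀', hω₀', rfl⟩ := (mem_cellFaces_iff hxy).1 hf'
    rintro p ⟨⟨s, hs, hfs, hps⟩, ⟨s', hs', hfs', hps'⟩⟩
    obtain ⟨-, ω, hω, hsub⟩ := (mem_componentT_faces_iff hxy).1 hs
    obtain ⟨-, ω', hω', hsub'⟩ := (mem_componentT_faces_iff hxy).1 hs'
    have hface : ∀ {ω ω' : G × G}, dartFace ω ∈ dartTriangle ω' → dartFace ω = dartFace ω' := by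
      intro ω ω' h
      rcases mem_dartTriangle.1 h with h | h | h
      · exact absurd h.symm (dartTail_ne_dartFace _ _)
      · exact absurd h.symm (dartHead_ne_dartFace _ _)
      · exact h
    have h1 := hface (hsub hfs)
    have h2 := hface (hsub' hfs')
    refine Set.mem_biUnion ((mem_cellEdges_iff hxy).2 ⟨ω, hω, rfl⟩) ?_
    intro w hw
    have h3 := mem_dartTriangle.1 (hsub (hps hw))
    rcases h3 with h3 | h3 | h3
    · simp [h3]
    · simp [h3]
    -- A triangle has only one type 2 corner, so a point with positive coordinate at one center lies
    -- in no other closed star.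
    · exfalso
      have h4 := hsub' (hps' hw)
      rw [h3] at h4
      exact hne (h1.trans ((hface h4).trans h2.symm))

end ComponentCells

/-! ### Automorphisms -/

section Automorphisms

/-- A simplicial automorphism that preserves the erased vertices induces a cell automorphism. -/
theorem exists_cellAut {W : Type*} [Fintype W] {K : PreAbstractSimplicialComplex W} {D : Set W}
    (c : Equiv.Perm W) (hK : ∀ s : Finset W, s.image c ∈ K.faces ↔ s ∈ K.faces)
    (hD : ∀ w, c w ∈ D ↔ w ∈ D) :
    ∃ φ ∈ cellAut K D, (∀ u, (φ.1 u).1 = c u.1) ∧ ∀ f, (φ.2 f).1 = c f.1 := by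
  have h1 : ∀ w, {c w} ∈ K.faces ↔ {w} ∈ K.faces := fun w => by
    rw [← hK {w}, Finset.image_singleton]
  have hedge : ∀ u v, ({c u, c v} : Finset W) ∈ cellEdges K D ↔ ({u, v} : Finset W) ∈ cellEdges K D := by
    intro u v
    have : ({c u, c v} : Finset W) = ({u, v} : Finset W).image c := by
      rw [Finset.image_insert, Finset.image_singleton]
    unfold cellEdges
    rw [Set.mem_ofPred_eq, Set.mem_ofPred_eq, this, hK, Finset.card_image_of_injective _ c.injective]
    simp [hD]
  refine ⟨(c.subtypePerm fun w => and_congr (h1 w) (not_congr (hD w)),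
    c.subtypePerm fun w => and_congr (h1 w) (hD w)), ⟨fun u v => (hedge _ _).symm, ?_⟩,
    fun _ => rfl, fun _ => rfl⟩
  intro f u v
  refine (and_congr (hedge u v) ?_).symm
  rw [← hK (insert f.1 {u.1, v.1}), Finset.image_insert, Finset.image_insert,
    Finset.image_singleton]
  rfl

variable {G : Type*} [Group G] {x y : G}

/-- Conjugation on the vertices of `X(G)`. -/
def conjVertex (g : G) : G ⊕ G → G ⊕ G := Sum.map (MulAut.conj g) (MulAut.conj g)

theorem conjVertex_injective (g : G) : Function.Injective (conjVertex g) :=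
  Sum.map_injective.2 ⟨(MulAut.conj g).injective, (MulAut.conj g).injective⟩

/-- Conjugation on the links of `X(G)`. -/
def conjLink (g : G) (v : G ⊕ G) :
    linkGraph (complexX G) v →g linkGraph (complexX G) (conjVertex g v) where
  toFun := conjVertex g
  map_rel' := by
    rintro u w ⟨hu, hw, huw, hf⟩
    refine ⟨(conjVertex_injective g).ne hu, (conjVertex_injective g).ne hw,
      (conjVertex_injective g).ne huw, ?_⟩
    obtain ⟨⟨p, q⟩, hω, he⟩ := exists_dart_of_mem_complexX_faces hu.symm huw hw.symm hf
    refine mem_complexX_faces (hω.conjDart g) (by simp) ?_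
    have : ({conjVertex g v, conjVertex g u, conjVertex g w} : Finset (G ⊕ G)) =
        ({v, u, w} : Finset (G ⊕ G)).image (conjVertex g) := by
      rw [Finset.image_insert, Finset.image_insert, Finset.image_singleton]
    intro z hz
    have hz' : z ∈ ({v, u, w} : Finset (G ⊕ G)).image (conjVertex g) := by
      rw [← this]; exact hz
    rw [he, Finset.image_insert, Finset.image_insert, Finset.image_singleton] at hz'
    simpa [conjVertex, conjDart_apply, mul_assoc] using hz'

/-- Conjugation on the vertices of `Y(G)`. -/
def conjSheetFun (g : G) (w : Sheet (complexX G)) : Sheet (complexX G) :=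
  ⟨conjVertex g w.1, w.2.map (conjLink g w.1)⟩

theorem conjSheetFun_sheetAt (g : G) (v u : G ⊕ G) :
    conjSheetFun g (sheetAt (complexX G) v u) =
      sheetAt (complexX G) (conjVertex g v) (conjVertex g u) := rfl

theorem conjVertex_conjVertex_inv (g : G) (v : G ⊕ G) :
    conjVertex g⁻¹ (conjVertex g v) = v := by
  rcases v with v | v <;> simp [conjVertex, mul_assoc]

theorem conjSheetFun_inv_conjSheetFun (g : G) (w : Sheet (complexX G)) :
    conjSheetFun g⁻¹ (conjSheetFun g w) = w := by
  obtain ⟨v, c⟩ := w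
  induction c using SimpleGraph.ConnectedComponent.ind with
  | h u =>
    change conjSheetFun g⁻¹ (conjSheetFun g (sheetAt (complexX G) v u)) = sheetAt (complexX G) v u
    rw [conjSheetFun_sheetAt, conjSheetFun_sheetAt, conjVertex_conjVertex_inv,
      conjVertex_conjVertex_inv]

/-- Conjugation as a permutation of the vertices of `Y(G)`. -/
def conjSheet (g : G) : Equiv.Perm (Sheet (complexX G)) where
  toFun := conjSheetFun g
  invFun := conjSheetFun g⁻¹
  left_inv := conjSheetFun_inv_conjSheetFun g
  right_inv w := by
    have := conjSheetFun_inv_conjSheetFun g⁻¹ w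
    rwa [inv_inv] at this

theorem conjSheet_dartTail (g : G) (ω : G × G) :
    conjSheet g (dartTail ω) = dartTail (conjDart g ω) := rfl

theorem conjSheet_dartHead (g : G) (ω : G × G) :
    conjSheet g (dartHead ω) = dartHead (conjDart g ω) := rfl

theorem conjSheet_dartFace (g : G) (ω : G × G) :
    conjSheet g (dartFace ω) = dartFace (conjDart g ω) := by
  obtain ⟨p, q⟩ := ω
  change sheetAt (complexX G) (Sum.inr (g * (p * q) * g⁻¹)) (Sum.inl (g * p * g⁻¹)) =
    sheetAt (complexX G) (Sum.inr (g * p * g⁻¹ * (g * q * g⁻¹))) (Sum.inl (g * p * g⁻¹))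
  simp [mul_assoc]

theorem image_conjSheet_mem_faces (hxy : x * y ≠ y * x) {g : G}
    (hg : g ∈ Subgroup.closure {x, y}) {s : Finset (Sheet (complexX G))}
    (hs : s ∈ (componentT x y).faces) : s.image (conjSheet g) ∈ (componentT x y).faces := by
  obtain ⟨hne, ω, hω, hsub⟩ := (mem_componentT_faces_iff hxy).1 hs
  refine (mem_componentT_faces_iff hxy).2 ⟨hne.image _, conjDart g ω,
    conjDart_mem_dartOrbit hω hg, ?_⟩
  refine (Finset.image_subset_image hsub).trans ?_
  rw [dartTriangle, dartTriangle, Finset.image_insert, Finset.image_insert,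
    Finset.image_singleton, conjSheet_dartTail, conjSheet_dartHead, conjSheet_dartFace]

theorem conjSheet_mem_typeTwo_iff (g : G) (w : Sheet (complexX G)) :
    conjSheet g w ∈ typeTwo G ↔ w ∈ typeTwo G := by
  obtain ⟨v | v, c⟩ := w <;> simp [typeTwo, conjSheet, conjSheetFun, conjVertex]

variable [Finite G]

theorem exists_cellAut_conjSheet (hxy : x * y ≠ y * x) {g : G}
    (hg : g ∈ Subgroup.closure {x, y}) :
    ∃ φ ∈ cellAut (componentT x y) (typeTwo G), (∀ u, (φ.1 u).1 = conjSheet g u.1) ∧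
      ∀ f, (φ.2 f).1 = conjSheet g f.1 := by
  refine exists_cellAut (conjSheet g) (fun s => ⟨fun h => ?_, image_conjSheet_mem_faces hxy hg⟩)
    (conjSheet_mem_typeTwo_iff g)
  have := image_conjSheet_mem_faces hxy (inv_mem hg) h
  rw [Finset.image_image] at this
  convert this
  rw [show (conjSheet g⁻¹ ∘ conjSheet g : Sheet (complexX G) → Sheet (complexX G)) = id from
    funext (conjSheetFun_inv_conjSheetFun g), Finset.image_id]

/-- Stated for an arbitrary action so as to serve faces, vertices and unordered edges alike. -/
theorem exists_cellAut_apply_eq {W : Type*} [Fintype W] {K : PreAbstractSimplicialComplex W} {D : Set W}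
    {X : Type*} (a : Equiv.Perm (cellVertices K D) × Equiv.Perm (cellFaces K D) → X → X)
    (ha : ∀ φ ψ z, a (φ * ψ) z = a φ (a ψ z)) {S : Set X} {z₀ : X}
    (h : ∀ z ∈ S, ∃ φ ∈ cellAut K D, a φ z₀ = z) {z z' : X} (hz : z ∈ S) (hz' : z' ∈ S) :
    ∃ φ ∈ cellAut K D, a φ z = z' := by
  obtain ⟨φ, hφ, rfl⟩ := h z hz
  obtain ⟨ψ, hψ, rfl⟩ := h z' hz'
  exact ⟨ψ * φ⁻¹, mul_mem hψ (inv_mem hφ), by rw [← ha, inv_mul_cancel_right]⟩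

theorem faceTransitive_componentT (hxy : x * y ≠ y * x) :
    FaceTransitive (componentT x y) (typeTwo G) := by
  have h0 : dartFace (x, y) ∈ cellFaces (componentT x y) (typeTwo G) :=
    (mem_cellFaces_iff hxy).2 ⟨_, self_mem_dartOrbit, rfl⟩
  intro f f'
  refine exists_cellAut_apply_eq (a := fun φ f => φ.2 f) (S := Set.univ) (z₀ := ⟨_, h0⟩)
    (fun _ _ _ => rfl) ?_ trivial trivial
  rintro ⟨f, hf⟩ -
  obtain ⟨ω, ⟨g, hg, h⟩, rfl⟩ := (mem_cellFaces_iff hxy).1 hf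
  have key : ∃ g ∈ Subgroup.closure {x, y}, dartFace ω = dartFace (conjDart g (x, y)) := by
    rcases h with rfl | rfl
    · exact ⟨g, hg, rfl⟩
    · have hyx : IsNoncomm (y, x) := hxy.symm
      -- One rotation of `(y, x)` around its face is the conjugate of `(x, y)` by `x⁻¹`.
      refine ⟨g * x⁻¹, mul_mem hg (inv_mem (Subgroup.subset_closure (by simp))), ?_⟩
      rw [← dartFace_rotate (hyx.conjDart g), ← conjDart_rotate, rotate_eq, ← conjDart_swap,
        conjDart_mul]
      rfl
  obtain ⟨g, hg, h⟩ := key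
  obtain ⟨φ, hφ, -, h2⟩ := exists_cellAut_conjSheet hxy hg
  exact ⟨φ, hφ, Subtype.ext (((h2 _).trans (conjSheet_dartFace g (x, y))).trans h.symm)⟩

theorem edgeTransitive_componentT (hxy : x * y ≠ y * x) :
    EdgeTransitive (componentT x y) (typeTwo G) := by
  have h0 : dartTail (x, y) ∈ cellVertices (componentT x y) (typeTwo G) :=
    (mem_cellVertices_iff hxy).2 ⟨_, self_mem_dartOrbit, rfl⟩
  have h1 : dartHead (x, y) ∈ cellVertices (componentT x y) (typeTwo G) :=
    (mem_cellVertices_iff hxy).2 ⟨_, swap_mem_dartOrbit self_mem_dartOrbit, rfl⟩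
  intro u v u' v' huv hu'v'
  have := exists_cellAut_apply_eq (K := componentT x y) (D := typeTwo G) (a := fun φ e => e.map φ.1)
    (S := {e | ∃ u v : cellVertices (componentT x y) (typeTwo G), e = s(u, v) ∧
      ({u.1, v.1} : Finset _) ∈ cellEdges (componentT x y) (typeTwo G)})
    (z₀ := s(⟨_, h0⟩, ⟨_, h1⟩))
    (fun φ ψ z => (Sym2.map_map (f := ψ.1) (g := φ.1) z).symm) ?_
    (z := s(u, v)) (z' := s(u', v')) ⟨u, v, rfl, huv⟩ ⟨u', v', rfl, hu'v'⟩
  · simpa using this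
  · rintro _ ⟨⟨u, hu⟩, ⟨v, hv⟩, rfl, he⟩
    obtain ⟨ω, ⟨g, hg, hω⟩, he⟩ := (mem_cellEdges_iff hxy).1 he
    obtain ⟨φ, hφ, h2, -⟩ := exists_cellAut_conjSheet hxy hg
    refine ⟨φ, hφ, ?_⟩
    have key : s(u, v) = s(conjSheet g (dartTail (x, y)), conjSheet g (dartHead (x, y))) := by
      have h3 : s(u, v) = s(dartTail ω, dartHead ω) := by
        have h4 : ({u, v} : Set (Sheet (complexX G))) = {dartTail ω, dartHead ω} := by
          have := congrArg (fun s : Finset (Sheet (complexX G)) => (s : Set (Sheet (complexX G)))) he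
          simpa using this
        rw [Sym2.eq_iff]
        exact Set.pair_eq_pair_iff.1 h4
      rw [h3, conjSheet_dartTail, conjSheet_dartHead]
      rcases hω with rfl | rfl
      · rfl
      · exact Sym2.eq_swap
    rw [Sym2.map_mk]
    apply Sym2.map.injective Subtype.val_injective
    simp only [Sym2.map_mk, h2]
    exact key.symm

theorem vertex_orbit (hxy : x * y ≠ y * x)
    (w : cellVertices (componentT x y) (typeTwo G)) :
    ∃ φ ∈ cellAut (componentT x y) (typeTwo G),
      (φ.1 w).1 = dartTail (x, y) ∨ (φ.1 w).1 = dartHead (x, y) := by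
  obtain ⟨ω, ⟨g, hg, h⟩, hw⟩ := (mem_cellVertices_iff hxy).1 w.2
  obtain ⟨φ, hφ, h2, -⟩ := exists_cellAut_conjSheet hxy (inv_mem hg)
  refine ⟨φ, hφ, ?_⟩
  rw [h2, hw, conjSheet_dartTail]
  rcases h with rfl | rfl <;> rw [← conjDart_mul, inv_mul_cancel, conjDart_one]
  · exact Or.inl rfl
  · exact Or.inr rfl

theorem vertexTransitive_componentT (hxy : x * y ≠ y * x) {g : G}
    (hg : g ∈ Subgroup.closure {x, y}) (h : dartHead (x, y) = conjSheet g (dartTail (x, y))) :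
    VertexTransitive (componentT x y) (typeTwo G) := by
  have h0 : dartTail (x, y) ∈ cellVertices (componentT x y) (typeTwo G) :=
    (mem_cellVertices_iff hxy).2 ⟨_, self_mem_dartOrbit, rfl⟩
  intro u v
  refine exists_cellAut_apply_eq (a := fun φ f => φ.1 f) (S := Set.univ) (z₀ := ⟨_, h0⟩)
    (fun _ _ _ => rfl) ?_ trivial trivial
  rintro w -
  obtain ⟨φ, hφ, hw⟩ := vertex_orbit hxy w
  rcases hw with hw | hw
  · refine ⟨φ⁻¹, inv_mem hφ, ?_⟩
    change φ.1⁻¹ _ = _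
    rw [Equiv.Perm.inv_eq_iff_eq]
    exact Subtype.ext hw.symm
  · obtain ⟨ψ, hψ, h2, -⟩ := exists_cellAut_conjSheet hxy hg
    refine ⟨φ⁻¹ * ψ, mul_mem (inv_mem hφ) hψ, ?_⟩
    change φ.1⁻¹ (ψ.1 _) = _
    rw [Equiv.Perm.inv_eq_iff_eq]
    exact Subtype.ext (by rw [h2, hw, h])

end Automorphisms

/-! ### Counting -/

section Counting

theorem ncard_eq_mul_ncard_image {α β : Type*} [Finite α] {s : Set α} {f : α → β} {m : ℕ}
    (h : ∀ a ∈ s, {b | b ∈ s ∧ f b = f a}.ncard = m) : s.ncard = m * (f '' s).ncard := by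
  have := Fintype.ofFinite α
  have h1 := Finset.card_eq_sum_card_image f s.toFinset
  rw [Finset.sum_congr rfl (g := fun _ => m), Finset.sum_const, smul_eq_mul] at h1
  · rw [Set.ncard_eq_toFinset_card', h1, mul_comm, Set.ncard_eq_toFinset_card',
      Set.toFinset_image]
  · intro b hb
    obtain ⟨a, ha, rfl⟩ := Finset.mem_image.1 hb
    rw [← h a (Set.mem_toFinset.1 ha), Set.ncard_eq_toFinset_card']
    congr 1
    ext; simp

theorem ncard_sameCycle {α : Type*} [Finite α] (f : Equiv.Perm α) (a : α) :
    {b | f.SameCycle a b}.ncard = Function.minimalPeriod f a := by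
  have h : {b | f.SameCycle a b} =
      (fun k : ℕ => (f ^ k) a) '' (Finset.range (Function.minimalPeriod f a) : Set ℕ) := by
    ext b
    constructor
    · intro hb
      obtain ⟨k, -, -, rfl⟩ := Equiv.Perm.SameCycle.exists_pow_eq'' hb
      refine ⟨k % Function.minimalPeriod f a, by simpa using Nat.mod_lt _ minimalPeriod_pos', ?_⟩
      simp only [← Equiv.Perm.iterate_eq_pow, Function.iterate_mod_minimalPeriod_eq]
    · rintro ⟨k, -, rfl⟩
      exact sameCycle_pow f k a
  rw [h, Set.InjOn.ncard_image, Set.ncard_coe_finset, Finset.card_range]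
  simpa using pow_injOn_Iio_minimalPeriod

/-- The sign of a fixed point free permutation is determined by the number of its cycles. -/
theorem sign_eq_of_sameCycle_iff {α β : Type*} [Fintype α] [DecidableEq α] (σ : Equiv.Perm α)
    (hσ : ∀ a, σ a ≠ a) (f : α → β) (hf : ∀ a b, f a = f b ↔ σ.SameCycle a b) :
    Equiv.Perm.sign σ = (-1) ^ (Fintype.card α + (Set.range f).ncard) := by
  have hsupp : σ.support = Finset.univ := by
    ext a; simp [hσ]
  have hcard : σ.cycleType.card = (Set.range f).ncard := by
    have hle : ∀ c ∈ σ.cycleFactorsFinset, ∃ a, c = σ.cycleOf a := by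
      intro c hc
      obtain ⟨a, ha⟩ := (Equiv.Perm.mem_cycleFactorsFinset_iff.1 hc).1.nonempty_support
      exact ⟨a, Equiv.Perm.cycle_is_cycleOf ha hc⟩
    have hcyc : ∀ a b, σ.cycleOf a = σ.cycleOf b ↔ f a = f b := by
      intro a b
      rw [hf]
      constructor
      · intro h
        have h1 : a ∈ (σ.cycleOf b).support := by
          rw [← h, Equiv.Perm.mem_support_cycleOf_iff]
          exact ⟨Equiv.Perm.SameCycle.refl _ _, by simp [hσ]⟩
        exact ((Equiv.Perm.mem_support_cycleOf_iff.1 h1).1).symm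
      · exact fun h => h.cycleOf_eq
    have himg : (σ.cycleFactorsFinset : Set (Equiv.Perm α)) = Set.range σ.cycleOf := by
      ext c
      constructor
      · intro hc
        obtain ⟨a, rfl⟩ := hle c hc
        exact ⟨a, rfl⟩
      · rintro ⟨a, rfl⟩
        rw [Finset.mem_coe, Equiv.Perm.cycleOf_mem_cycleFactorsFinset_iff]
        simp [hσ]
    rw [Equiv.Perm.cycleType_def, Multiset.card_map, Finset.card_val, ← Set.ncard_coe_finset, himg]
    refine Set.ncard_congr (fun c hc => f hc.choose) (fun c hc => ⟨_, rfl⟩) ?_ ?_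
    · intro c d hc hd h
      rw [← hc.choose_spec, ← hd.choose_spec]
      exact (hcyc _ _).2 h
    · rintro _ ⟨a, rfl⟩
      refine ⟨σ.cycleOf a, ⟨a, rfl⟩, ?_⟩
      exact (hcyc _ _).1 (Exists.choose_spec (⟨a, rfl⟩ : σ.cycleOf a ∈ Set.range σ.cycleOf))
  rw [Equiv.Perm.sign_of_cycleType, Equiv.Perm.sum_cycleType, hsupp, hcard, Finset.card_univ]

end Counting

/-! ### Counting cells by darts and the Euler characteristic -/

section ComponentCounting

variable {G : Type*} [Group G] {x y : G}

/-- The edge of the dart. -/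
def dartEdge (ω : G × G) : Finset (Sheet (complexX G)) := {dartTail ω, dartHead ω}

theorem dartEdge_eq_iff {ω ω' : G × G} :
    dartEdge ω = dartEdge ω' ↔ ω = ω' ∨ ω = ω'.swap := by
  constructor
  · intro h
    have h4 : ({dartTail ω, dartHead ω} : Set (Sheet (complexX G))) =
        {dartTail ω', dartHead ω'} := by
      have := congrArg (fun s : Finset (Sheet (complexX G)) => (s : Set (Sheet (complexX G)))) h
      simpa [dartEdge] using this
    rcases Set.pair_eq_pair_iff.1 h4 with ⟨h1, h2⟩ | ⟨h1, h2⟩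
    · exact Or.inl (dart_eq_of_tail_head h1 h2)
    · exact Or.inr (dart_eq_of_tail_head h1 h2)
  · rintro (rfl | rfl)
    · rfl
    · exact Finset.pair_comm _ _

theorem card_dartTriangle {ω : G × G} (h : IsNoncomm ω) : (dartTriangle ω).card = 3 :=
  Finset.card_eq_three.2 ⟨_, _, _, dartTail_ne_dartHead h, dartTail_ne_dartFace _ _,
    dartHead_ne_dartFace _ _, rfl⟩

theorem ncard_triangles (hxy : x * y ≠ y * x) :
    {e | e ∈ (componentT x y).faces ∧ e.card = 3}.ncard = (dartOrbit x y).ncard := by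
  have himg : {e | e ∈ (componentT x y).faces ∧ e.card = 3} = dartTriangle '' dartOrbit x y := by
    ext e
    constructor
    · rintro ⟨he, hcard⟩
      obtain ⟨-, ω, hω, hsub⟩ := (mem_componentT_faces_iff hxy).1 he
      refine ⟨ω, hω, (Finset.eq_of_subset_of_card_le hsub ?_).symm⟩
      rw [hcard, card_dartTriangle (isNoncomm_of_mem_dartOrbit hxy hω)]
    · rintro ⟨ω, hω, rfl⟩
      exact ⟨(mem_componentT_faces_iff hxy).2 ⟨by simp [dartTriangle], ω, hω, subset_rfl⟩,
        card_dartTriangle (isNoncomm_of_mem_dartOrbit hxy hω)⟩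
  rw [himg, Set.InjOn.ncard_image]
  intro ω hω ω' _ h
  exact dartTriangle_injective (isNoncomm_of_mem_dartOrbit hxy hω) (Eq.subset h)

variable [Finite G]

instance fintypeDartOrbit : Fintype (dartOrbit x y) := Fintype.ofFinite _

theorem cellVertices_eq_image (hxy : x * y ≠ y * x) :
    cellVertices (componentT x y) (typeTwo G) = dartTail '' dartOrbit x y := by
  ext w
  rw [mem_cellVertices_iff hxy]
  simp only [Set.mem_image, eq_comm]

theorem cellFaces_eq_image (hxy : x * y ≠ y * x) :
    cellFaces (componentT x y) (typeTwo G) = dartFace '' dartOrbit x y := by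
  ext w
  rw [mem_cellFaces_iff hxy]
  simp only [Set.mem_image, eq_comm]

theorem cellEdges_eq_image (hxy : x * y ≠ y * x) :
    cellEdges (componentT x y) (typeTwo G) = dartEdge '' dartOrbit x y := by
  ext w
  rw [mem_cellEdges_iff hxy]
  simp only [Set.mem_image, eq_comm, dartEdge]

theorem two_mul_ncard_cellEdges (hxy : x * y ≠ y * x) :
    (dartOrbit x y).ncard = 2 * (cellEdges (componentT x y) (typeTwo G)).ncard := by
  rw [cellEdges_eq_image hxy]
  refine ncard_eq_mul_ncard_image fun ω hω => ?_
  have : {b | b ∈ dartOrbit x y ∧ dartEdge b = dartEdge ω} = {ω, ω.swap} := by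
    ext b
    simp only [Set.mem_ofPred_eq, dartEdge_eq_iff, Set.mem_insert_iff, Set.mem_singleton_iff]
    constructor
    · exact fun h => h.2
    · rintro (rfl | rfl)
      · exact ⟨hω, Or.inl rfl⟩
      · exact ⟨swap_mem_dartOrbit hω, Or.inr rfl⟩
  rw [this, Set.ncard_pair]
  intro h
  exact (isNoncomm_of_mem_dartOrbit hxy hω).ne (congrArg Prod.fst h)

theorem mul_ncard_cellFaces (hxy : x * y ≠ y * x) :
    (dartOrbit x y).ncard = Function.minimalPeriod rotate (x, y) *
      (cellFaces (componentT x y) (typeTwo G)).ncard := by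
  rw [cellFaces_eq_image hxy]
  refine ncard_eq_mul_ncard_image fun ω hω => ?_
  rw [← minimalPeriod_rotate_of_mem_dartOrbit hω, ← ncard_sameCycle]
  congr 1
  ext b
  constructor
  · rintro ⟨-, h⟩
    exact (dartFace_eq_iff (isNoncomm_of_mem_dartOrbit hxy hω)).1 h.symm
  · intro h
    exact ⟨mem_dartOrbit_of_sameCycle_rotate hω h,
      ((dartFace_eq_iff (isNoncomm_of_mem_dartOrbit hxy hω)).2 h).symm⟩

theorem ncard_dartTail_fiber {ω : G × G} (hω : ω ∈ dartOrbit x y) :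
    {b | b ∈ dartOrbit x y ∧ dartTail b = dartTail ω}.ncard = Function.minimalPeriod turn ω := by
  rw [← ncard_sameCycle]
  congr 1
  ext b
  constructor
  · rintro ⟨-, h⟩
    exact dartTail_eq_iff.1 h.symm
  · intro h
    exact ⟨mem_dartOrbit_of_sameCycle_turn hω h, (dartTail_eq_iff.2 h).symm⟩

/-- Edges at a vertex correspond to darts leaving it, since a dart and its swap never leave the same
vertex; these darts form one cycle of `turn`. -/
theorem valency_dartTail (hxy : x * y ≠ y * x) {ω : G × G} (hω : ω ∈ dartOrbit x y) :
    valency (componentT x y) (typeTwo G) (dartTail ω) = Function.minimalPeriod turn ω := by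
  rw [← ncard_dartTail_fiber hω, valency]
  symm
  have himg : {e | e ∈ cellEdges (componentT x y) (typeTwo G) ∧ dartTail ω ∈ e} =
      dartEdge '' {b | b ∈ dartOrbit x y ∧ dartTail b = dartTail ω} := by
    ext e
    constructor
    · rintro ⟨he, hmem⟩
      obtain ⟨ω', hω', rfl⟩ := (mem_cellEdges_iff hxy).1 he
      simp only [Finset.mem_insert, Finset.mem_singleton] at hmem
      rcases hmem with h | h
      · exact ⟨ω', ⟨hω', h.symm⟩, rfl⟩
      · exact ⟨ω'.swap, ⟨swap_mem_dartOrbit hω', h.symm⟩, Finset.pair_comm _ _⟩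
    · rintro ⟨b, ⟨hb, h⟩, rfl⟩
      exact ⟨(mem_cellEdges_iff hxy).2 ⟨b, hb, rfl⟩, by simp [dartEdge, h]⟩
  rw [himg, Set.InjOn.ncard_image]
  rintro b ⟨hb, h⟩ b' ⟨hb', h'⟩ he
  rcases dartEdge_eq_iff.1 he with h1 | h1
  · exact h1
  · exfalso
    rw [h1] at h
    exact dartTail_ne_dartHead (isNoncomm_of_mem_dartOrbit hxy hb') (h'.trans h.symm)

theorem sum_valency (hxy : x * y ≠ y * x) :
    ∑ v ∈ (dartOrbit x y).toFinset.image dartTail,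
      valency (componentT x y) (typeTwo G) v = (dartOrbit x y).ncard := by
  rw [Set.ncard_eq_toFinset_card', Finset.card_eq_sum_card_image dartTail]
  refine Finset.sum_congr rfl fun v hv => ?_
  obtain ⟨ω, hω, rfl⟩ := Finset.mem_image.1 hv
  rw [Set.mem_toFinset] at hω
  rw [valency_dartTail hxy hω, ← ncard_dartTail_fiber hω, Set.ncard_eq_toFinset_card']
  congr 1
  ext; simp

theorem coe_image_dartTail (hxy : x * y ≠ y * x) :
    (((dartOrbit x y).toFinset.image dartTail : Finset (Sheet (complexX G))) :
      Set (Sheet (complexX G))) = cellVertices (componentT x y) (typeTwo G) := by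
  rw [cellVertices_eq_image hxy]; simp

theorem averageValency_componentT (hxy : x * y ≠ y * x) :
    averageValency (componentT x y) (typeTwo G) =
      ((dartOrbit x y).ncard : ℚ) / (cellVertices (componentT x y) (typeTwo G)).ncard := by
  rw [averageValency, ← sum_valency hxy, ← coe_image_dartTail hxy, finsum_mem_coe_finset]
  push_cast
  rfl

theorem two_mul_ncard_cellVertices_le (hxy : x * y ≠ y * x) :
    2 * (cellVertices (componentT x y) (typeTwo G)).ncard ≤ (dartOrbit x y).ncard := by
  rw [← sum_valency hxy, ← coe_image_dartTail hxy, Set.ncard_coe_finset, mul_comm,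
    ← smul_eq_mul, ← Finset.sum_const]
  refine Finset.sum_le_sum fun v hv => ?_
  obtain ⟨ω, hω, rfl⟩ := Finset.mem_image.1 hv
  rw [Set.mem_toFinset] at hω
  rw [valency_dartTail hxy hω]
  exact two_le_minimalPeriod_turn (isNoncomm_of_mem_dartOrbit hxy hω)

/-- Counting the darts that start at the vertices of a given valency. -/
theorem ncard_valency_eq (hxy : x * y ≠ y * x) (l : ℕ) :
    {ω | ω ∈ dartOrbit x y ∧ Function.minimalPeriod turn ω = l}.ncard =
      l * {v | v ∈ cellVertices (componentT x y) (typeTwo G) ∧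
        valency (componentT x y) (typeTwo G) v = l}.ncard := by
  have himg : {v | v ∈ cellVertices (componentT x y) (typeTwo G) ∧
      valency (componentT x y) (typeTwo G) v = l} =
      dartTail '' {ω | ω ∈ dartOrbit x y ∧ Function.minimalPeriod turn ω = l} := by
    ext v
    constructor
    · rintro ⟨hv, hl⟩
      obtain ⟨ω, hω, rfl⟩ := (mem_cellVertices_iff hxy).1 hv
      exact ⟨ω, ⟨hω, by rwa [← valency_dartTail hxy hω]⟩, rfl⟩
    · rintro ⟨ω, ⟨hω, hl⟩, rfl⟩
      exact ⟨(mem_cellVertices_iff hxy).2 ⟨ω, hω, rfl⟩, by rwa [valency_dartTail hxy hω]⟩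
  rw [himg]
  refine ncard_eq_mul_ncard_image fun ω hω => ?_
  refine Eq.trans ?_ ((ncard_dartTail_fiber hω.1).trans hω.2)
  congr 1
  ext b
  constructor
  · rintro ⟨⟨hb, -⟩, h⟩
    exact ⟨hb, h⟩
  · rintro ⟨hb, h⟩
    refine ⟨⟨hb, ?_⟩, h⟩
    rw [← hω.2, ← valency_dartTail hxy hb, ← valency_dartTail hxy hω.1, h]

/-! ### The Euler characteristic -/

theorem ncard_vertices :
    {w | {w} ∈ (componentT x y).faces}.ncard =
      (cellVertices (componentT x y) (typeTwo G)).ncard +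
        (cellFaces (componentT x y) (typeTwo G)).ncard := by
  rw [← Set.ncard_union_eq]
  · congr 1
    ext w
    simp only [cellVertices, cellFaces, Set.mem_ofPred_eq, Set.mem_union]
    tauto
  · rw [Set.disjoint_left]
    exact fun w h h' => h.2 h'.2

/-- The edges at type 2 vertices are as many as the darts: each is the tail-face edge of exactly one
dart, the head-face edge being the tail-face edge of the rotated dart. -/
theorem ncard_edges (hxy : x * y ≠ y * x) :
    {e | e ∈ (componentT x y).faces ∧ e.card = 2}.ncard =
      (cellEdges (componentT x y) (typeTwo G)).ncard + (dartOrbit x y).ncard := by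
  have himg : {e | e ∈ (componentT x y).faces ∧ e.card = 2} =
      cellEdges (componentT x y) (typeTwo G) ∪
        (fun ω => ({dartTail ω, dartFace ω} : Finset (Sheet (complexX G)))) '' dartOrbit x y := by
    ext e
    constructor
    · rintro ⟨he, hcard⟩
      by_cases hD : ∀ w ∈ e, w ∉ typeTwo G
      · exact Or.inl ⟨he, hcard, hD⟩
      · right
        obtain ⟨-, ω, hω, hsub⟩ := (mem_componentT_faces_iff hxy).1 he
        push Not at hD
        obtain ⟨w, hw, hwD⟩ := hD
        have hw' : w = dartFace ω := by
          rcases mem_dartTriangle.1 (hsub hw) with h | h | h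
          · exact absurd (h ▸ hwD) (dartTail_notMem_typeTwo ω)
          · exact absurd (h ▸ hwD) (dartHead_notMem_typeTwo ω)
          · exact h
        obtain ⟨z, hz, hzw⟩ := Finset.exists_mem_ne (by omega : 1 < e.card) w
        have heq : e = {z, w} := by
          symm
          refine Finset.eq_of_subset_of_card_le ?_ (by rw [hcard, Finset.card_pair hzw])
          intro v hv
          simp only [Finset.mem_insert, Finset.mem_singleton] at hv
          rcases hv with rfl | rfl
          · exact hz
          · exact hw
        rcases mem_dartTriangle.1 (hsub hz) with h | h | h
        · exact ⟨ω, hω, by rw [heq, h, hw']⟩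
        · refine ⟨rotate ω, rotate_mem_dartOrbit_iff.1 hω, ?_⟩
          simp only [dartTail_rotate, dartFace_rotate (isNoncomm_of_mem_dartOrbit hxy hω)]
          rw [heq, h, hw']
        · exact absurd (h.trans hw'.symm) hzw
    · rintro (h | ⟨ω, hω, rfl⟩)
      · exact ⟨h.1, h.2.1⟩
      · refine ⟨(mem_componentT_faces_iff hxy).2 ⟨by simp, ω, hω, fun w hw => ?_⟩,
          Finset.card_pair (dartTail_ne_dartFace _ _)⟩
        rw [mem_dartTriangle]
        simp only [Finset.mem_insert, Finset.mem_singleton] at hw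
        tauto
  rw [himg, Set.ncard_union_eq, Set.InjOn.ncard_image]
  · intro ω hω ω' hω' h
    have h4 : ({dartTail ω, dartFace ω} : Set (Sheet (complexX G))) =
        {dartTail ω', dartFace ω'} := by
      have := congrArg (fun s : Finset (Sheet (complexX G)) => (s : Set (Sheet (complexX G)))) h
      simpa using this
    rcases Set.pair_eq_pair_iff.1 h4 with ⟨h1, h2⟩ | ⟨h1, h2⟩
    · exact dart_eq_of_tail_face h1 h2
    · exact absurd h1 (dartTail_ne_dartFace _ _)
  · rw [Set.disjoint_left]
    rintro e h ⟨ω, -, rfl⟩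
    exact h.2.2 (dartFace ω) (by simp) (dartFace_mem_typeTwo ω)

/-- With `N` darts the triangulation has `V + F` vertices, `E + N` edges and `N` triangles, and `N`
cancels. -/
theorem finrank_homology₁_componentT (hxy : x * y ≠ y * x) :
    Module.finrank ℚ (homology₁ (componentT x y)) +
      (cellVertices (componentT x y) (typeTwo G)).ncard +
      (cellFaces (componentT x y) (typeTwo G)).ncard =
      (cellEdges (componentT x y) (typeTwo G)).ncard + 2 := by
  have h := finrank_homology₁ (K := componentT x y) (v := cornerFst x y)
    ((singleton_mem_componentT_iff hxy).2 ⟨_, self_mem_dartOrbit, Or.inl rfl⟩)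
    (fun w hw => componentT_reachable hw) (finrank_cycles₂ hxy)
  rw [ncard_vertices, ncard_triangles hxy, ncard_edges hxy] at h
  omega

/-- On the `N` darts the fixed point free permutations `rotate`, swap and `turn` have `F`, `E` and
`V` cycles, and their product is the identity. Comparing signs makes `3 N + V + E + F` even, and `N
= 2 E`. This replaces Poincaré duality. -/
theorem even_ncard_add (hxy : x * y ≠ y * x) :
    Even ((cellVertices (componentT x y) (typeTwo G)).ncard +
      (cellEdges (componentT x y) (typeTwo G)).ncard +
      (cellFaces (componentT x y) (typeTwo G)).ncard) := by
  have hswap : ∀ ω : G × G, Equiv.prodComm G G ω ∈ dartOrbit x y ↔ ω ∈ dartOrbit x y :=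
    fun ω => ⟨fun h => swap_mem_dartOrbit h, fun h => swap_mem_dartOrbit h⟩
  let r : Equiv.Perm (dartOrbit x y) :=
    rotate.subtypePerm fun ω => (rotate_mem_dartOrbit_iff (ω := ω)).symm
  let t : Equiv.Perm (dartOrbit x y) :=
    turn.subtypePerm fun ω => (turn_mem_dartOrbit_iff (ω := ω)).symm
  let s : Equiv.Perm (dartOrbit x y) := Equiv.Perm.subtypePerm (Equiv.prodComm G G) hswap
  have hn : ∀ ω : dartOrbit x y, IsNoncomm ω.1 := fun ω => isNoncomm_of_mem_dartOrbit hxy ω.2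
  have hrange : ∀ {β : Type _} (f : G × G → β),
      Set.range (fun ω : dartOrbit x y => f ω.1) = f '' dartOrbit x y := by
    intro β f
    ext b
    simp
  have hr : Equiv.Perm.sign r = (-1) ^ (Fintype.card (dartOrbit x y) +
      (cellFaces (componentT x y) (typeTwo G)).ncard) := by
    rw [cellFaces_eq_image hxy, ← hrange dartFace]
    refine sign_eq_of_sameCycle_iff r (fun ω h => ?_) _ fun a b => ?_
    · exact (hn ω).ne (congrArg (fun z : dartOrbit x y => z.1.1) h).symm
    · rw [dartFace_eq_iff (hn a), Equiv.Perm.sameCycle_subtypePerm]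
  have ht : Equiv.Perm.sign t = (-1) ^ (Fintype.card (dartOrbit x y) +
      (cellVertices (componentT x y) (typeTwo G)).ncard) := by
    rw [cellVertices_eq_image hxy, ← hrange dartTail]
    refine sign_eq_of_sameCycle_iff t (fun ω h => ?_) _ fun a b => ?_
    · have h1 : ω.1.1 * ω.1.2 * ω.1.1⁻¹ = ω.1.2 :=
        congrArg (fun z : dartOrbit x y => z.1.2) h
      exact hn ω (mul_inv_eq_iff_eq_mul.1 h1)
    · rw [dartTail_eq_iff, Equiv.Perm.sameCycle_subtypePerm]
  have hs : Equiv.Perm.sign s = (-1) ^ (Fintype.card (dartOrbit x y) +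
      (cellEdges (componentT x y) (typeTwo G)).ncard) := by
    rw [cellEdges_eq_image hxy, ← hrange dartEdge]
    refine sign_eq_of_sameCycle_iff s (fun ω h => ?_) _ fun a b => ?_
    · exact (hn ω).ne (congrArg (fun z : dartOrbit x y => z.1.2) h)
    · rw [dartEdge_eq_iff]
      have hss : ∀ c, s (s c) = c := fun c => Subtype.ext (Prod.swap_swap c.1)
      constructor
      · rintro (h | h)
        · rw [Subtype.ext h]
        · have h' : a = s b := Subtype.ext h
          rw [h']
          exact (Equiv.Perm.sameCycle_apply_left).2 (Equiv.Perm.SameCycle.refl _ _)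
      · rintro h
        obtain ⟨k, -, -, rfl⟩ := h.exists_pow_eq''
        clear h
        have hk : (s ^ k) a = a ∨ (s ^ k) a = s a := by
          induction k with
          | zero => exact Or.inl rfl
          | succ k ih =>
            rw [pow_succ', Equiv.Perm.mul_apply]
            rcases ih with ih | ih <;> rw [ih]
            · exact Or.inr rfl
            · exact Or.inl (hss a)
        rcases hk with hk | hk <;> rw [hk]
        · exact Or.inl rfl
        · exact Or.inr rfl
  have hone : r * s * t = 1 := by
    ext ω : 1
    apply Subtype.ext
    change rotate (turn ω.1).swap = ω.1
    obtain ⟨⟨p, q⟩, h⟩ := ω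
    simp [turn_apply, rotate_apply, mul_assoc]
  have hsign := congrArg Equiv.Perm.sign hone
  rw [map_mul, map_mul, map_one, hr, hs, ht, ← pow_add, ← pow_add] at hsign
  have heven := (neg_one_pow_eq_one_iff_even (R := ℤˣ) (by decide)).1 hsign
  have hN : Fintype.card (dartOrbit x y) = 2 * (cellEdges (componentT x y) (typeTwo G)).ncard := by
    rw [← two_mul_ncard_cellEdges hxy, ← Nat.card_eq_fintype_card]
    rfl
  rw [hN] at heven
  rw [Nat.even_iff] at heven ⊢
  omega

end ComponentCounting

/-! ### Conjugacy classes under a cyclic group -/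

section ConjClass

variable {G : Type*} [Group G] {x y : G}

theorem mem_conjClass_iff {c g h : G} : h ∈ conjClass c g ↔ turn.SameCycle (c, g) (c, h) := by
  constructor
  · rintro ⟨k, rfl⟩
    exact ⟨k, turn_zpow k c g⟩
  · rintro ⟨k, hk⟩
    rw [turn_zpow] at hk
    exact ⟨k, (congrArg Prod.snd hk).symm⟩

theorem ncard_conjClass [Finite G] (c g : G) :
    (conjClass c g).ncard = Function.minimalPeriod turn (c, g) := by
  rw [← ncard_sameCycle]
  symm
  have : conjClass c g = Prod.snd '' {b | turn.SameCycle (c, g) b} := by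
    ext h
    rw [mem_conjClass_iff]
    constructor
    · exact fun hh => ⟨_, hh, rfl⟩
    · rintro ⟨⟨p, q⟩, ⟨k, hk⟩, rfl⟩
      rw [turn_zpow] at hk
      obtain ⟨rfl, rfl⟩ := Prod.ext_iff.1 hk
      exact ⟨k, turn_zpow k _ _⟩
  rw [this, Set.InjOn.ncard_image]
  rintro ⟨p, q⟩ ⟨k, hk⟩ ⟨p', q'⟩ ⟨k', hk'⟩ h
  rw [turn_zpow] at hk hk'
  exact Prod.ext ((Prod.ext_iff.1 hk).1.symm.trans (Prod.ext_iff.1 hk').1) h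

/-- Multiplying the second entry by `p` commutes with conjugation by `p`. This allows `λ₁` to be
computed from `α` instead of `y`. -/
theorem minimalPeriod_turn_mul_left (p q : G) :
    Function.minimalPeriod turn (p, p * q) = Function.minimalPeriod turn (p, q) :=
  minimalPeriod_apply_of_commute (f := turn)
    (e := ⟨fun ω => (ω.1, ω.1 * ω.2), fun ω => (ω.1, ω.1⁻¹ * ω.2), fun ω => by simp,
      fun ω => by simp⟩) (fun ω => by obtain ⟨p, q⟩ := ω; simp [turn_apply, mul_assoc]) (p, q)

theorem minimalPeriod_turn_mul_right (p q : G) :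
    Function.minimalPeriod turn (p, q * p) = Function.minimalPeriod turn (p, q) :=
  minimalPeriod_apply_of_commute (f := turn)
    (e := ⟨fun ω => (ω.1, ω.2 * ω.1), fun ω => (ω.1, ω.2 * ω.1⁻¹), fun ω => by simp,
      fun ω => by simp⟩) (fun ω => by obtain ⟨p, q⟩ := ω; simp [turn_apply, mul_assoc]) (p, q)

theorem minimalPeriod_turn_conjDart (g : G) (ω : G × G) :
    Function.minimalPeriod turn (conjDart g ω) = Function.minimalPeriod turn ω :=
  minimalPeriod_apply_of_commute (conjDart_turn g) ω

theorem rotate_iterate_two_iterate (k : ℕ) (x y : G) :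
    (rotate^[2])^[k] (x, y) = conjDart ((x * y)⁻¹ ^ k) (x, y) := by
  induction k with
  | zero => rw [pow_zero, conjDart_one]; rfl
  | succ k ih =>
    rw [Function.iterate_succ_apply', ih]
    change rotate (rotate _) = _
    rw [← conjDart_rotate, ← conjDart_rotate, rotate_rotate, ← conjDart_mul, pow_succ]

theorem turn_iterate (k : ℕ) (p q : G) : turn^[k] (p, q) = (p, p ^ k * q * (p ^ k)⁻¹) := by
  rw [Equiv.Perm.iterate_eq_pow, ← zpow_natCast, turn_zpow, zpow_natCast]

/-- A power of `α = x y` that commutes with `x` also commutes with `y = x⁻¹ α`, so fixing the dart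
is the same as fixing `x`. -/
theorem minimalPeriod_rotate_iterate_two (x y : G) :
    Function.minimalPeriod (rotate^[2]) (x, y) = Function.minimalPeriod turn (x * y, x) := by
  rw [Function.minimalPeriod_eq_minimalPeriod_iff]
  intro k
  unfold Function.IsPeriodicPt Function.IsFixedPt
  rw [rotate_iterate_two_iterate, turn_iterate, conjDart_apply]
  have hcomm : Commute ((x * y) ^ k) (x * y) := Commute.pow_self _ _
  rw [Prod.ext_iff, Prod.ext_iff, inv_pow, inv_inv]
  generalize hg : (x * y) ^ k = g at hcomm ⊢
  simp only [true_and]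
  have h1 : g⁻¹ * x * g = x ↔ g * x * g⁻¹ = x := by
    rw [mul_assoc, inv_mul_eq_iff_eq_mul, mul_inv_eq_iff_eq_mul, eq_comm]
  rw [h1, and_iff_left_iff_imp]
  intro h
  have h2 : Commute g x := mul_inv_eq_iff_eq_mul.1 h
  have h3 : Commute g y := by
    have := h2.inv_right.mul_right hcomm
    rwa [inv_mul_cancel_left] at this
  rw [mul_assoc, inv_mul_eq_iff_eq_mul]
  exact h3.symm

variable [Finite G]

/-- If `α ^ i` conjugates `y` to `x`, then `2 i` rotations and one rotation of `(x, y)` have the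
same first entry and product, so the period divides the odd number `2 i - 1`. Conversely, for period
`2 k + 1`, applying `2 k` rotations to the rotated dart gives back `(x, y)`, and its first entry
says that `α ^ k` conjugates `x` to `y`. -/
theorem mem_conjClass_mul_iff_odd (x y : G) :
    y ∈ conjClass (x * y) x ↔ Odd (Function.minimalPeriod rotate (x, y)) := by
  have hfst : ∀ (ω ω' : G × G), ω.1 = ω'.1 → ω.1 * ω.2 = ω'.1 * ω'.2 → ω = ω' := by
    intro ω ω' h1 h2
    rw [h1] at h2
    exact Prod.ext h1 (mul_left_cancel h2)
  have hconj : ∀ {a b c : G}, a * b * a⁻¹ = c → a⁻¹ * c * a = b := by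
    rintro a b c rfl
    group
  constructor
  · intro h
    obtain ⟨i, hi, -, h⟩ := (mem_conjClass_iff.1 h).symm.exists_pow_eq''
    rw [← zpow_natCast, turn_zpow, zpow_natCast] at h
    have h1 := congrArg Prod.snd h
    simp only at h1
    have h2 : rotate^[2 * i] (x, y) = rotate (x, y) := by
      apply hfst
      · rw [Function.iterate_mul, rotate_iterate_two_iterate, conjDart_apply, inv_pow, inv_inv,
          rotate_apply]
        exact hconj h1
      · rw [Equiv.Perm.iterate_eq_pow, rotate_pow_mul]
        simp [rotate_apply, mul_assoc]
    have h3 : Function.IsPeriodicPt rotate (2 * i - 1) (rotate (x, y)) := by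
      unfold Function.IsPeriodicPt Function.IsFixedPt
      rw [← Function.iterate_succ_apply, show (2 * i - 1).succ = 2 * i by omega, h2]
    have h4 := h3.minimalPeriod_dvd
    rw [minimalPeriod_apply_of_commute (fun _ => rfl)] at h4
    exact Odd.of_dvd_nat ⟨i - 1, by omega⟩ h4
  · rintro ⟨k, hk⟩
    have h := Function.iterate_minimalPeriod (f := rotate) (x := (x, y))
    rw [hk, Function.iterate_add_apply, Function.iterate_one, rotate_apply, Function.iterate_mul,
      rotate_iterate_two_iterate] at h
    have h1 : y * (y⁻¹ * x * y) = x * y := by simp [mul_assoc]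
    rw [h1, conjDart_apply, inv_pow, inv_inv] at h
    have h2 : ((x * y) ^ k)⁻¹ * y * (x * y) ^ k = x := congrArg Prod.fst h
    refine ⟨k, ?_⟩
    rw [zpow_natCast]
    have h3 := hconj (a := ((x * y) ^ k)⁻¹) (b := y) (c := x) (by rwa [inv_inv])
    rw [inv_inv] at h3
    exact h3.symm

theorem ncard_conjClass_mul (x y : G) : (conjClass (x * y) x).ncard =
    Function.minimalPeriod rotate (x, y) / (Function.minimalPeriod rotate (x, y)).gcd 2 := by
  rw [ncard_conjClass, ← minimalPeriod_rotate_iterate_two,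
    Function.minimalPeriod_iterate_eq_div_gcd two_ne_zero]

/-- With period `2 k + 1`, conjugation by `α ^ k` equals one rotation on `(x, y)`, and rotating
moves the tail to the head. -/
theorem exists_conjSheet_dartTail (h : y ∈ conjClass (x * y) x) :
    ∃ g ∈ Subgroup.closure {x, y}, dartHead (x, y) = conjSheet g (dartTail (x, y)) := by
  obtain ⟨k, hk⟩ := (mem_conjClass_mul_iff_odd x y).1 h
  have h := Function.iterate_minimalPeriod (f := rotate) (x := (x, y))
  have hx : x ∈ Subgroup.closure {x, y} := Subgroup.subset_closure (by simp)
  have hy : y ∈ Subgroup.closure {x, y} := Subgroup.subset_closure (by simp)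
  refine ⟨((x * y)⁻¹ ^ k)⁻¹, inv_mem (pow_mem (inv_mem (mul_mem hx hy)) k), ?_⟩
  have h1 : y * (y⁻¹ * x * y) = x * y := by simp [mul_assoc]
  rw [hk, Function.iterate_add_apply, Function.iterate_one, rotate_apply, Function.iterate_mul,
    rotate_iterate_two_iterate, h1] at h
  have h2 : conjDart ((x * y)⁻¹ ^ k)⁻¹ (x, y) = rotate (x, y) := by
    conv_lhs => rw [← h]
    rw [← conjDart_mul, inv_mul_cancel, conjDart_one, rotate_apply]
  rw [conjSheet_dartTail, h2, dartTail_rotate]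

theorem minimalPeriod_turn_of_mem_dartOrbit {ω : G × G} (hω : ω ∈ dartOrbit x y) :
    (Function.minimalPeriod turn ω = (conjClass x (x * y)).ncard ∧
      Function.minimalPeriod turn ω.swap = (conjClass y (x * y)).ncard) ∨
    (Function.minimalPeriod turn ω = (conjClass y (x * y)).ncard ∧
      Function.minimalPeriod turn ω.swap = (conjClass x (x * y)).ncard) := by
  rw [ncard_conjClass, ncard_conjClass, minimalPeriod_turn_mul_left, minimalPeriod_turn_mul_right]
  obtain ⟨g, -, rfl | rfl⟩ := hω
  · left
    rw [← conjDart_swap, minimalPeriod_turn_conjDart, minimalPeriod_turn_conjDart]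
    exact ⟨rfl, rfl⟩
  · right
    rw [← conjDart_swap, minimalPeriod_turn_conjDart, minimalPeriod_turn_conjDart]
    exact ⟨rfl, rfl⟩

theorem ncard_conjClass_eq_of_mem (hxy : x * y ≠ y * x) (h : y ∈ conjClass (x * y) x) :
    (conjClass y (x * y)).ncard = (conjClass x (x * y)).ncard := by
  obtain ⟨g, hg, h⟩ := exists_conjSheet_dartTail h
  rw [ncard_conjClass, ncard_conjClass, minimalPeriod_turn_mul_left, minimalPeriod_turn_mul_right,
    ← minimalPeriod_turn_conjDart g (x, y),
    ← valency_dartTail hxy (conjDart_mem_dartOrbit self_mem_dartOrbit hg), ← conjSheet_dartTail,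
    ← h, ← dartTail_swap, valency_dartTail hxy (swap_mem_dartOrbit self_mem_dartOrbit)]
  rfl

end ConjClass

/-! ### The genus and the case of two different valencies -/

section Surface

variable {G : Type*} [Group G] [Finite G] {x y : G}

theorem exists_genus (hxy : x * y ≠ y * x) :
    ∃ g : ℕ, IsClosedOrientedSurface (componentT x y) g ∧
      2 * g + (cellVertices (componentT x y) (typeTwo G)).ncard +
      (cellFaces (componentT x y) (typeTwo G)).ncard =
      (cellEdges (componentT x y) (typeTwo G)).ncard + 2 := by
  have h1 := finrank_homology₁_componentT hxy
  obtain ⟨k, hk⟩ := even_ncard_add hxy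
  have hlink : ∀ w, {w} ∈ (componentT x y).faces →
      ∃ n u, HasCircleLink (componentT x y) w n u := by
    intro w hw
    obtain ⟨ω, hω, rfl | rfl⟩ := (singleton_mem_componentT_iff hxy).1 hw
    · exact ⟨_, _, hasCircleLink_dartTail hxy hω⟩
    · exact ⟨_, _, hasCircleLink_dartFace hxy hω⟩
  obtain ⟨g, hg⟩ : ∃ g, Module.finrank ℚ (homology₁ (componentT x y)) = 2 * g :=
    ⟨Module.finrank ℚ (homology₁ (componentT x y)) / 2, by omega⟩
  exact ⟨g, ⟨isCompact_iff_compactSpace.1 (isCompact_realization _), inferInstance,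
    connectedSpace_realization ((singleton_mem_componentT_iff hxy).2
      ⟨_, self_mem_dartOrbit, Or.inl rfl⟩) (fun w hw => componentT_reachable hw),
    nonempty_chartedSpace_realization hlink, ⟨_, isOrientation_orientation hxy⟩, hg⟩, by omega⟩

/-- If the two valencies differ, then half of the darts start at a vertex of each valency. -/
theorem ncard_cellEdges_eq_mul (hxy : x * y ≠ y * x)
    (hne : (conjClass x (x * y)).ncard ≠ (conjClass y (x * y)).ncard) {l : ℕ}
    (hl : l = (conjClass x (x * y)).ncard ∨ l = (conjClass y (x * y)).ncard) :
    (cellEdges (componentT x y) (typeTwo G)).ncard =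
      l * {v | v ∈ cellVertices (componentT x y) (typeTwo G) ∧
        valency (componentT x y) (typeTwo G) v = l}.ncard := by
  rw [← ncard_valency_eq hxy]
  -- The two ends of an edge have the two different valencies, so the swap exchanges the darts
  -- leaving vertices of valency `l` with all others.
  have hcompl : {ω | ω ∈ dartOrbit x y ∧ Function.minimalPeriod turn ω ≠ l} =
      Prod.swap '' {ω | ω ∈ dartOrbit x y ∧ Function.minimalPeriod turn ω = l} := by
    have key : ∀ ω ∈ dartOrbit x y,
        (Function.minimalPeriod turn ω.swap = l ↔ Function.minimalPeriod turn ω ≠ l) := by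
      intro ω hω
      rcases minimalPeriod_turn_of_mem_dartOrbit hω with ⟨h1, h2⟩ | ⟨h1, h2⟩ <;> rw [h1, h2] <;>
        omega
    ext ω
    constructor
    · rintro ⟨hω, h⟩
      exact ⟨ω.swap, ⟨swap_mem_dartOrbit hω, (key ω hω).2 h⟩, Prod.swap_swap ω⟩
    · rintro ⟨ω', ⟨hω', h⟩, rfl⟩
      refine ⟨swap_mem_dartOrbit hω', fun h' => ?_⟩
      exact (key ω' hω').1 h' h
  have hunion : dartOrbit x y = {ω | ω ∈ dartOrbit x y ∧ Function.minimalPeriod turn ω = l} ∪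
      {ω | ω ∈ dartOrbit x y ∧ Function.minimalPeriod turn ω ≠ l} := by
    ext ω
    simp only [Set.mem_union, Set.mem_ofPred_eq]
    tauto
  have hcard := two_mul_ncard_cellEdges hxy
  have hsum : (dartOrbit x y).ncard =
      {ω | ω ∈ dartOrbit x y ∧ Function.minimalPeriod turn ω = l}.ncard +
      {ω | ω ∈ dartOrbit x y ∧ Function.minimalPeriod turn ω ≠ l}.ncard := by
    conv_lhs => rw [hunion]
    refine Set.ncard_union_eq ?_
    rw [Set.disjoint_left]
    exact fun ω h h' => h'.2 h.2
  rw [hcompl, Set.ncard_image_of_injective _ Prod.swap_injective] at hsum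
  omega

end Surface

end NoncommutingComplex

end

theorem mainTheorem3 {G : Type*} [Group G] [Finite G] (x y α : G) (hxy : x * y ≠ y * x)
    (hα : α = x * y)
    (T : PreAbstractSimplicialComplex (Sheet (complexX G)))
    (hT : T = componentT x y)
    (D : Set (Sheet (complexX G)))
    (hD : D = typeTwo G)
    (V E F : ℕ)
    (hV : V = (cellVertices T D).ncard)
    (hE : E = (cellEdges T D).ncard)
    (hF : F = (cellFaces T D).ncard)
    (lam : ℚ) (hlam : lam = averageValency T D)
    (l₁ l₂ : ℕ)
    (hl₁ : l₁ = (conjClass x α).ncard)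
    (hl₂ : l₂ = (conjClass y α).ncard)
    (V₁ V₂ : ℕ)
    (hV₁ : V₁ = {v | v ∈ cellVertices T D ∧
      valency T D v = l₁}.ncard)
    (hV₂ : V₂ = {v | v ∈ cellVertices T D ∧
      valency T D v = l₂}.ncard) :
    cornerFst x y ∈ cellVertices T D ∧
    cornerSnd x y ∈ cellVertices T D ∧
    cornerTwo x y ∈ cellFaces T D ∧
    ∃ g n : ℕ, 3 ≤ n ∧
      IsClosedOrientedSurface T g ∧
      IsNGonStructure T D n ∧
      FaceTransitive T D ∧
      EdgeTransitive T D ∧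
      -- `x` and `y` lie in different `α`-conjugacy classes
      (y ∉ conjClass α x →
        Even n ∧ n = 2 * (conjClass α x).ncard ∧
        (∀ w : cellVertices T D, ∃ φ ∈ cellAut T D,
          (φ.1 w).1 = cornerFst x y ∨
          (φ.1 w).1 = cornerSnd x y) ∧
        valency T D (cornerFst x y) = l₁ ∧ 2 ≤ l₁ ∧
        valency T D (cornerSnd x y) = l₂ ∧ 2 ≤ l₂ ∧
        (∀ v ∈ cellVertices T D,
          valency T D v = l₁ ∨ valency T D v = l₂) ∧
        (l₁ ≠ l₂ →
          V = V₁ + V₂ ∧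
          lam = ((l₁ : ℚ) * V₁ + (l₂ : ℚ) * V₂) / ((V₁ : ℚ) + V₂) ∧
          (∀ e ∈ cellEdges T D, ∃ u ∈ e, ∃ v ∈ e,
            valency T D u = l₁ ∧ valency T D v = l₂) ∧
          E = l₁ * V₁ ∧ E = l₂ * V₂) ∧
        2 ≤ lam ∧
        lam = 2 * (E : ℚ) / V ∧
        2 / lam = 1 / (l₁ : ℚ) + 1 / (l₂ : ℚ)) ∧
      -- `x` and `y` lie in the same `α`-conjugacy class
      (y ∈ conjClass α x →
        Odd n ∧ n = (conjClass α x).ncard ∧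
        VertexTransitive T D ∧
        (∀ v ∈ cellVertices T D, valency T D v = l₁) ∧
        lam = l₁ ∧ 2 ≤ l₁) ∧
      (n : ℚ) * F = 2 * E ∧
      (n : ℚ) * F = lam * V ∧
      (2 : ℚ) - 2 * g = (V : ℚ) - E + F ∧
      (V : ℚ) - E + F = 2 * (1 / lam + 1 / (n : ℚ) - 1 / 2) * E := by
  subst hα hT hD
  have hn3 : 3 ≤ Function.minimalPeriod rotate (x, y) :=
    three_le_minimalPeriod_rotate (ω := (x, y)) hxy
  have hVpos : 0 < V := by
    rw [hV, Set.ncard_pos]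
    exact ⟨_, (mem_cellVertices_iff hxy).2 ⟨_, self_mem_dartOrbit, rfl⟩⟩
  have hNE := two_mul_ncard_cellEdges hxy
  have hNF := mul_ncard_cellFaces hxy
  have hNV := two_mul_ncard_cellVertices_le hxy
  rw [averageValency_componentT hxy] at hlam
  rw [← hE] at hNE
  rw [← hF] at hNF
  rw [← hV] at hNV hlam
  have hlamV : lam * V = 2 * E := by
    rw [hlam, hNE]
    push_cast
    field_simp
  have hnF : (Function.minimalPeriod rotate (x, y) : ℚ) * F = 2 * E := by
    rw [hNF] at hNE
    exact_mod_cast hNE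
  have hlam2 : 2 ≤ lam := by
    rw [hlam, le_div_iff₀ (by exact_mod_cast hVpos)]
    exact_mod_cast hNV
  have hval : ∀ v ∈ cellVertices (componentT x y) (typeTwo G),
      valency (componentT x y) (typeTwo G) v = l₁ ∨
      valency (componentT x y) (typeTwo G) v = l₂ := by
    intro v hv
    obtain ⟨ω, hω, rfl⟩ := (mem_cellVertices_iff hxy).1 hv
    rw [valency_dartTail hxy hω, hl₁, hl₂]
    exact (minimalPeriod_turn_of_mem_dartOrbit hω).imp And.left And.left
  have hvalFst : valency (componentT x y) (typeTwo G) (cornerFst x y) = l₁ := by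
    rw [hl₁, ncard_conjClass, minimalPeriod_turn_mul_left]
    exact valency_dartTail hxy (ω := (x, y)) self_mem_dartOrbit
  have hvalSnd : valency (componentT x y) (typeTwo G) (cornerSnd x y) = l₂ := by
    rw [hl₂, ncard_conjClass, minimalPeriod_turn_mul_right]
    exact valency_dartTail hxy (ω := (y, x)) (swap_mem_dartOrbit self_mem_dartOrbit)
  have hl₁2 : 2 ≤ l₁ := by
    rw [hl₁, ncard_conjClass, minimalPeriod_turn_mul_left]
    exact two_le_minimalPeriod_turn (ω := (x, y)) hxy
  have hl₂2 : 2 ≤ l₂ := by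
    rw [hl₂, ncard_conjClass, minimalPeriod_turn_mul_right]
    exact two_le_minimalPeriod_turn (ω := (y, x)) hxy.symm
  -- Used in the second case and also in the first one when `l₁ = l₂`, where the count of edges by
  -- valency fails.
  have hconst : (∀ v ∈ cellVertices (componentT x y) (typeTwo G),
      valency (componentT x y) (typeTwo G) v = l₁) → lam = l₁ := by
    intro h
    have h1 := sum_valency hxy
    rw [Finset.sum_congr rfl (g := fun _ => l₁) fun v hv =>
      h v (by rw [← coe_image_dartTail hxy]; exact hv), Finset.sum_const, smul_eq_mul,
      ← Set.ncard_coe_finset, coe_image_dartTail hxy, ← hV] at h1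
    rw [hlam, ← h1]
    push_cast
    field_simp
  have hVE : (V : ℚ) ≠ 0 := by exact_mod_cast hVpos.ne'
  have hlam0 : lam ≠ 0 := by linarith
  have hl₁0 : (l₁ : ℚ) ≠ 0 := by norm_cast; omega
  have hl₂0 : (l₂ : ℚ) ≠ 0 := by norm_cast; omega
  obtain ⟨g, hg, hχ⟩ := exists_genus hxy
  rw [← hV, ← hE, ← hF] at hχ
  have hχ' : (2 : ℚ) - 2 * g = (V : ℚ) - E + F := by
    have : (2 * g + V + F : ℚ) = E + 2 := by exact_mod_cast hχ
    linarith
  refine ⟨(mem_cellVertices_iff hxy).2 ⟨_, self_mem_dartOrbit, rfl⟩,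
    (mem_cellVertices_iff hxy).2 ⟨_, swap_mem_dartOrbit self_mem_dartOrbit, rfl⟩,
    (mem_cellFaces_iff hxy).2 ⟨_, self_mem_dartOrbit, rfl⟩, g,
    Function.minimalPeriod rotate (x, y), hn3, hg, isNGonStructure_componentT hxy,
    faceTransitive_componentT hxy, edgeTransitive_componentT hxy, ?_, ?_, hnF,
    hnF.trans hlamV.symm, hχ', ?_⟩
  · intro hy
    rw [mem_conjClass_mul_iff_odd, Nat.not_odd_iff_even] at hy
    have hhalves : l₁ ≠ l₂ → V = V₁ + V₂ ∧ E = l₁ * V₁ ∧ E = l₂ * V₂ := by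
      intro hne
      have hne' := hne
      rw [hl₁, hl₂] at hne'
      refine ⟨?_, ?_, ?_⟩
      · rw [hV, hV₁, hV₂, ← Set.ncard_union_eq]
        · congr 1
          ext v
          constructor
          · exact fun hv => (hval v hv).imp (fun h => ⟨hv, h⟩) (fun h => ⟨hv, h⟩)
          · rintro (h | h) <;> exact h.1
        · rw [Set.disjoint_left]
          exact fun v h h' => hne (h.2.symm.trans h'.2)
      · rw [hE, hV₁]
        exact ncard_cellEdges_eq_mul hxy hne' (Or.inl hl₁)
      · rw [hE, hV₂]
        exact ncard_cellEdges_eq_mul hxy hne' (Or.inr hl₂)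
    refine ⟨hy, ?_, vertex_orbit hxy, hvalFst, hl₁2, hvalSnd, hl₂2, hval, ?_, hlam2, ?_, ?_⟩
    · rw [ncard_conjClass_mul, Nat.gcd_eq_right hy.two_dvd, Nat.mul_div_cancel' hy.two_dvd]
    · intro hne
      obtain ⟨h1, h2, h3⟩ := hhalves hne
      refine ⟨h1, ?_, ?_, h2, h3⟩
      · have h2' : (E : ℚ) = l₁ * V₁ := by exact_mod_cast h2
        have h3' : (E : ℚ) = l₂ * V₂ := by exact_mod_cast h3
        have h1' : (V : ℚ) = V₁ + V₂ := by exact_mod_cast h1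
        rw [← h2', ← h3', ← h1', eq_div_iff hVE, hlamV]
        ring
      · intro e he
        obtain ⟨ω, hω, rfl⟩ := (mem_cellEdges_iff hxy).1 he
        have e1 := valency_dartTail hxy hω
        have e2 : valency (componentT x y) (typeTwo G) (dartHead ω) = _ :=
          valency_dartTail hxy (swap_mem_dartOrbit hω)
        rcases minimalPeriod_turn_of_mem_dartOrbit hω with ⟨h1, h2⟩ | ⟨h1, h2⟩
        · exact ⟨dartTail ω, by simp, dartHead ω, by simp, by rw [e1, h1, hl₁],
            by rw [e2, h2, hl₂]⟩
        · exact ⟨dartHead ω, by simp, dartTail ω, by simp, by rw [e2, h2, hl₁],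
            by rw [e1, h1, hl₂]⟩
    · rw [eq_div_iff hVE, hlamV]
    -- For different valencies the harmonic mean comes from `2 / λ = V / E` and `V = E / l₁ + E /
    -- l₂`.
    · by_cases hne : l₁ = l₂
      · rw [hconst fun v hv => (hval v hv).elim id fun h => h.trans hne.symm, ← hne]
        ring
      · obtain ⟨h1, h2, h3⟩ := hhalves hne
        have h2' : (E : ℚ) = l₁ * V₁ := by exact_mod_cast h2
        have h3' : (E : ℚ) = l₂ * V₂ := by exact_mod_cast h3
        have h1' : (V : ℚ) = V₁ + V₂ := by exact_mod_cast h1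
        have hE0 : (E : ℚ) ≠ 0 := by
          intro h0
          rw [h0, mul_zero] at hlamV
          exact mul_ne_zero hlam0 hVE hlamV
        have e1 : (V₁ : ℚ) = E / l₁ := by rw [h2']; field_simp
        have e2 : (V₂ : ℚ) = E / l₂ := by rw [h3']; field_simp
        have e3 : lam = 2 * E / V := by rw [eq_div_iff hVE, hlamV]
        have e4 : 2 / lam = V / E := by rw [e3]; field_simp
        rw [e4, h1', e1, e2]
        field_simp
  · intro hy
    have hodd := (mem_conjClass_mul_iff_odd x y).1 hy
    obtain ⟨h, hh, hhead⟩ := exists_conjSheet_dartTail hy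
    have hl : l₂ = l₁ := by rw [hl₁, hl₂, ncard_conjClass_eq_of_mem hxy hy]
    have hval' : ∀ v ∈ cellVertices (componentT x y) (typeTwo G),
        valency (componentT x y) (typeTwo G) v = l₁ := fun v hv =>
      (hval v hv).elim id fun h => h.trans hl
    refine ⟨hodd, ?_, vertexTransitive_componentT hxy hh hhead, hval', hconst hval', hl₁2⟩
    rw [ncard_conjClass_mul, (Nat.coprime_two_right.2 hodd).gcd_eq_one, Nat.div_one]
  · have hn0 : (Function.minimalPeriod rotate (x, y) : ℚ) ≠ 0 := by norm_cast; omega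
    have e1 : (V : ℚ) = 2 * E / lam := by rw [eq_div_iff hlam0, mul_comm, hlamV]
    have e2 : (F : ℚ) = 2 * E / Function.minimalPeriod rotate (x, y) := by
      rw [eq_div_iff hn0, mul_comm, hnF]
    rw [e1, e2]
    ring
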